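/- **Setting.** Let $\Omega\subset\mathbb R^2$ be a polygonal domain (a bounded open set with $\Omega=\operatorname{int}\overline\Omega$, triangulated as below), with coordinates $(x,y)$ and unit outward normal $n=(n_1,n_2)$, and put $\partial_0\Omega=\{n_1\ne0\}$, $\partial_-\Omega=\{z\in\partial\Omega\setminus\partial_0\Omega: xn_2<0\}$, $\partial_+\Omega=\{z\in\partial\Omega\setminus\partial_0\Omega: xn_2\ge0\}$. Assume $xn_2\ge 0$ on $\partial_0\Omega$ (e.g. $n_2=0$ there). Let $\mathcal T$ be a finite family of mutually disjoint open triangles with $\bigcup_{T}\overline T=\overline\Omega$, $h_T=\operatorname{diam}T\le 1$; for $T\in\mathcal T$ let $\partial_-T=\{z\in\partial T:xn_2<0\}$, $\partial_+T=\{z\in\partial T:xn_2\ge0\}$ with the normal of $T$. For $p\ge1$ let $$V_h=\{v\in H^1(\Omega): v|_{\partial_-\Omega}=0,\ v|_T\in\mathbb P_p(T)\ \forall T\in\mathcal T\},$$ where $\mathbb P_p$ denotes polynomials of total degree at most $p$. Write $(\cdot,\cdot)_\omega$, $\|\cdot\|_\omega$ for the $L_2(\omega)$ inner product and norm, omitting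 $\omega=\Omega$. **Inverse inequalities.** Let $C_{inv},C_{INV}>0$ be such that for all $T\in\mathcal T$, $v\in\mathbb P_p(T)$, $$\|v\|_{\partial T}^2\le C_{inv}\,p^2h_T^{-1}\|v\|_T^2,\qquad \|\nabla v\|_T\le C_{INV}\,p^2h_T^{-1}\|v\|_T .$$ Such constants exist depending only on shape-regularity: for every $\sigma>0$ there are $C_{inv},C_{INV}>0$ for which both inequalities hold for all $p\ge1$ and all triangles $T$ containing a disc of radius $\sigma h_T$. **Form and norm.** Let $L u=-u_{xx}+xu_y$ and, elementwise on each $T\in\mathcal T$, $$\delta_T=C_\delta^T\frac{p^4}{h_T^2},\quad C_\delta^T=\frac{C_{inv}^2}{6}\Big(3\|xn_2\|_{L_\infty(\partial_-T)}+2\|n_1\|_{L_\infty(\partial T)}^2\Big),\quad \tau_T=\frac{h_T^2}{4C_{INV}^2p^4},$$ $$\alpha=\frac1{8\delta},\quad \beta=\frac1{24\delta^2},\quad \gamma=\frac1{64\delta^3},\quad A=\begin{pmatrix}\alpha&\beta\\ \beta&\gamma\end{pmatrix}.$$ For functions $U,V$ of time with values in $V_h$, let $$a_h(U,V)=(U_x,V_x)+(xU_y,V)+\sum_{T}(U_t+LU,\tau(V_t+xV_y))_T+\sum_{T}(\nabla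 LU,A\nabla V)_T,$$ $$|||w|||^2=\tfrac12\|w_x\|^2+\|\sqrt{\gamma\delta}\,w_y\|^2+\tfrac12\|\sqrt\tau(w_t+xw_y)\|^2+\sum_T\|\sqrt A\nabla w_x\|_T^2+\|\sqrt{xn_2}\,w\|_{\partial_+\Omega}^2+\sum_T\|\sqrt{xn_2A}\,\nabla w\|_{\partial_+T}^2 .$$ **Lemma ((hypo)coercivity).** For every differentiable $w:(t_0,t_1]\to V_h$, at every time in $(t_0,t_1]$, $$a_h(w,w)\ \ge\ \tfrac14\,|||w|||^2 .$$ -/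

import Mathlib

open MeasureTheory Set Topology
open scoped ENNReal ContDiff

noncomputable section

/-- The Euclidean plane; the coordinates of `z` are `x = z 0` and `y = z 1`. -/
abbrev Plane : Type := EuclideanSpace ℝ (Fin 2)

/-- Arc length (one-dimensional Hausdorff measure) in the plane. -/
abbrev arcLength : Measure Plane := Measure.hausdorffMeasure 1

/-! ### Differential operators -/

/-- The partial derivative in the `i`-th coordinate direction. -/
def pd (i : Fin 2) (f : Plane → ℝ) (z : Plane) : ℝ :=
  fderiv ℝ f z (EuclideanSpace.single i 1)

/-- The gradient as a coordinate vector. -/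
def grad (f : Plane → ℝ) (z : Plane) : Fin 2 → ℝ := fun i => pd i f z

/-- The spatial operator `L u = - u_xx + x u_y`. -/
def kolmogorovOp (u : Plane → ℝ) (z : Plane) : ℝ :=
  - pd 0 (pd 0 u) z + z 0 * pd 1 u z

/-- The value `v ⬝ A v = |√A v| ^ 2` of the quadratic form of a symmetric positive semidefinite
matrix `A`. -/
def quadForm (A : Matrix (Fin 2) (Fin 2) ℝ) (v : Fin 2 → ℝ) : ℝ := v ⬝ᵥ A.mulVec v

/-! ### Normals and parts of the boundary -/

/-- `n` is the unit outward normal of `S` at `z`, where `z` is a flat boundary point: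
near `z` the set `S` is the open half-plane `{ζ | (ζ - z) ⬝ n < 0}`. All boundary points of an open
polygonal set except its corners are of this kind. -/
def IsOutwardNormal (S : Set Plane) (z n : Plane) : Prop :=
  ‖n‖ = 1 ∧ ∃ r > 0, ∀ ζ ∈ Metric.ball z r, ζ ∈ S ↔ inner ℝ (ζ - z) n < 0

open Classical in
/-- The unit outward normal of `S` at `z` (zero at the corners, a set of zero length). -/
def outwardNormal (S : Set Plane) (z : Plane) : Plane :=
  if h : ∃ n, IsOutwardNormal S z n then h.choose else 0

/-- The normal component `x n₂` of the transport field `(0, x)`. -/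
def normalFlux (S : Set Plane) (z : Plane) : ℝ := z 0 * outwardNormal S z 1

/-- The elliptic part `∂₀Ω` of the boundary, where `n₁ ≠ 0`. -/
def ellipticBoundary (Ω : Set Plane) : Set Plane :=
  {z ∈ frontier Ω | outwardNormal Ω z 0 ≠ 0}

/-- `∂₋Ω`: the points of `∂Ω` off `∂₀Ω` with `x n₂ < 0`. -/
def inflowBoundary (Ω : Set Plane) : Set Plane :=
  {z ∈ frontier Ω \ ellipticBoundary Ω | normalFlux Ω z < 0}

/-- `∂₊Ω`: the points of `∂Ω` off `∂₀Ω` with `x n₂ ≥ 0`. -/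
def outflowBoundary (Ω : Set Plane) : Set Plane :=
  {z ∈ frontier Ω \ ellipticBoundary Ω | 0 ≤ normalFlux Ω z}

/-- `∂₋T` for an element `T`: all boundary points with `x n₂ < 0`. -/
def elementInflow (T : Set Plane) : Set Plane := {z ∈ frontier T | normalFlux T z < 0}

/-- `∂₊T` for an element `T`: all boundary points with `x n₂ ≥ 0`. -/
def elementOutflow (T : Set Plane) : Set Plane := {z ∈ frontier T | 0 ≤ normalFlux T z}

/-! ### Sobolev space with vanishing inflow trace -/

/-- `g` is the weak partial derivative of `v` on `Ω` in direction `i`. -/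
def IsWeakPartial (Ω : Set Plane) (i : Fin 2) (v g : Plane → ℝ) : Prop :=
  ∀ φ : Plane → ℝ, ContDiff ℝ ∞ φ → HasCompactSupport φ → tsupport φ ⊆ Ω →
    ∫ z in Ω, v z * pd i φ z = - ∫ z in Ω, g z * φ z

/-- `v ∈ H¹(Ω)`. -/
def MemH1 (Ω : Set Plane) (v : Plane → ℝ) : Prop :=
  MemLp v 2 (volume.restrict Ω) ∧
    ∀ i, ∃ g, MemLp g 2 (volume.restrict Ω) ∧ IsWeakPartial Ω i v g

/-- `g ∈ L²(∂Ω)` is the trace of `v ∈ H¹(Ω)` on `∂Ω`, characterised through the Gauss-Green formula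
`∫_Ω (v ∂ᵢφ + ∂ᵢv φ) = ∫_∂Ω g φ nᵢ` for all test functions `φ` on the plane. -/
def IsTrace (Ω : Set Plane) (v g : Plane → ℝ) : Prop :=
  MemLp g 2 (arcLength.restrict (frontier Ω)) ∧
    ∀ i, ∃ G, MemLp G 2 (volume.restrict Ω) ∧ IsWeakPartial Ω i v G ∧
      ∀ φ : Plane → ℝ, ContDiff ℝ ∞ φ → HasCompactSupport φ →
        ∫ z in Ω, (v z * pd i φ z + G z * φ z) =
          ∫ z in frontier Ω, g z * φ z * outwardNormal Ω z i ∂arcLength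

open Classical in
/-- The trace of `v` on `∂Ω` (determined up to sets of zero length). -/
def boundaryTrace (Ω : Set Plane) (v : Plane → ℝ) : Plane → ℝ :=
  if h : ∃ g, IsTrace Ω v g then h.choose else 0

/-- `v ∈ H¹₋(Ω)`: the functions of `H¹(Ω)` whose trace vanishes on `∂₋Ω`. -/
def MemH1Minus (Ω : Set Plane) (v : Plane → ℝ) : Prop :=
  MemH1 Ω v ∧ ∃ g, IsTrace Ω v g ∧ ∀ᵐ z ∂(arcLength.restrict (inflowBoundary Ω)), g z = 0

/-! ### Triangulations and finite elements -/

/-- The open triangle with the vertices of `t`. -/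
def openTriangle (t : Affine.Triangle ℝ Plane) : Set Plane :=
  interior (convexHull ℝ (Set.range t.points))

/-- The diameter `h_T`. -/
def meshSize (t : Affine.Triangle ℝ Plane) : ℝ := Metric.diam (openTriangle t)

/-- Finitely many mutually disjoint open triangles whose closures cover the closure of `Ω`
exactly. Hanging nodes are not excluded. -/
structure Triangulation (Ω : Set Plane) where
  elements : Finset (Affine.Triangle ℝ Plane)
  disjoint : (elements : Set (Affine.Triangle ℝ Plane)).PairwiseDisjoint openTriangle
  cover : ⋃ t ∈ elements, closure (openTriangle t) = closure Ω

/-- The largest disc inscribed in the triangle has radius at least `σ h_T`. -/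
def ShapeRegular (σ : ℝ) (t : Affine.Triangle ℝ Plane) : Prop :=
  ∃ c : Plane, Metric.ball c (σ * meshSize t) ⊆ openTriangle t

/-- The polynomial function on the plane defined by `q`. -/
def polyFun (q : MvPolynomial (Fin 2) ℝ) (z : Plane) : ℝ := MvPolynomial.eval (fun i => z i) q

/-- The finite element space `V_h^p` (the values off the open elements, a null set of `Ω`,
are immaterial). -/
def feSpace (Ω : Set Plane) (M : Triangulation Ω) (p : ℕ) : Set (Plane → ℝ) :=
  {v | MemH1Minus Ω v ∧ ∀ t ∈ M.elements, ∃ q : MvPolynomial (Fin 2) ℝ,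
    q.totalDegree ≤ p ∧ ∀ z ∈ openTriangle t, v z = polyFun q z}

/-- `w : J → V_h` is differentiable with derivative `w' : J → V_h`. As `V_h` is finite-dimensional,
pointwise convergence of the difference quotients on the elements is convergence in `V_h`. -/
def IsTimeDerivative (Ω : Set Plane) (M : Triangulation Ω) (p : ℕ) (J : Set ℝ)
    (w w' : ℝ → Plane → ℝ) : Prop :=
  ∀ t ∈ J, w t ∈ feSpace Ω M p ∧ w' t ∈ feSpace Ω M p ∧
    ∀ T ∈ M.elements, ∀ z ∈ openTriangle T, HasDerivWithinAt (fun s => w s z) (w' t z) J t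

/-! ### Inverse inequalities and parameters -/

/-- `‖v‖²_∂T ≤ C p² h_T⁻¹ ‖v‖²_T` for all polynomials `v` of total degree at most `p`. -/
def TraceInverse (C : ℝ) (p : ℕ) (t : Affine.Triangle ℝ Plane) : Prop :=
  ∀ q : MvPolynomial (Fin 2) ℝ, q.totalDegree ≤ p →
    ∫ z in frontier (openTriangle t), polyFun q z ^ 2 ∂arcLength ≤
      C * (p : ℝ) ^ 2 / meshSize t * ∫ z in openTriangle t, polyFun q z ^ 2

/-- `‖∇v‖_T ≤ C p² h_T⁻¹ ‖v‖_T` for all polynomials `v` of total degree at most `p`. -/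
def GradInverse (C : ℝ) (p : ℕ) (t : Affine.Triangle ℝ Plane) : Prop :=
  ∀ q : MvPolynomial (Fin 2) ℝ, q.totalDegree ≤ p →
    Real.sqrt (∫ z in openTriangle t, (pd 0 (polyFun q) z ^ 2 + pd 1 (polyFun q) z ^ 2)) ≤
      C * (p : ℝ) ^ 2 / meshSize t * Real.sqrt (∫ z in openTriangle t, polyFun q z ^ 2)

/-- The norm of `f` in `L_∞(S)` for a part `S` of a boundary. -/
def supNormOn (S : Set Plane) (f : Plane → ℝ) : ℝ :=
  (eLpNorm f ∞ (arcLength.restrict S)).toReal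

/-- `C_δ^T = C² / 6 * (3 ‖x n₂‖_{L_∞(∂₋T)} + 2 ‖n₁‖²_{L_∞(∂T)})`. -/
def deltaConst (C : ℝ) (t : Affine.Triangle ℝ Plane) : ℝ :=
  C ^ 2 / 6 *
    (3 * supNormOn (elementInflow (openTriangle t)) (normalFlux (openTriangle t)) +
      2 * supNormOn (frontier (openTriangle t))
        (fun z => outwardNormal (openTriangle t) z 0) ^ 2)

/-! ### The stabilised form and the energy norm -/

/-- The form `a_{h,SUPG}(U, V)` at a fixed time; `U'` and `V'` are the time derivatives of `U` and
`V` at that time. On `V_h` the weak first derivatives are the elementwise ones almost everywhere. -/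
def supgForm (Ω : Set Plane) (M : Triangulation Ω) (τ : Affine.Triangle ℝ Plane → ℝ)
    (U U' V V' : Plane → ℝ) : ℝ :=
  (∫ z in Ω, pd 0 U z * pd 0 V z) + (∫ z in Ω, z 0 * pd 1 U z * V z) +
    ∑ t ∈ M.elements, ∫ z in openTriangle t,
      (U' z + kolmogorovOp U z) * (τ t * (V' z + z 0 * pd 1 V z))

/-- The form `a_h(U, V) = a_{h,SUPG}(U, V) + ∑_T (∇LU, A∇V)_T` at a fixed time. -/
def stabForm (Ω : Set Plane) (M : Triangulation Ω)
    (A : Affine.Triangle ℝ Plane → Matrix (Fin 2) (Fin 2) ℝ)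
    (τ : Affine.Triangle ℝ Plane → ℝ) (U U' V V' : Plane → ℝ) : ℝ :=
  supgForm Ω M τ U U' V V' +
    ∑ t ∈ M.elements, ∫ z in openTriangle t,
      grad (kolmogorovOp U) z ⬝ᵥ (A t).mulVec (grad V z)

/-- The boundary values on `∂T` of the gradient of `w`, taken from inside `T`. -/
def innerGrad (T : Set Plane) (w : Plane → ℝ) (z : Plane) : Fin 2 → ℝ :=
  fun i => extendFrom T (pd i w) z

/-- The energy norm `|||w|||` at a fixed time, `w'` being the time derivative of `w`. -/
def energyNorm (Ω : Set Plane) (M : Triangulation Ω)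
    (A : Affine.Triangle ℝ Plane → Matrix (Fin 2) (Fin 2) ℝ)
    (γ δ τ : Affine.Triangle ℝ Plane → ℝ) (w w' : Plane → ℝ) : ℝ :=
  Real.sqrt
    (1 / 2 * (∫ z in Ω, pd 0 w z ^ 2)
      + (∑ t ∈ M.elements, ∫ z in openTriangle t, γ t * δ t * pd 1 w z ^ 2)
      + 1 / 2 * (∑ t ∈ M.elements, ∫ z in openTriangle t, τ t * (w' z + z 0 * pd 1 w z) ^ 2)
      + (∑ t ∈ M.elements, ∫ z in openTriangle t, quadForm (A t) (grad (pd 0 w) z))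
      + (∫ z in outflowBoundary Ω, normalFlux Ω z * boundaryTrace Ω w z ^ 2 ∂arcLength)
      + ∑ t ∈ M.elements, ∫ z in elementOutflow (openTriangle t),
          normalFlux (openTriangle t) z *
            quadForm (A t) (innerGrad (openTriangle t) w z) ∂arcLength)

end

/-! Diffusion acts in `x` only, so control of `w_y` must come from the commutator of `∂_x` with `x
∂_y`, which is `∂_y`. Indeed `∇(x w_y) = (w_y, 0) + x ∂_y ∇w`, and testing the first summand with
`A∇w` gives `α (w_x, w_y) + β ‖w_y‖²`: the off-diagonal entry of `A` produces the missing
derivative.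

The other stabilisation terms are integrated by parts on each triangle. The part `-∇w_xx` yields
`‖√A∇w_x‖²` and a boundary term with `n₁`; the part `x ∂_y ∇w` yields half the boundary flux of
`|√A∇w|²`. Since `A∇w` may jump between elements, nothing cancels, and the terms of the wrong sign
are absorbed by the trace inverse inequality. With `K = C_inv p²/h`, `m = ‖x n₂‖` on the inflow part
and `N = ‖n₁‖`, the loss is at most `3/4 ‖√A∇w_x‖² + K² (m/2 + N²/3) ‖√A∇w‖²`, and the last factor
is exactly `δ`. The entries of `δA` are `1/8`, `1/(24δ)`, `1/(64δ²)`, small enough for `‖w_x‖²` and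
`β ‖w_y‖²` to absorb it (`coercivity_arithmetic`). The streamline term costs a further `1/8 ‖w_x‖²`
(`triIntegral_supg_ge`); `element_coercivity` adds up the budget.

The remaining term `(x w_y, w)` is global and needs conformity. Subtracting the elementwise Green
formulas from the one that defines the trace shows that `w` has no jumps across interior edges
(`IsTrace.ae_skeletonSum_eq`). Hence the term is half the flux of `w²` through `∂Ω`, whose density
is nonnegative because the trace vanishes on the inflow part (`setIntegral_outflowBoundary_le`).

For the inverse inequalities, an `L²` Markov inequality on an interval, obtained from Legendre
polynomials, is applied along the lines of three parallelograms that cover the triangle. The trace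
inequality then follows from the divergence theorem for a radial field centred at the inscribed
disc. -/

noncomputable section

/-! ### The Markov inequality in `L²(0, 1)` -/

section Markov

open Polynomial

/-- The integral over the unit interval as a linear functional on polynomials. -/
def unitIntegral : ℝ[X] →ₗ[ℝ] ℝ where
  toFun q := ∫ x in (0 : ℝ)..1, q.eval x
  map_add' p q := by
    simp only [eval_add]
    exact intervalIntegral.integral_add (p.continuous.intervalIntegrable _ _)
      (q.continuous.intervalIntegrable _ _)
  map_smul' c q := by
    simp [eval_smul]

lemma unitIntegral_apply (q : ℝ[X]) : unitIntegral q = ∫ x in (0 : ℝ)..1, q.eval x := rfl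

lemma unitIntegral_derivative (q : ℝ[X]) :
    unitIntegral (derivative q) = q.eval 1 - q.eval 0 := by
  rw [unitIntegral_apply]
  exact intervalIntegral.integral_eq_sub_of_hasDerivAt (fun x _ => q.hasDerivAt x)
    ((derivative q).continuous.intervalIntegrable _ _)

lemma unitIntegral_mul_self_nonneg (q : ℝ[X]) : 0 ≤ unitIntegral (q * q) := by
  rw [unitIntegral_apply]
  refine intervalIntegral.integral_nonneg zero_le_one fun x _ => ?_
  rw [eval_mul]
  exact mul_self_nonneg _

lemma eq_zero_of_unitIntegral_mul_self {q : ℝ[X]} (h : unitIntegral (q * q) = 0) : q = 0 := by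
  rw [unitIntegral_apply] at h
  by_contra hq
  have hpos : 0 < ∫ x in (0 : ℝ)..1, (q * q).eval x := by
    obtain ⟨x, hx, hx'⟩ : ∃ x ∈ Icc (0 : ℝ) 1, ¬ q.IsRoot x := by
      by_contra! hall
      exact hq (q.eq_zero_of_infinite_isRoot
        ((Icc_infinite (zero_lt_one (α := ℝ))).mono fun x hx => hall x hx))
    refine intervalIntegral.integral_pos zero_lt_one (q * q).continuous.continuousOn
      (fun x _ => ?_) ⟨x, hx, ?_⟩
    · rw [eval_mul]; exact mul_self_nonneg _
    · rw [eval_mul]; exact mul_self_pos.2 hx'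
  exact hpos.ne' h

/-- The Legendre operator `- (x (1 - x) q')'` of the unit interval. -/
def legendreOp (q : ℝ[X]) : ℝ[X] := - derivative ((X - X ^ 2) * derivative q)

/-- On monomials the operator is triangular with diagonal `m (m + 1)`. So it respects degree bounds,
and the eigenvalue of an eigenpolynomial is read off its leading coefficient. -/
lemma coeff_legendreOp (q : ℝ[X]) (m : ℕ) :
    (legendreOp q).coeff m = (m : ℝ) * (m + 1) * q.coeff m - (m + 1) ^ 2 * q.coeff (m + 1) := by
  rw [legendreOp, coeff_neg, coeff_derivative, sub_mul, coeff_sub, coeff_X_mul, coeff_derivative,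
    pow_two, mul_assoc, coeff_X_mul]
  cases m with
  | zero => simp
  | succ k => rw [coeff_X_mul, coeff_derivative]; push_cast; ring

lemma degree_legendreOp_lt {q : ℝ[X]} {n : ℕ} (h : q.degree < n) : (legendreOp q).degree < n := by
  rw [degree_lt_iff_coeff_zero] at h ⊢
  intro m hm
  rw [coeff_legendreOp, h m hm, h (m + 1) (by omega)]
  ring

/-- Self-adjointness: the two integrands differ by an exact derivative of terms carrying the weight
`x (1 - x)`, which vanishes at both endpoints. -/
lemma unitIntegral_legendreOp_mul (p q : ℝ[X]) :
    unitIntegral (legendreOp p * q) = unitIntegral (p * legendreOp q) := by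
  have h1 := unitIntegral_derivative ((X - X ^ 2) * derivative p * q)
  have h2 := unitIntegral_derivative ((X - X ^ 2) * derivative q * p)
  simp only [eval_mul, eval_sub, eval_X, eval_pow] at h1 h2
  have h3 : legendreOp p * q - p * legendreOp q =
      derivative ((X - X ^ 2) * derivative q * p) - derivative ((X - X ^ 2) * derivative p * q) := by
    rw [legendreOp, legendreOp, derivative_mul (f := (X - X ^ 2) * derivative q),
      derivative_mul (f := (X - X ^ 2) * derivative p)]
    ring
  have h4 := congrArg unitIntegral h3
  rw [map_sub, map_sub, h1, h2] at h4
  norm_num at h4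
  linarith

/-- The inner product is definite, so on polynomials of degree below `n` every functional is
represented; subtracting from `X ^ n` the representer of `r ↦ ∫ X ^ n r` gives the Legendre
polynomial. -/
lemma exists_monic_orthogonal (n : ℕ) :
    ∃ e : ℝ[X], e.natDegree ≤ n ∧ e.coeff n = 1 ∧
      ∀ r : ℝ[X], r.degree < n → unitIntegral (e * r) = 0 := by
  let V := degreeLT ℝ n
  let B : V →ₗ[ℝ] Module.Dual ℝ V :=
    (((LinearMap.mul ℝ ℝ[X]).compr₂ unitIntegral).domRestrict₁₂ V V)
  have hB : ∀ s r : V, B s r = unitIntegral (s.1 * r.1) := fun s r => rfl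
  have : FiniteDimensional ℝ V := FiniteDimensional.of_injective _ (degreeLTEquiv ℝ n).injective
  have hinj : Function.Injective B := by
    rw [← LinearMap.ker_eq_bot, LinearMap.ker_eq_bot']
    intro s hs
    have := hB s s
    rw [hs] at this
    exact Subtype.ext (eq_zero_of_unitIntegral_mul_self this.symm)
  have hsurj : Function.Surjective B :=
    (LinearMap.injective_iff_surjective_of_finrank_eq_finrank
      (Subspace.dual_finrank_eq (K := ℝ) (V := V)).symm).1 hinj
  obtain ⟨s, hs⟩ := hsurj
    ((unitIntegral.comp (LinearMap.mulLeft ℝ (X ^ n : ℝ[X]))).domRestrict V)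
  have hsn := mem_degreeLT.1 s.2
  refine ⟨X ^ n - s.1, ?_, ?_, fun r hr => ?_⟩
  · refine (natDegree_sub_le _ _).trans (max_le (by simp) ?_)
    exact natDegree_le_of_degree_le hsn.le
  · rw [coeff_sub, coeff_X_pow_self, coeff_eq_zero_of_degree_lt hsn, sub_zero]
  · have := LinearMap.congr_fun hs ⟨r, mem_degreeLT.2 hr⟩
    rw [hB] at this
    rw [sub_mul, map_sub, this]
    exact sub_self _

/-- Orthogonality to lower degrees reduces both integrals to endpoint values: `∫ e'² = c (e(1)² +
e(0)²)` with `c = n (n + 1)`, and `(4n + 2) ∫ e² = e(1)² + e(0)²`. -/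
lemma unitIntegral_derivative_sq_of_orthogonal {n : ℕ} {e : ℝ[X]} (hn : e.natDegree ≤ n)
    (h1 : e.coeff n = 1) (ho : ∀ r : ℝ[X], r.degree < n → unitIntegral (e * r) = 0) :
    unitIntegral (derivative e * derivative e) =
      (n : ℝ) * (n + 1) * (4 * n + 2) * unitIntegral (e * e) := by
  have hc : ∀ m, n < m → e.coeff m = 0 := fun m hm =>
    coeff_eq_zero_of_natDegree_lt (hn.trans_lt hm)
  have hd : (derivative e).degree < n := by
    rw [degree_lt_iff_coeff_zero]
    intro m hm
    rw [coeff_derivative, hc (m + 1) (by omega), zero_mul]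
  have hd2 : (derivative (derivative e)).degree < n := by
    rw [degree_lt_iff_coeff_zero]
    intro m hm
    rw [coeff_derivative, coeff_derivative, hc _ (by omega), zero_mul, zero_mul]
  set c : ℝ := (n : ℝ) * (n + 1) with hcdef
  set f : ℝ[X] := legendreOp e - C c * e with hf
  have hfdeg : f.degree < n := by
    rw [degree_lt_iff_coeff_zero]
    intro m hm
    rw [hf, coeff_sub, coeff_legendreOp, coeff_C_mul, hc (m + 1) (by omega)]
    rcases hm.eq_or_lt with rfl | hm
    · rw [h1]; ring
    · rw [hc m hm]; ring
  -- The defect of the eigenvalue equation has degree below `n`, so self-adjointness makes it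
  -- orthogonal to itself.
  have hf0 : f = 0 := by
    apply eq_zero_of_unitIntegral_mul_self
    have : f * f = legendreOp e * f - c • (e * f) := by
      rw [smul_eq_C_mul]
      nth_rewrite 1 [hf]; ring
    rw [this, map_sub, map_smul, unitIntegral_legendreOp_mul, ho _ (degree_legendreOp_lt hfdeg),
      ho _ hfdeg]
    simp
  have hode : ∀ x, (legendreOp e).eval x = c * e.eval x := fun x => by
    have := congrArg (eval x) hf0
    simp only [hf, eval_sub, eval_mul, eval_C, eval_zero] at this
    linarith
  -- Where the weight vanishes, the second order equation degenerates to `e'(1) = c e(1)` and `e'(0)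
  -- = -c e(0)`.
  have he1 := hode 1
  have he0 := hode 0
  simp only [legendreOp, derivative_mul, derivative_sub, derivative_X, derivative_X_pow, eval_neg,
    eval_add, eval_mul, eval_sub, eval_one, eval_X, eval_pow, eval_C, Nat.cast_ofNat] at he1 he0
  norm_num at he1 he0
  have hx : unitIntegral (e * (X * derivative e - C (n : ℝ) * e)) = 0 := by
    apply ho
    rw [degree_lt_iff_coeff_zero]
    intro m hm
    rw [coeff_sub, coeff_C_mul]
    rcases hm.eq_or_lt with rfl | hm
    · cases n with
      | zero => simp
      | succ k => rw [coeff_X_mul, coeff_derivative]; push_cast; ring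
    · obtain ⟨k, rfl⟩ : ∃ k, m = k + 1 := ⟨m - 1, by omega⟩
      rw [coeff_X_mul, coeff_derivative, hc _ hm]; ring
  -- The factor `2x - 1` is `±1` at the endpoints, so this derivative integrates to `e(1)² + e(0)²`.
  have hb := unitIntegral_derivative ((C 2 * X - 1) * (e * e))
  have hb' : derivative ((C 2 * X - 1) * (e * e)) =
      (4 : ℝ) • (e * (X * derivative e - C (n : ℝ) * e)) + (4 * n + 2 : ℝ) • (e * e) -
        (2 : ℝ) • (e * derivative e) := by
    simp only [derivative_mul, derivative_sub, derivative_X, derivative_one, derivative_ofNat,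
      smul_eq_C_mul, map_add, map_mul, map_ofNat]
    ring
  rw [hb', map_sub, map_add, map_smul, map_smul, map_smul, hx, ho _ hd] at hb
  simp only [eval_mul, eval_sub, eval_C, eval_X, eval_one, smul_eq_mul] at hb
  have hg := unitIntegral_derivative (e * derivative e)
  rw [derivative_mul, map_add, ho _ hd2, eval_mul, eval_mul] at hg
  rw [add_zero] at hg
  rw [hg, he1, show eval 0 (derivative e) = -(c * eval 0 e) by linarith, mul_assoc c]
  have hb2 : (4 * (n : ℝ) + 2) * unitIntegral (e * e) = eval 1 e ^ 2 + eval 0 e ^ 2 := by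
    linarith
  rw [hb2]; ring

/-- Each induction step splits off the orthogonal component of top degree and adds its ratio `m (m +
1) (4m + 2)` to the constant; the sum telescopes to `n (n + 1)² (n + 2)`. The extra `1` keeps the
constant positive at `n = 0`, so that it can be divided by. -/
lemma unitIntegral_derivative_sq_le_aux (n : ℕ) : ∀ q : ℝ[X], q.natDegree ≤ n →
    unitIntegral (derivative q * derivative q) ≤
      ((n : ℝ) * (n + 1) ^ 2 * (n + 2) + 1) * unitIntegral (q * q) := by
  induction n with
  | zero =>
    intro q hq
    rw [derivative_of_natDegree_zero (Nat.le_zero.1 hq), zero_mul, map_zero]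
    simpa using unitIntegral_mul_self_nonneg q
  | succ n ih =>
    intro q hq
    obtain ⟨e, hn, h1, ho⟩ := exists_monic_orthogonal (n + 1)
    have hD := unitIntegral_derivative_sq_of_orthogonal hn h1 ho
    set c := q.coeff (n + 1)
    set r := q - C c * e with hr
    have hrdeg : r.degree < (n + 1 : ℕ) := by
      rw [degree_lt_iff_coeff_zero]
      intro m hm
      rw [hr, coeff_sub, coeff_C_mul]
      rcases hm.eq_or_lt with rfl | hm
      · rw [h1]; ring
      · rw [coeff_eq_zero_of_natDegree_lt (hq.trans_lt hm),
          coeff_eq_zero_of_natDegree_lt (hn.trans_lt hm)]; ring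
    have hrn : r.natDegree ≤ n := by
      rw [natDegree_le_iff_coeff_eq_zero]
      rw [degree_lt_iff_coeff_zero] at hrdeg
      exact fun m hm => hrdeg m hm
    have hir := ih r hrn
    have hq : q = r + C c * e := by rw [hr]; ring
    set M : ℝ := (n : ℝ) * (n + 1) ^ 2 * (n + 2) + 1 with hM
    set D : ℝ := ((n + 1 : ℕ) : ℝ) * ((n + 1 : ℕ) + 1) * (4 * (n + 1 : ℕ) + 2) with hDdef
    have hMpos : 0 < M := by positivity
    have hDpos : 0 < D := by positivity
    have hqq : unitIntegral (q * q) = unitIntegral (r * r) + c ^ 2 * unitIntegral (e * e) := by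
      have : q * q = r * r + (2 * c) • (e * r) + (c ^ 2) • (e * e) := by
        simp only [hq, smul_eq_C_mul, map_mul, map_pow, map_ofNat]; ring
      rw [this, map_add, map_add, map_smul, map_smul, ho r hrdeg]
      simp
    have hqd : unitIntegral (derivative q * derivative q) =
        unitIntegral (derivative r * derivative r) +
          2 * c * unitIntegral (derivative r * derivative e) +
          c ^ 2 * unitIntegral (derivative e * derivative e) := by
      have : derivative q * derivative q = derivative r * derivative r +
          (2 * c) • (derivative r * derivative e) + (c ^ 2) • (derivative e * derivative e) := by
        simp only [hq, smul_eq_C_mul, map_mul, map_pow, map_ofNat, derivative_add, derivative_mul,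
          derivative_C]
        ring
      rw [this, map_add, map_add, map_smul, map_smul]
      simp
    -- The weights `D` and `M` are those for which `(√(M R) + |c| √(D N))² ≤ (M + D) (R + c² N)`
    -- comes out without roots.
    have hsq := unitIntegral_mul_self_nonneg (C D * derivative r - C (M * c) * derivative e)
    have hsq' : (C D * derivative r - C (M * c) * derivative e) *
        (C D * derivative r - C (M * c) * derivative e) =
        (D ^ 2) • (derivative r * derivative r) +
          (-(2 * D * M * c)) • (derivative r * derivative e) +
          (M ^ 2 * c ^ 2) • (derivative e * derivative e) := by
      simp only [smul_eq_C_mul, map_mul, map_pow, map_neg, map_ofNat]; ring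
    rw [hsq', map_add, map_add, map_smul, map_smul, map_smul, hD] at hsq
    simp only [smul_eq_mul] at hsq
    have hMD : ((n + 1 : ℕ) : ℝ) * ((n + 1 : ℕ) + 1) ^ 2 * ((n + 1 : ℕ) + 2) + 1 = M + D := by
      rw [hM, hDdef]; push_cast; ring
    rw [hMD, hqq, hqd, hD]
    set R := unitIntegral (r * r)
    set N := unitIntegral (e * e)
    set R' := unitIntegral (derivative r * derivative r)
    set S := unitIntegral (derivative r * derivative e)
    have key : 2 * c * S ≤ D * R + M * c ^ 2 * N := by
      have h : D * M * (2 * c * S) ≤ D * M * (D * R + M * c ^ 2 * N) := by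
        have : D ^ 2 * R' ≤ D ^ 2 * (M * R) := by gcongr
        nlinarith
      exact le_of_mul_le_mul_left h (by positivity)
    nlinarith

/-- The Markov inequality in `L²(0, 1)`. -/
lemma integral_derivative_sq_le {n : ℕ} (hn : 1 ≤ n) (q : ℝ[X]) (hq : q.natDegree ≤ n) :
    ∫ x in (0 : ℝ)..1, (derivative q).eval x ^ 2 ≤
      13 * (n : ℝ) ^ 4 * ∫ x in (0 : ℝ)..1, q.eval x ^ 2 := by
  have h := unitIntegral_derivative_sq_le_aux n q hq
  have h0 := unitIntegral_mul_self_nonneg q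
  simp only [unitIntegral_apply, ← pow_two, eval_pow] at h h0
  refine h.trans (mul_le_mul_of_nonneg_right ?_ h0)
  have h1 : (1 : ℝ) ≤ n := by exact_mod_cast hn
  -- This accounts for `12 n⁴`; the additional `1` is at most `n⁴`, hence the constant `13`.
  have : (n : ℝ) * (n + 1) ^ 2 * (n + 2) ≤ n * (2 * n) ^ 2 * (3 * n) := by
    gcongr <;> linarith
  have : (1 : ℝ) ≤ n ^ 4 := one_le_pow₀ h1
  nlinarith

end Markov

end

noncomputable section

/-! ### Affine parametrisations of the plane -/

/-- The determinant of two plane vectors. -/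
def det2 (u v : Plane) : ℝ := u 0 * v 1 - u 1 * v 0

/-- The affine parametrisation `(s, t) ↦ A + s u + t v`. -/
def affPar (A u v : Plane) (p : ℝ × ℝ) : Plane := A + p.1 • u + p.2 • v

lemma plane_inner (a b : Plane) : inner ℝ a b = a 0 * b 0 + a 1 * b 1 := by
  simp [PiLp.inner_apply, Fin.sum_univ_two, mul_comm]

lemma plane_norm_sq (a : Plane) : ‖a‖ ^ 2 = a 0 ^ 2 + a 1 ^ 2 := by
  rw [← real_inner_self_eq_norm_sq, plane_inner]; ring

lemma plane_ext {a b : Plane} (h0 : a 0 = b 0) (h1 : a 1 = b 1) : a = b := by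
  ext i; fin_cases i <;> assumption

lemma continuous_affPar (A u v : Plane) : Continuous (affPar A u v) := by
  unfold affPar; fun_prop

lemma injective_affPar {A u v : Plane} (hd : det2 u v ≠ 0) :
    Function.Injective (affPar A u v) := by
  rintro ⟨s, t⟩ ⟨s', t'⟩ h
  have h0 := congrArg (fun z : Plane => z 0) h
  have h1 := congrArg (fun z : Plane => z 1) h
  simp only [affPar, PiLp.add_apply, PiLp.smul_apply, smul_eq_mul] at h0 h1
  have hs : det2 u v * (s - s') = 0 := by rw [det2]; linear_combination v 1 * h0 - v 0 * h1
  have ht : det2 u v * (t - t') = 0 := by rw [det2]; linear_combination u 0 * h1 - u 1 * h0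
  have hs' := (mul_eq_zero.1 hs).resolve_left hd
  have ht' := (mul_eq_zero.1 ht).resolve_left hd
  exact Prod.ext (sub_eq_zero.1 hs') (sub_eq_zero.1 ht')

lemma map_affPar_volume {A u v : Plane} (hd : det2 u v ≠ 0) :
    Measure.map (affPar A u v) volume = ENNReal.ofReal |(det2 u v)⁻¹| • volume := by
  let N : Matrix (Fin 2) (Fin 2) ℝ := !![u 0, v 0; u 1, v 1]
  have hN : N.det = det2 u v := by
    simp only [N, Matrix.det_fin_two_of, det2]; ring
  have h1 := (volume_preserving_finTwoArrow ℝ).symm.map_eq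
  have h2 := Real.map_matrix_volume_pi_eq_smul_volume_pi (M := N) (by rwa [hN])
  have h3 := (PiLp.volume_preserving_toLp (Fin 2)).map_eq
  have h4 := (measurePreserving_add_left (volume : Measure Plane) A).map_eq
  have hf : affPar A u v = (fun z => A + z) ∘ (WithLp.toLp 2) ∘ (Matrix.toLin' N) ∘
      (MeasurableEquiv.finTwoArrow (α := ℝ)).symm := by
    funext p
    apply plane_ext <;>
    simp [affPar, N, MeasurableEquiv.finTwoArrow] <;>
    ring
  have hm1 : Measurable (MeasurableEquiv.finTwoArrow (α := ℝ)).symm :=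
    (MeasurableEquiv.finTwoArrow (α := ℝ)).symm.measurable
  have hm2 : Measurable (Matrix.toLin' N) := (LinearMap.continuous_of_finiteDimensional _).measurable
  have hm3 : Measurable (WithLp.toLp 2 : (Fin 2 → ℝ) → Plane) :=
    (PiLp.volume_preserving_toLp (Fin 2)).measurable
  have hm4 : Measurable (fun z : Plane => A + z) := measurable_const_add A
  rw [hf, ← Measure.map_map hm4 (hm3.comp (hm2.comp hm1)), ← Measure.map_map hm3 (hm2.comp hm1),
    ← Measure.map_map hm2 hm1, h1, h2, Measure.map_smul, h3, Measure.map_smul, h4, hN]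

lemma setIntegral_affPar {A u v : Plane} (hd : det2 u v ≠ 0) (f : Plane → ℝ) (S : Set Plane) :
    ∫ z in S, f z = |det2 u v| * ∫ p in affPar A u v ⁻¹' S, f (affPar A u v p) := by
  have h := ((continuous_affPar A u v).measurableEmbedding
    (injective_affPar hd)).setIntegral_map (μ := volume) f S
  rw [map_affPar_volume hd, Measure.restrict_smul, integral_smul_measure,
    ENNReal.toReal_ofReal (abs_nonneg _), abs_inv, smul_eq_mul] at h
  rw [← h, mul_inv_cancel_left₀ (abs_ne_zero.2 hd)]

/-! ### Integration over the reference triangle -/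

/-- The open reference triangle. -/
def refTriangle : Set (ℝ × ℝ) := {p | 0 < p.1 ∧ 0 < p.2 ∧ p.1 + p.2 < 1}

lemma measurableSet_refTriangle : MeasurableSet refTriangle :=
  ((isOpen_lt continuous_const continuous_fst).inter ((isOpen_lt continuous_const
    continuous_snd).inter (isOpen_lt (continuous_fst.add continuous_snd)
      continuous_const))).measurableSet

lemma integrableOn_refTriangle {g : ℝ × ℝ → ℝ} (hg : Continuous g) :
    IntegrableOn g refTriangle := by
  refine (hg.continuousOn.integrableOn_compact (isCompact_Icc (a := ((0 : ℝ), (0 : ℝ)))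
    (b := ((1 : ℝ), (1 : ℝ))))).mono_set ?_
  rintro ⟨s, t⟩ ⟨hs, ht, hst⟩
  simp only at hs ht hst
  exact ⟨⟨hs.le, ht.le⟩, ⟨by simp only; linarith, by simp only; linarith⟩⟩

lemma setIntegral_refTriangle {g : ℝ × ℝ → ℝ} (hg : Continuous g) :
    ∫ p in refTriangle, g p = ∫ t in (0 : ℝ)..1, ∫ s in (0 : ℝ)..(1 - t), g (s, t) := by
  rw [← integral_indicator measurableSet_refTriangle, Measure.volume_eq_prod, integral_prod_symm,
    intervalIntegral.integral_of_le zero_le_one, integral_Ioc_eq_integral_Ioo,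
    ← integral_indicator measurableSet_Ioo]
  · congr 1
    funext t
    by_cases ht : t ∈ Ioo (0 : ℝ) 1
    · rw [indicator_of_mem ht, intervalIntegral.integral_of_le (by linarith [ht.2]),
        integral_Ioc_eq_integral_Ioo, ← integral_indicator measurableSet_Ioo]
      congr 1
      funext s
      by_cases hs : s ∈ Ioo 0 (1 - t)
      · rw [indicator_of_mem hs, indicator_of_mem]
        exact ⟨hs.1, ht.1, by simp only; linarith [hs.2]⟩
      · rw [indicator_of_notMem hs, indicator_of_notMem]
        rintro ⟨h1, h2, h3⟩
        simp only at h1 h2 h3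
        exact hs ⟨h1, by linarith⟩
    · rw [indicator_of_notMem ht]
      have : ∀ s, refTriangle.indicator g (s, t) = 0 := by
        intro s
        apply indicator_of_notMem
        rintro ⟨h1, h2, h3⟩
        simp only at h1 h2 h3
        exact ht ⟨h2, by linarith⟩
      simp [this]
  · rw [← Measure.volume_eq_prod]
    exact (integrableOn_refTriangle hg).integrable_indicator measurableSet_refTriangle

lemma setIntegral_refTriangle_swap (g : ℝ × ℝ → ℝ) :
    ∫ p in refTriangle, g p = ∫ p in refTriangle, g p.swap := by
  rw [← integral_indicator measurableSet_refTriangle, ← integral_indicator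
    measurableSet_refTriangle, Measure.volume_eq_prod, ← integral_prod_swap]
  congr 1
  funext ⟨s, t⟩
  have : (t, s) ∈ refTriangle ↔ (s, t) ∈ refTriangle := by
    simp only [refTriangle, mem_ofPred_eq, add_comm t s]; tauto
  by_cases h : (s, t) ∈ refTriangle
  · rw [Prod.swap_prod_mk, indicator_of_mem h, indicator_of_mem (this.2 h), Prod.swap_prod_mk]
  · rw [Prod.swap_prod_mk, indicator_of_notMem h, indicator_of_notMem (fun h' => h (this.1 h'))]

/-- The fundamental theorem of calculus along `u`: each line runs from the side spanned by `v` to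
the hypotenuse, which it meets at `s = 1 - t`. -/
lemma setIntegral_refTriangle_deriv {f : Plane → ℝ} (hf : ContDiff ℝ 1 f) (A u v : Plane) :
    ∫ p in refTriangle, fderiv ℝ f (affPar A u v p) u =
      (∫ t in (0 : ℝ)..1, f (A + u + t • (v - u))) - ∫ t in (0 : ℝ)..1, f (A + t • v) := by
  have hc : Continuous fun z => fderiv ℝ f z u :=
    (hf.continuous_fderiv one_ne_zero).clm_apply continuous_const
  rw [setIntegral_refTriangle (g := fun p => fderiv ℝ f (affPar A u v p) u)
      (hc.comp (continuous_affPar A u v)),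
    ← intervalIntegral.integral_sub]
  · congr 1
    funext t
    have hder : ∀ s : ℝ, HasDerivAt (fun s => f (affPar A u v (s, t)))
        (fderiv ℝ f (affPar A u v (s, t)) u) s := by
      intro s
      have h1 : HasDerivAt (fun s : ℝ => affPar A u v (s, t)) u s := by
        simpa [affPar] using (((hasDerivAt_id s).smul_const u).const_add A).add_const (t • v)
      exact ((hf.differentiable one_ne_zero) _).hasFDerivAt.comp_hasDerivAt s h1
    rw [intervalIntegral.integral_eq_sub_of_hasDerivAt (fun s _ => hder s)]
    · congr 2 <;> simp only [affPar] <;> module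
    · exact (hc.comp ((continuous_affPar A u v).comp (by fun_prop))).intervalIntegrable _ _
  · exact (hf.continuous.comp (by fun_prop)).intervalIntegrable _ _
  · exact (hf.continuous.comp (by fun_prop)).intervalIntegrable _ _

end

noncomputable section

/-! ### Barycentric coordinates -/

/-- The vertices of a triangle as an affine basis of the plane. -/
def vertexBasis (t : Affine.Triangle ℝ Plane) : AffineBasis (Fin 3) ℝ Plane :=
  ⟨t.points, t.independent, by
    rw [t.independent.affineSpan_eq_top_iff_card_eq_finrank_add_one]; simp⟩

/-- The barycentric coordinate of `z` with respect to the `k`-th vertex. -/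
def bary (t : Affine.Triangle ℝ Plane) (k : Fin 3) (z : Plane) : ℝ := (vertexBasis t).coord k z

/-- The gradient of a barycentric coordinate. -/
def baryGrad (t : Affine.Triangle ℝ Plane) (k : Fin 3) : Plane :=
  !₂[((vertexBasis t).coord k).linear (EuclideanSpace.single 0 1),
    ((vertexBasis t).coord k).linear (EuclideanSpace.single 1 1)]

variable (t : Affine.Triangle ℝ Plane)

/-- Barycentric coordinates are affine, so this expansion is exact; edges, normals and distances are
all read off from it. -/
lemma bary_sub (k : Fin 3) (z ζ : Plane) :
    bary t k ζ = bary t k z + inner ℝ (ζ - z) (baryGrad t k) := by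
  have h : ∀ w : Plane, ((vertexBasis t).coord k).linear w = inner ℝ w (baryGrad t k) := by
    intro w
    have hw : w = w 0 • EuclideanSpace.single (0 : Fin 2) (1 : ℝ) +
        w 1 • EuclideanSpace.single (1 : Fin 2) (1 : ℝ) := by
      apply plane_ext <;> simp
    conv_lhs => rw [hw]
    rw [map_add, map_smul, map_smul, plane_inner]
    simp [baryGrad]
  rw [← h, bary, bary]
  have := ((vertexBasis t).coord k).linearMap_vsub ζ z
  rw [vsub_eq_sub, vsub_eq_sub] at this
  rw [this]; ring

lemma bary_vertex (k j : Fin 3) : bary t k (t.points j) = if k = j then 1 else 0 :=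
  (vertexBasis t).coord_apply k j

lemma sum_bary (z : Plane) : bary t 0 z + bary t 1 z + bary t 2 z = 1 := by
  have := (vertexBasis t).sum_coord_apply_eq_one z
  rwa [Fin.sum_univ_three] at this

lemma sum_bary_smul (z : Plane) :
    bary t 0 z • t.points 0 + bary t 1 z • t.points 1 + bary t 2 z • t.points 2 = z := by
  have := (vertexBasis t).linear_combination_coord_eq_self z
  rwa [Fin.sum_univ_three] at this

lemma continuous_bary (k : Fin 3) : Continuous (bary t k) := by
  have : bary t k = fun ζ => bary t k 0 + inner ℝ (ζ - 0) (baryGrad t k) :=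
    funext fun ζ => bary_sub t k 0 ζ
  rw [this]; fun_prop

lemma openTriangle_eq : openTriangle t = {z | ∀ k, 0 < bary t k z} :=
  (vertexBasis t).interior_convexHull

lemma mem_openTriangle {z : Plane} : z ∈ openTriangle t ↔ ∀ k, 0 < bary t k z := by
  rw [openTriangle_eq]; rfl

lemma isOpen_openTriangle : IsOpen (openTriangle t) := isOpen_interior

lemma nonempty_openTriangle : (openTriangle t).Nonempty :=
  ⟨_, (vertexBasis t).centroid_mem_interior_convexHull⟩

lemma convex_openTriangle : Convex ℝ (openTriangle t) := (convex_convexHull ℝ _).interior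

lemma closure_openTriangle_eq : closure (openTriangle t) = convexHull ℝ (range t.points) := by
  rw [openTriangle, (convex_convexHull ℝ _).closure_interior_eq_closure_of_nonempty_interior
    (nonempty_openTriangle t)]
  exact ((finite_range t.points).isCompact_convexHull ℝ).isClosed.closure_eq

lemma isCompact_closure_openTriangle : IsCompact (closure (openTriangle t)) := by
  rw [closure_openTriangle_eq]
  exact (finite_range t.points).isCompact_convexHull ℝ

lemma mem_closure_openTriangle {z : Plane} :
    z ∈ closure (openTriangle t) ↔ ∀ k, 0 ≤ bary t k z := by
  rw [closure_openTriangle_eq]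
  have := (vertexBasis t).convexHull_eq_nonneg_coord
  change convexHull ℝ (range t.points) = _ at this
  rw [this]; rfl

lemma mem_frontier_openTriangle {z : Plane} :
    z ∈ frontier (openTriangle t) ↔ (∀ k, 0 ≤ bary t k z) ∧ ∃ k, bary t k z = 0 := by
  rw [(isOpen_openTriangle t).frontier_eq, mem_sdiff, mem_closure_openTriangle, mem_openTriangle]
  refine and_congr_right fun h => ?_
  push Not
  exact exists_congr fun k => ⟨fun h' => le_antisymm h' (h k), fun h' => h'.le⟩

lemma isCompact_frontier_openTriangle : IsCompact (frontier (openTriangle t)) :=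
  (isCompact_closure_openTriangle t).of_isClosed_subset isClosed_frontier
    frontier_subset_closure

lemma isBounded_openTriangle : Bornology.IsBounded (openTriangle t) :=
  (isCompact_closure_openTriangle t).isBounded.subset subset_closure

lemma bary_le_one {z : Plane} (hz : z ∈ closure (openTriangle t)) (k : Fin 3) :
    bary t k z ≤ 1 := by
  rw [mem_closure_openTriangle] at hz
  have := sum_bary t z
  fin_cases k <;> simp only [Fin.zero_eta, Fin.mk_one, Fin.reduceFinMk] <;>
    linarith [hz 0, hz 1, hz 2]

lemma diam_closure_openTriangle : Metric.diam (closure (openTriangle t)) = meshSize t :=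
  Metric.diam_closure _

lemma norm_sub_le_meshSize {z ζ : Plane} (hz : z ∈ closure (openTriangle t))
    (hζ : ζ ∈ closure (openTriangle t)) : ‖z - ζ‖ ≤ meshSize t := by
  rw [← dist_eq_norm, ← diam_closure_openTriangle]
  exact Metric.dist_le_diam_of_mem (isCompact_closure_openTriangle t).isBounded hz hζ

lemma vertex_mem_closure (k : Fin 3) : t.points k ∈ closure (openTriangle t) := by
  rw [closure_openTriangle_eq]
  exact subset_convexHull ℝ _ (mem_range_self k)

lemma meshSize_pos : 0 < meshSize t := by
  have h := norm_sub_le_meshSize t (vertex_mem_closure t 0) (vertex_mem_closure t 1)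
  have h' : t.points 0 ≠ t.points 1 := fun h => absurd (t.independent.injective h) (by decide)
  exact (norm_pos_iff.2 (sub_ne_zero.2 h')).trans_le h

/-! ### Edges and normals -/

/-- The edge opposite to the `k`-th vertex. -/
def edge (k : Fin 3) : Set Plane := {z | z ∈ closure (openTriangle t) ∧ bary t k z = 0}

/-- The unit outward normal on the edge opposite to the `k`-th vertex. -/
def edgeNormal (k : Fin 3) : Plane := -(‖baryGrad t k‖⁻¹ • baryGrad t k)

lemma frontier_eq_iUnion_edge : frontier (openTriangle t) = ⋃ k, edge t k := by
  ext z
  rw [mem_frontier_openTriangle, mem_iUnion, ← mem_closure_openTriangle]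
  exact ⟨fun ⟨h, k, hk⟩ => ⟨k, h, hk⟩, fun ⟨k, h, hk⟩ => ⟨h, k, hk⟩⟩

lemma isClosed_edge (k : Fin 3) : IsClosed (edge t k) :=
  isClosed_closure.inter (isClosed_eq (continuous_bary t k) continuous_const)

lemma inner_baryGrad (k i j : Fin 3) : inner ℝ (t.points i - t.points j) (baryGrad t k) =
    (if k = i then 1 else 0) - (if k = j then 1 else 0) := by
  have := bary_sub t k (t.points j) (t.points i)
  rw [bary_vertex, bary_vertex] at this
  linarith

lemma baryGrad_ne_zero (k : Fin 3) : baryGrad t k ≠ 0 := by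
  intro h
  have := inner_baryGrad t k k (k + 1)
  rw [h, inner_zero_right, if_pos rfl, if_neg (by simp)] at this
  norm_num at this

lemma norm_edgeNormal (k : Fin 3) : ‖edgeNormal t k‖ = 1 := by
  rw [edgeNormal, norm_neg, norm_smul, norm_inv, norm_norm,
    inv_mul_cancel₀ (norm_ne_zero_iff.2 (baryGrad_ne_zero t k))]

lemma inner_edgeNormal (k : Fin 3) (w : Plane) :
    inner ℝ w (edgeNormal t k) = -(‖baryGrad t k‖⁻¹ * inner ℝ w (baryGrad t k)) := by
  rw [edgeNormal, inner_neg_right, inner_smul_right]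

lemma inner_edgeNormal_lt_zero_iff {k : Fin 3} {z ζ : Plane} (hz : bary t k z = 0) :
    inner ℝ (ζ - z) (edgeNormal t k) < 0 ↔ 0 < bary t k ζ := by
  rw [bary_sub t k z ζ, hz, zero_add, inner_edgeNormal, neg_lt_zero]
  exact mul_pos_iff_of_pos_left (inv_pos.2 (norm_pos_iff.2 (baryGrad_ne_zero t k)))

/-- Close to a relatively interior point of an edge the other two coordinates stay positive, so the
sign of the `k`-th one alone decides membership. -/
lemma isOutwardNormal_edgeNormal {k : Fin 3} {z : Plane} (hz : bary t k z = 0)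
    (hpos : ∀ j ≠ k, 0 < bary t j z) :
    IsOutwardNormal (openTriangle t) z (edgeNormal t k) := by
  refine ⟨norm_edgeNormal t k, ?_⟩
  have : ∀ᶠ ζ in 𝓝 z, ∀ j ≠ k, 0 < bary t j ζ := by
    rw [Filter.eventually_all]
    intro j
    by_cases hj : j = k
    · simp [hj]
    · filter_upwards [(continuous_bary t j).continuousAt.eventually (lt_mem_nhds (hpos j hj))] with ζ hζ _
      exact hζ
  obtain ⟨r, hr, h⟩ := Metric.eventually_nhds_iff_ball.1 this
  refine ⟨r, hr, fun ζ hζ => ?_⟩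
  rw [inner_edgeNormal_lt_zero_iff t hz, mem_openTriangle]
  refine ⟨fun h' => h' k, fun h' j => ?_⟩
  by_cases hj : j = k
  · rwa [hj]
  · exact h ζ hζ j hj

end

/-! ### General facts on outward normals -/

/-- A direction pointing into both half-planes leads from `z` to a common point of the two sets.
Both the uniqueness of normals and their opposition across an edge follow from this. -/
lemma IsOutwardNormal.inner_neg_of_inner_neg {S S' : Set Plane} {z n n' : Plane}
    (h : IsOutwardNormal S z n) (h' : IsOutwardNormal S' z n') {v : Plane}
    (hv : inner ℝ v n < 0) (hv' : inner ℝ v n' < 0) : (S ∩ S').Nonempty := by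
  obtain ⟨-, r, hr, hS⟩ := h
  obtain ⟨-, r', hr', hS'⟩ := h'
  obtain ⟨ε, hε, hε1, hε2⟩ : ∃ ε : ℝ, 0 < ε ∧ ε * ‖v‖ < r ∧ ε * ‖v‖ < r' := by
    refine ⟨min r r' / (‖v‖ + 1), by positivity, ?_, ?_⟩ <;>
    · rw [div_mul_eq_mul_div, div_lt_iff₀ (by positivity)]
      nlinarith [norm_nonneg v, min_le_left r r', min_le_right r r', lt_min hr hr',
        mul_le_mul_of_nonneg_right (min_le_left r r') (norm_nonneg v),
        mul_le_mul_of_nonneg_right (min_le_right r r') (norm_nonneg v)]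
  refine ⟨z + ε • v, (hS _ ?_).2 ?_, (hS' _ ?_).2 ?_⟩
  · simpa [norm_smul, abs_of_pos hε] using hε1
  · rw [add_sub_cancel_left, real_inner_smul_left]; exact mul_neg_of_pos_of_neg hε hv
  · simpa [norm_smul, abs_of_pos hε] using hε2
  · rw [add_sub_cancel_left, real_inner_smul_left]; exact mul_neg_of_pos_of_neg hε hv'

lemma IsOutwardNormal.eq_neg_of_disjoint {S S' : Set Plane} {z n n' : Plane}
    (h : IsOutwardNormal S z n) (h' : IsOutwardNormal S' z n') (hd : Disjoint S S') :
    n' = -n := by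
  by_contra hne
  have h1 := h.1
  have h2 := h'.1
  have hlt : -1 < inner ℝ n n' := by
    have h3 : 0 < ‖n + n'‖ ^ 2 := by
      have : n + n' ≠ 0 := fun h0 => hne (eq_neg_of_add_eq_zero_right h0)
      positivity
    rw [norm_add_sq_real, h1, h2] at h3
    linarith
  -- For unit vectors, `-(n + n')` has product `-(1 + n · n')` with each of them, which is negative
  -- unless they are opposite.
  refine (h.inner_neg_of_inner_neg h' (v := -(n + n')) ?_ ?_).ne_empty hd.inter_eq
  · rw [inner_neg_left, inner_add_left, real_inner_self_eq_norm_sq, h1, real_inner_comm]; linarith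
  · rw [inner_neg_left, inner_add_left, real_inner_self_eq_norm_sq, h2]; linarith

lemma IsOutwardNormal.unique {S : Set Plane} {z n n' : Plane}
    (h : IsOutwardNormal S z n) (h' : IsOutwardNormal S z n') : n' = n := by
  -- The complementary half-plane does not meet `S` near `z`; if `n'` differed from `n`, the
  -- direction `n - n'` would point into both.
  have hc : IsOutwardNormal {ζ | inner ℝ (ζ - z) (-n) < 0} z (-n) :=
    ⟨by rw [norm_neg, h.1], 1, one_pos, fun ζ _ => Iff.rfl⟩
  by_contra hne
  have h1 := h.1
  have h2 := h'.1
  have hlt : inner ℝ n n' < 1 := by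
    have h3 : 0 < ‖n - n'‖ ^ 2 := by
      have : n - n' ≠ 0 := fun h0 => hne (sub_eq_zero.1 h0).symm
      positivity
    rw [norm_sub_sq_real, h1, h2] at h3
    linarith
  obtain ⟨-, r, hr, hS⟩ := h
  have hS2 : IsOutwardNormal (S ∩ Metric.ball z r) z n' := by
    obtain ⟨-, r', hr', hS'⟩ := h'
    refine ⟨h2, min r r', lt_min hr hr', fun ζ hζ => ?_⟩
    rw [← hS' ζ (Metric.ball_subset_ball (min_le_right _ _) hζ)]
    exact ⟨fun h => h.1, fun h => ⟨h, Metric.ball_subset_ball (min_le_left _ _) hζ⟩⟩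
  obtain ⟨ζ, hζ, hζ'⟩ := hc.inner_neg_of_inner_neg hS2 (v := n - n')
    (by rw [inner_neg_right, inner_sub_left, real_inner_self_eq_norm_sq, h1, real_inner_comm]
        linarith)
    (by rw [inner_sub_left, real_inner_self_eq_norm_sq, h2]; linarith)
  have h3 := (hS ζ hζ'.2).1 hζ'.1
  have h4 : inner ℝ (ζ - z) (-n) < 0 := hζ
  rw [inner_neg_right] at h4
  linarith

lemma IsOutwardNormal.outwardNormal_eq {S : Set Plane} {z n : Plane}
    (h : IsOutwardNormal S z n) : outwardNormal S z = n := by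
  have hex : ∃ n, IsOutwardNormal S z n := ⟨n, h⟩
  rw [outwardNormal, dif_pos hex]
  exact h.unique hex.choose_spec

lemma norm_outwardNormal_le (S : Set Plane) (z : Plane) : ‖outwardNormal S z‖ ≤ 1 := by
  rw [outwardNormal]
  split_ifs with h
  · exact h.choose_spec.1.le
  · simp

lemma abs_outwardNormal_le (S : Set Plane) (z : Plane) (i : Fin 2) :
    |outwardNormal S z i| ≤ 1 :=
  (PiLp.norm_apply_le (p := 2) (outwardNormal S z) i).trans (norm_outwardNormal_le S z)

noncomputable section

/-! ### Arc length on segments and on the boundary of a triangle -/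

lemma arcLength_finite_zero {s : Set Plane} (hs : s.Finite) : arcLength s = 0 := by
  have := Measure.nullSingletonClass_hausdorff Plane (zero_lt_one (α := ℝ))
  exact hs.measure_zero _

lemma ae_notMem_finite {s : Set Plane} (hs : s.Finite) : ∀ᵐ z ∂arcLength, z ∉ s :=
  measure_eq_zero_iff_ae_notMem.1 (arcLength_finite_zero hs)

/-- Parametrisation by arc length is an isometry of the line into the plane, so it carries Lebesgue
measure to one-dimensional Hausdorff measure on its range. -/
lemma setIntegral_segment {A B : Plane} (hAB : A ≠ B) (f : Plane → ℝ) :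
    ∫ z in segment ℝ A B, f z ∂arcLength =
      ‖B - A‖ * ∫ s in (0 : ℝ)..1, f (A + s • (B - A)) := by
  set l := ‖B - A‖ with hl
  have hlpos : 0 < l := norm_pos_iff.2 (sub_ne_zero.2 hAB.symm)
  let ι : ℝ → Plane := fun s => A + (s / l) • (B - A)
  have hι : Isometry ι := by
    refine Isometry.of_dist_eq fun x y => ?_
    simp only [ι, dist_add_left]
    rw [dist_eq_norm, ← sub_smul, norm_smul, ← sub_div, norm_div, Real.norm_of_nonneg hlpos.le,
      ← hl, div_mul_cancel₀ _ hlpos.ne', ← dist_eq_norm]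
  have hpre : ι ⁻¹' segment ℝ A B = Icc 0 l := by
    ext s
    rw [mem_preimage, segment_eq_image', mem_image]
    constructor
    · rintro ⟨θ, ⟨h0, h1⟩, h⟩
      have : θ * l = s := by
        have h2 : (θ - s / l) • (B - A) = 0 := by
          rw [sub_smul, sub_eq_zero]; exact add_left_cancel h
        have h3 := (smul_eq_zero.1 h2).resolve_right (sub_ne_zero.2 hAB.symm)
        rw [sub_eq_zero.1 h3, div_mul_cancel₀ _ hlpos.ne']
      rw [← this]
      exact ⟨by positivity, by nlinarith⟩
    · rintro ⟨h0, h1⟩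
      exact ⟨s / l, ⟨by positivity, (div_le_one hlpos).2 h1⟩, rfl⟩
  have hsub : segment ℝ A B ⊆ range ι := by
    rw [segment_eq_image']
    rintro _ ⟨θ, -, rfl⟩
    exact ⟨θ * l, by simp only [ι]; rw [mul_div_cancel_right₀ _ hlpos.ne']⟩
  have hmap : Measure.map ι volume = arcLength.restrict (range ι) := by
    rw [← hausdorffMeasure_real]
    exact hι.map_hausdorffMeasure (Or.inl zero_le_one)
  have hmeas : MeasurableSet (segment ℝ A B) := by
    rw [segment_eq_image']
    exact (isCompact_Icc.image (by fun_prop)).isClosed.measurableSet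
  have h1 : arcLength.restrict (segment ℝ A B) =
      (Measure.map ι volume).restrict (segment ℝ A B) := by
    rw [hmap, Measure.restrict_restrict hmeas, inter_eq_left.2 hsub]
  rw [h1, hι.isClosedEmbedding.measurableEmbedding.setIntegral_map, hpre,
    integral_Icc_eq_integral_Ioc, ← intervalIntegral.integral_of_le hlpos.le]
  have h2 := intervalIntegral.integral_comp_div (a := 0) (b := l)
    (fun s => f (A + s • (B - A))) hlpos.ne'
  rw [zero_div, div_self hlpos.ne', smul_eq_mul] at h2
  exact h2

variable (t : Affine.Triangle ℝ Plane)

lemma bary_combination (k : Fin 3) (x y : Plane) {a b : ℝ} (hab : a + b = 1) :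
    bary t k (a • x + b • y) = a * bary t k x + b * bary t k y := by
  rw [bary_sub t k x y, bary_sub t k x (a • x + b • y)]
  have : a • x + b • y - x = b • (y - x) := by
    rw [show a = 1 - b by linarith]; module
  rw [this, real_inner_smul_left, show a = 1 - b by linarith]; ring

lemma edge_eq_segment (k : Fin 3) :
    edge t k = segment ℝ (t.points (k + 1)) (t.points (k + 2)) := by
  apply Subset.antisymm
  · rintro z ⟨hz, hk⟩
    rw [mem_closure_openTriangle] at hz
    have h1 := sum_bary t z
    have h2 := sum_bary_smul t z
    refine ⟨bary t (k + 1) z, bary t (k + 2) z, hz _, hz _, ?_, ?_⟩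
    · fin_cases k <;> simp at hk ⊢ <;> rw [hk] at h1 <;> linarith
    · fin_cases k <;> simp at hk ⊢ <;> rw [hk, zero_smul] at h2 <;> nth_rewrite 3 [← h2]
      · rw [zero_add]
      · rw [add_zero, add_comm]
      · rw [add_zero]
  · rintro z ⟨a, b, ha, hb, hab, rfl⟩
    refine ⟨?_, ?_⟩
    · exact (convex_openTriangle t).closure (vertex_mem_closure t _) (vertex_mem_closure t _)
        ha hb hab
    · rw [bary_combination t k _ _ hab, bary_vertex, bary_vertex, if_neg, if_neg]
      · ring
      · fin_cases k <;> decide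
      · fin_cases k <;> decide

lemma eq_vertex_of_bary_eq_zero {z : Plane} {j k : Fin 3} (hjk : j ≠ k) (hj : bary t j z = 0)
    (hk : bary t k z = 0) : z ∈ range t.points := by
  have h1 := sum_bary t z
  have h2 := sum_bary_smul t z
  have key : ∀ i : Fin 3, bary t i z = 1 → (∀ i' ≠ i, bary t i' z = 0) → z ∈ range t.points := by
    intro i hi hi'
    refine ⟨i, ?_⟩
    rw [← h2]
    fin_cases i
    · simp [hi' 1 (by decide), hi' 2 (by decide)] at hi ⊢; simp [hi]
    · simp [hi' 0 (by decide), hi' 2 (by decide)] at hi ⊢; simp [hi]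
    · simp [hi' 0 (by decide), hi' 1 (by decide)] at hi ⊢; simp [hi]
  obtain ⟨i, hij, hik, hall⟩ : ∃ i : Fin 3, i ≠ j ∧ i ≠ k ∧ ∀ i', i' = i ∨ i' = j ∨ i' = k := by
    have : ∀ j k : Fin 3, j ≠ k → ∃ i : Fin 3, i ≠ j ∧ i ≠ k ∧ ∀ i', i' = i ∨ i' = j ∨ i' = k := by
      decide
    exact this j k hjk
  have hz : ∀ i' ≠ i, bary t i' z = 0 := fun i' h => by
    rcases hall i' with h' | h' | h'
    · exact absurd h' h
    · rwa [h']
    · rwa [h']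
  refine key i ?_ hz
  fin_cases i
  · simp [hz 1 (by decide), hz 2 (by decide)] at h1 ⊢; exact h1
  · simp [hz 0 (by decide), hz 2 (by decide)] at h1 ⊢; exact h1
  · simp [hz 0 (by decide), hz 1 (by decide)] at h1 ⊢; exact h1

lemma isOutwardNormal_of_mem_edge {k : Fin 3} {z : Plane} (hz : z ∈ edge t k)
    (hv : z ∉ range t.points) : IsOutwardNormal (openTriangle t) z (edgeNormal t k) := by
  refine isOutwardNormal_edgeNormal t hz.2 fun j hj => ?_
  refine lt_of_le_of_ne ((mem_closure_openTriangle t).1 hz.1 j) fun h => hv ?_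
  exact eq_vertex_of_bary_eq_zero t hj h.symm hz.2

lemma exists_isOutwardNormal {z : Plane} (hz : z ∈ frontier (openTriangle t))
    (hv : z ∉ range t.points) : IsOutwardNormal (openTriangle t) z
      (outwardNormal (openTriangle t) z) := by
  rw [frontier_eq_iUnion_edge, mem_iUnion] at hz
  obtain ⟨k, hk⟩ := hz
  have := isOutwardNormal_of_mem_edge t hk hv
  rwa [this.outwardNormal_eq]

lemma ae_outwardNormal_edge (k : Fin 3) : ∀ᵐ z ∂arcLength.restrict (edge t k),
    outwardNormal (openTriangle t) z = edgeNormal t k := by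
  rw [ae_restrict_iff' (isClosed_edge t k).measurableSet]
  filter_upwards [ae_notMem_finite (finite_range t.points)] with z hv hz
  exact (isOutwardNormal_of_mem_edge t hz hv).outwardNormal_eq

lemma isCompact_edge (k : Fin 3) : IsCompact (edge t k) :=
  (isCompact_closure_openTriangle t).of_isClosed_subset (isClosed_edge t k) fun _ h => h.1

lemma arcLength_edge_lt_top (k : Fin 3) : arcLength (edge t k) < ⊤ := by
  rw [edge_eq_segment, hausdorffMeasure_segment]
  exact edist_lt_top _ _

lemma arcLength_frontier_lt_top : arcLength (frontier (openTriangle t)) < ⊤ := by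
  rw [frontier_eq_iUnion_edge]
  exact (measure_iUnion_le _).trans_lt (by
    rw [tsum_fintype]
    exact ENNReal.sum_lt_top.2 fun k _ => arcLength_edge_lt_top t k)

instance : IsFiniteMeasure (arcLength.restrict (frontier (openTriangle t))) :=
  ⟨by rw [Measure.restrict_apply_univ]; exact arcLength_frontier_lt_top t⟩

lemma IsCompact.integrableOn_of_finite {s : Set Plane} (hs : IsCompact s) {μ : Measure Plane}
    (hμ : μ s < ⊤) {f : Plane → ℝ} (hf : ContinuousOn f s) : IntegrableOn f s μ := by
  obtain ⟨C, hC⟩ := hs.exists_bound_of_continuousOn hf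
  exact IntegrableOn.of_bound hμ (hf.aestronglyMeasurable hs.measurableSet) C
    ((ae_restrict_iff' hs.measurableSet).2 (Filter.Eventually.of_forall hC))

lemma integrableOn_frontier_of_continuous {f : Plane → ℝ} (hf : Continuous f) :
    IntegrableOn f (frontier (openTriangle t)) arcLength :=
  (isCompact_frontier_openTriangle t).integrableOn_of_finite (arcLength_frontier_lt_top t)
    hf.continuousOn

lemma integrableOn_frontier_iff {f : Plane → ℝ} :
    IntegrableOn f (frontier (openTriangle t)) arcLength ↔
      ∀ k, IntegrableOn f (edge t k) arcLength := by
  rw [frontier_eq_iUnion_edge, integrableOn_finite_iUnion]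

lemma setIntegral_frontier {f : Plane → ℝ}
    (hf : IntegrableOn f (frontier (openTriangle t)) arcLength) :
    ∫ z in frontier (openTriangle t), f z ∂arcLength =
      ∑ k, ∫ z in edge t k, f z ∂arcLength := by
  rw [frontier_eq_iUnion_edge] at hf ⊢
  rw [integral_iUnion_ae (fun k => (isClosed_edge t k).measurableSet.nullMeasurableSet) _ hf,
    tsum_fintype]
  intro j k hjk
  refine measure_mono_null ?_ (arcLength_finite_zero (finite_range t.points))
  rintro z ⟨hj, hk⟩
  exact eq_vertex_of_bary_eq_zero t hjk hj.2 hk.2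

/-- The normal is defined by choice, so measurability is not evident; off the vertices it is
constant on each edge, and the integrand agrees there with a continuous function. -/
lemma integrableOn_frontier_normal {G : Plane → Plane → ℝ} (hG : ∀ n, Continuous fun z => G z n) :
    IntegrableOn (fun z => G z (outwardNormal (openTriangle t) z)) (frontier (openTriangle t))
      arcLength := by
  rw [integrableOn_frontier_iff]
  intro k
  refine ((isCompact_edge t k).integrableOn_of_finite (arcLength_edge_lt_top t k)
    (hG (edgeNormal t k)).continuousOn).congr_fun_ae ?_
  filter_upwards [ae_outwardNormal_edge t k] with z hz
  rw [hz]

lemma setIntegral_frontier_normal {G : Plane → Plane → ℝ} (hG : ∀ n, Continuous fun z => G z n) :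
    ∫ z in frontier (openTriangle t), G z (outwardNormal (openTriangle t) z) ∂arcLength =
      ∑ k, ∫ z in edge t k, G z (edgeNormal t k) ∂arcLength := by
  rw [setIntegral_frontier t (integrableOn_frontier_normal t hG)]
  refine Finset.sum_congr rfl fun k _ => integral_congr_ae ?_
  filter_upwards [ae_outwardNormal_edge t k] with z hz
  rw [hz]

/-! ### The divergence theorem on a triangle -/

/-- The two conditions force `det(u, v) g` to be `v` rotated by a right angle. For a barycentric
gradient this relates its length to that of the opposite edge. -/
lemma norm_mul_det2 {u v g : Plane} (hu : inner ℝ u g = 1) (hv : inner ℝ v g = 0) :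
    ‖g‖ * |det2 u v| = ‖v‖ := by
  rw [plane_inner] at hu hv
  have h0 : det2 u v * g 0 = v 1 := by rw [det2]; linear_combination v 1 * hu - u 1 * hv
  have h1 : det2 u v * g 1 = -v 0 := by rw [det2]; linear_combination u 0 * hv - v 0 * hu
  rw [← sq_eq_sq₀ (by positivity) (norm_nonneg _), mul_pow, sq_abs, plane_norm_sq, plane_norm_sq]
  linear_combination (det2 u v * g 0 + v 1) * h0 + (det2 u v * g 1 - v 0) * h1

/-- The Jacobian determinant of the affine parametrisation of a triangle. -/
def triJac : ℝ := |det2 (t.points 1 - t.points 0) (t.points 2 - t.points 0)|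

lemma triJac_eq (k : Fin 3) : |det2 (t.points (k + 1) - t.points k)
    (t.points (k + 2) - t.points k)| = triJac t := by
  rw [triJac]
  fin_cases k <;> simp [det2] <;> congr 1 <;> ring

lemma triJac_ne_zero : triJac t ≠ 0 := by
  intro h
  have h2 := norm_mul_det2 (u := t.points 1 - t.points 0) (v := t.points 2 - t.points 0)
    (g := baryGrad t 1) (by rw [inner_baryGrad]; simp) (by rw [inner_baryGrad]; simp)
  have h3 : |det2 (t.points 1 - t.points 0) (t.points 2 - t.points 0)| = 0 := h
  rw [h3, mul_zero, eq_comm, norm_eq_zero, sub_eq_zero] at h2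
  exact absurd (t.independent.injective h2) (by decide)

lemma det2_ne_zero (k : Fin 3) : det2 (t.points (k + 1) - t.points k)
    (t.points (k + 2) - t.points k) ≠ 0 := by
  rw [← abs_ne_zero, triJac_eq]
  exact triJac_ne_zero t

lemma norm_baryGrad_mul_triJac (k : Fin 3) :
    ‖baryGrad t k‖ * triJac t = ‖t.points (k + 2) - t.points (k + 1)‖ := by
  rw [← norm_mul_det2 (u := t.points k - t.points (k + 1)) (v := t.points (k + 2) -
    t.points (k + 1)) (g := baryGrad t k), ← triJac_eq t k]
  · congr 1
    rw [← abs_neg]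
    congr 1
    simp only [det2, PiLp.sub_apply]; ring
  · rw [inner_baryGrad]; simp
  · rw [inner_baryGrad]; simp

lemma preimage_openTriangle (k : Fin 3) :
    affPar (t.points k) (t.points (k + 1) - t.points k) (t.points (k + 2) - t.points k) ⁻¹'
      openTriangle t = refTriangle := by
  ext ⟨s, r⟩
  have hb : ∀ j, bary t j (affPar (t.points k) (t.points (k + 1) - t.points k)
      (t.points (k + 2) - t.points k) (s, r)) = (if j = k then 1 else 0) +
        (s * ((if j = k + 1 then 1 else 0) - (if j = k then 1 else 0)) +
        r * ((if j = k + 2 then 1 else 0) - (if j = k then 1 else 0))) := by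
    intro j
    rw [bary_sub t j (t.points k), bary_vertex, affPar, add_assoc, add_sub_cancel_left,
      inner_add_left, real_inner_smul_left, real_inner_smul_left, inner_baryGrad, inner_baryGrad]
  rw [mem_preimage, mem_openTriangle]
  simp only [hb, refTriangle, mem_ofPred_eq]
  constructor
  · intro h
    have h0 := h k
    have h1 := h (k + 1)
    have h2 := h (k + 2)
    fin_cases k <;> simp at h0 h1 h2 <;> exact ⟨h1, h2, by linarith⟩
  · rintro ⟨h1, h2, h3⟩ j
    fin_cases k <;> fin_cases j <;> simp <;> linarith

lemma setIntegral_openTriangle (k : Fin 3) (f : Plane → ℝ) :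
    ∫ z in openTriangle t, f z = triJac t * ∫ p in refTriangle, f (affPar (t.points k)
      (t.points (k + 1) - t.points k) (t.points (k + 2) - t.points k) p) := by
  rw [setIntegral_affPar (det2_ne_zero t k), preimage_openTriangle, triJac_eq]

/-- The mean value of `f` over an edge. -/
def edgeMean (f : Plane → ℝ) (k : Fin 3) : ℝ :=
  ∫ s in (0 : ℝ)..1, f (t.points (k + 1) + s • (t.points (k + 2) - t.points (k + 1)))

lemma setIntegral_edge (f : Plane → ℝ) (k : Fin 3) :
    ∫ z in edge t k, f z ∂arcLength = ‖baryGrad t k‖ * triJac t * edgeMean t f k := by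
  rw [edge_eq_segment, setIntegral_segment, norm_baryGrad_mul_triJac, edgeMean]
  intro h
  have := t.independent.injective h
  revert this
  fin_cases k <;> decide

/-- The divergence theorem on a triangle. -/
theorem setIntegral_fderiv_openTriangle {f : Plane → ℝ} (hf : ContDiff ℝ 1 f) (w : Plane) :
    ∫ z in openTriangle t, fderiv ℝ f z w =
      ∫ z in frontier (openTriangle t),
        f z * inner ℝ w (outwardNormal (openTriangle t) z) ∂arcLength := by
  rw [setIntegral_frontier_normal t (G := fun z n => f z * inner ℝ w n)
    (fun n => hf.continuous.mul continuous_const)]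
  have hR : ∀ k, ∫ z in edge t k, f z * inner ℝ w (edgeNormal t k) ∂arcLength =
      -(triJac t * inner ℝ w (baryGrad t k) * edgeMean t f k) := by
    intro k
    rw [integral_mul_const, setIntegral_edge, inner_edgeNormal]
    have := norm_ne_zero_iff.2 (baryGrad_ne_zero t k)
    field_simp
  simp only [hR, Fin.sum_univ_three]
  set u := t.points 1 - t.points 0 with hu
  set v := t.points 2 - t.points 0 with hv
  -- By linearity only the two edge directions matter, and for those both sides are combinations of
  -- the three edge means.
  have hw : ∃ a b : ℝ, w = a • u + b • v := by
    have hd : det2 u v ≠ 0 := det2_ne_zero t 0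
    refine ⟨det2 w v / det2 u v, det2 u w / det2 u v, ?_⟩
    apply plane_ext <;> simp only [PiLp.add_apply, PiLp.smul_apply, smul_eq_mul] <;>
      rw [div_mul_eq_mul_div, div_mul_eq_mul_div, ← add_div, eq_div_iff hd] <;>
      simp only [det2] <;> ring
  obtain ⟨a, b, rfl⟩ := hw
  have hcont : ∀ w, Continuous fun z => fderiv ℝ f z w := fun w =>
    (hf.continuous_fderiv one_ne_zero).clm_apply continuous_const
  have hint : ∀ w, IntegrableOn (fun p => fderiv ℝ f (affPar (t.points 0) u v p) w) refTriangle :=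
    fun w => integrableOn_refTriangle ((hcont w).comp (continuous_affPar _ _ _))
  have e0 := setIntegral_refTriangle_deriv hf (t.points 0) u v
  have e1 := setIntegral_refTriangle_deriv hf (t.points 0) v u
  rw [setIntegral_refTriangle_swap] at e1
  have hswap : ∀ p : ℝ × ℝ, affPar (t.points 0) v u p.swap = affPar (t.points 0) u v p := by
    intro p; simp only [affPar, Prod.fst_swap, Prod.snd_swap]; abel
  simp only [hswap] at e1
  have hL := setIntegral_openTriangle t 0 (fun z => fderiv ℝ f z (a • u + b • v))
  rw [hL]
  simp only [zero_add, map_add, map_smul, smul_eq_mul]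
  rw [← hu, ← hv]
  rw [integral_add ((hint u).const_mul a) ((hint v).const_mul b), integral_const_mul,
    integral_const_mul, e0, e1]
  have m0 : ∫ r in (0 : ℝ)..1, f (t.points 0 + u + r • (v - u)) = edgeMean t f 0 := by
    rw [edgeMean]; congr 1; funext r; congr 1
    simp [hu, hv]
  have m0' : ∫ r in (0 : ℝ)..1, f (t.points 0 + v + r • (u - v)) = edgeMean t f 0 := by
    rw [← m0]
    have := intervalIntegral.integral_comp_sub_left (a := 0) (b := 1)
      (fun r => f (t.points 0 + u + r • (v - u))) 1
    rw [sub_self, sub_zero] at this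
    rw [← this]
    congr 1; funext r; congr 1; module
  have m1 : ∫ r in (0 : ℝ)..1, f (t.points 0 + r • v) = edgeMean t f 1 := by
    have := intervalIntegral.integral_comp_sub_left (a := 0) (b := 1)
      (fun r => f (t.points 0 + r • v)) 1
    rw [sub_self, sub_zero] at this
    rw [← this, edgeMean]
    congr 1; funext r; congr 1
    simp [hv]; module
  have m2 : ∫ r in (0 : ℝ)..1, f (t.points 0 + r • u) = edgeMean t f 2 := by
    rw [edgeMean]; congr 1
  rw [m0, m0', m1, m2]
  simp only [inner_add_left, real_inner_smul_left, hu, hv, inner_baryGrad]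
  simp
  ring

end

noncomputable section

/-! ### Polynomial functions on the plane -/

section PolyFun

open MvPolynomial

lemma polyFun_add (q r : MvPolynomial (Fin 2) ℝ) (z : Plane) :
    polyFun (q + r) z = polyFun q z + polyFun r z := by simp [polyFun]

lemma polyFun_mul (q r : MvPolynomial (Fin 2) ℝ) (z : Plane) :
    polyFun (q * r) z = polyFun q z * polyFun r z := by simp [polyFun]

lemma polyFun_C (a : ℝ) (z : Plane) : polyFun (C a) z = a := by simp [polyFun]

lemma polyFun_X (i : Fin 2) (z : Plane) : polyFun (X i) z = z i := by simp [polyFun]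

lemma polyFun_C_mul (a : ℝ) (q : MvPolynomial (Fin 2) ℝ) (z : Plane) :
    polyFun (C a * q) z = a * polyFun q z := by rw [polyFun_mul, polyFun_C]

lemma contDiff_coord (i : Fin 2) {n : WithTop ℕ∞} : ContDiff ℝ n fun z : Plane => z i :=
  (EuclideanSpace.proj (𝕜 := ℝ) i).contDiff

lemma contDiff_polyFun (q : MvPolynomial (Fin 2) ℝ) {n : WithTop ℕ∞} :
    ContDiff ℝ n (polyFun q) := by
  induction q using MvPolynomial.induction_on with
  | C a =>
    rw [show polyFun (C a) = fun _ => a from funext (polyFun_C a)]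
    exact contDiff_const
  | add q r hq hr =>
    rw [show polyFun (q + r) = fun z => polyFun q z + polyFun r z from funext (polyFun_add q r)]
    exact hq.add hr
  | mul_X q i hq =>
    rw [show polyFun (q * X i) = fun z => polyFun q z * z i from
      funext fun z => by rw [polyFun_mul, polyFun_X]]
    exact hq.mul (contDiff_coord i)

lemma continuous_polyFun (q : MvPolynomial (Fin 2) ℝ) : Continuous (polyFun q) :=
  (contDiff_polyFun q (n := 0)).continuous

lemma hasFDerivAt_polyFun (q : MvPolynomial (Fin 2) ℝ) (z : Plane) :
    HasFDerivAt (polyFun q) (fderiv ℝ (polyFun q) z) z :=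
  ((contDiff_polyFun q (n := 1)).differentiable one_ne_zero z).hasFDerivAt

lemma pd_polyFun (q : MvPolynomial (Fin 2) ℝ) (i : Fin 2) :
    pd i (polyFun q) = polyFun (pderiv i q) := by
  funext z
  rw [pd]
  induction q using MvPolynomial.induction_on with
  | C a =>
    rw [show polyFun (C a) = fun _ => a from funext (polyFun_C a)]
    simp [polyFun]
  | add q r hq hr =>
    rw [show polyFun (q + r) = fun z => polyFun q z + polyFun r z from funext (polyFun_add q r),
      ((hasFDerivAt_polyFun q z).fun_add (hasFDerivAt_polyFun r z)).fderiv,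
      add_apply, hq, hr, map_add, polyFun_add]
  | mul_X q j hq =>
    have hX : HasFDerivAt (fun z : Plane => z j) (EuclideanSpace.proj (𝕜 := ℝ) j) z :=
      (EuclideanSpace.proj (𝕜 := ℝ) j).hasFDerivAt
    rw [show polyFun (q * X j) = fun z => polyFun q z * z j from
      funext fun z => by rw [polyFun_mul, polyFun_X],
      ((hasFDerivAt_polyFun q z).fun_mul hX).fderiv, Derivation.leibniz, pderiv_X]
    simp only [add_apply, smul_apply, hq, smul_eq_mul, PiLp.proj_apply, polyFun_add, polyFun_mul,
      polyFun_X, Pi.single_apply]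
    rcases eq_or_ne j i with rfl | h
    · simp [polyFun]
    · simp [polyFun, h]

lemma fderiv_apply_eq_pd (f : Plane → ℝ) (z w : Plane) :
    fderiv ℝ f z w = w 0 * pd 0 f z + w 1 * pd 1 f z := by
  have hw : w = w 0 • EuclideanSpace.single (0 : Fin 2) (1 : ℝ) +
      w 1 • EuclideanSpace.single (1 : Fin 2) (1 : ℝ) := by
    apply plane_ext <;> simp
  conv_lhs => rw [hw]
  rw [map_add, map_smul, map_smul]
  rfl

lemma totalDegree_pderiv_le (i : Fin 2) (q : MvPolynomial (Fin 2) ℝ) :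
    (pderiv i q).totalDegree ≤ q.totalDegree := by
  classical
  rw [totalDegree, Finset.sup_le_iff]
  intro m hm
  have hcoef : coeff (m + Finsupp.single i 1) q ≠ 0 := by
    intro h
    rw [mem_support_iff, coeff_pderiv, h, mul_comm] at hm
    simp at hm
  have h := le_totalDegree (mem_support_iff.2 hcoef)
  rw [Finsupp.sum_add_index' (fun _ => rfl) (fun _ _ _ => rfl)] at h
  exact le_of_add_le_left h

lemma totalDegree_linComb_le {q r : MvPolynomial (Fin 2) ℝ} {p : ℕ} (hq : q.totalDegree ≤ p)
    (hr : r.totalDegree ≤ p) (a b : ℝ) : (C a * q + C b * r).totalDegree ≤ p := by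
  refine (totalDegree_add _ _).trans (max_le ?_ ?_)
  · exact (totalDegree_mul _ _).trans (by rwa [totalDegree_C, zero_add])
  · exact (totalDegree_mul _ _).trans (by rwa [totalDegree_C, zero_add])

lemma exists_polynomial_on_line (q : MvPolynomial (Fin 2) ℝ) (A w : Plane) :
    ∃ r : Polynomial ℝ, r.natDegree ≤ q.totalDegree ∧
      ∀ s : ℝ, r.eval s = polyFun q (A + s • w) := by
  refine ⟨aeval (fun i => Polynomial.C (A i) + Polynomial.C (w i) * Polynomial.X) q, ?_, ?_⟩
  · have := MvPolynomial.aeval_natDegree_le q le_rfl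
      (fun i => Polynomial.C (A i) + Polynomial.C (w i) * Polynomial.X) (n := 1)
      (fun i => by compute_degree)
    rwa [mul_one] at this
  · intro s
    induction q using MvPolynomial.induction_on with
    | C a => simp [polyFun]
    | add q r hq hr => rw [map_add, Polynomial.eval_add, hq, hr, polyFun_add]
    | mul_X q i hq =>
      rw [map_mul, Polynomial.eval_mul, hq, polyFun_mul, polyFun_X, aeval_X, Polynomial.eval_add,
        Polynomial.eval_mul, Polynomial.eval_C, Polynomial.eval_C, Polynomial.eval_X,
        PiLp.add_apply, PiLp.smul_apply, smul_eq_mul, mul_comm s]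

lemma integral_line_fderiv_sq_le {q : MvPolynomial (Fin 2) ℝ} {p : ℕ} (hp : 1 ≤ p)
    (hq : q.totalDegree ≤ p) (A w : Plane) :
    ∫ s in (0 : ℝ)..1, fderiv ℝ (polyFun q) (A + s • w) w ^ 2 ≤
      13 * (p : ℝ) ^ 4 * ∫ s in (0 : ℝ)..1, polyFun q (A + s • w) ^ 2 := by
  obtain ⟨r, hr, hrs⟩ := exists_polynomial_on_line q A w
  have h := integral_derivative_sq_le hp r (hr.trans hq)
  have hder : ∀ s, r.derivative.eval s = fderiv ℝ (polyFun q) (A + s • w) w := by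
    intro s
    have h1 : HasDerivAt (fun s : ℝ => A + s • w) w s := by
      simpa using ((hasDerivAt_id s).smul_const w).const_add A
    have h2 : HasDerivAt (polyFun q ∘ fun s : ℝ => A + s • w)
        (fderiv ℝ (polyFun q) (A + s • w) w) s :=
      (hasFDerivAt_polyFun q (A + s • w)).comp_hasDerivAt s h1
    have h3 := r.hasDerivAt s
    rw [show (fun s => r.eval s) = polyFun q ∘ fun s => A + s • w from funext hrs] at h3
    exact h3.unique h2
  simpa only [hder, hrs] using h

end PolyFun

/-! ### Inverse inequalities on parallelograms -/

/-- The closed parallelogram with corner `A` and sides `u`, `v`. -/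
def parallelogram (A u v : Plane) : Set Plane := affPar A u v '' (Icc 0 1 ×ˢ Icc 0 1)

lemma isCompact_parallelogram (A u v : Plane) : IsCompact (parallelogram A u v) :=
  (isCompact_Icc.prod isCompact_Icc).image (continuous_affPar A u v)

lemma parallelogram_swap (A u v : Plane) : parallelogram A u v = parallelogram A v u := by
  have : ∀ u v : Plane, parallelogram A u v ⊆ parallelogram A v u := by
    rintro u v _ ⟨⟨s, t⟩, ⟨hs, ht⟩, rfl⟩
    exact ⟨(t, s), ⟨ht, hs⟩, by simp only [affPar]; abel⟩
  exact (this u v).antisymm (this v u)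

lemma setIntegral_parallelogram {A u v : Plane} (hd : det2 u v ≠ 0) {f : Plane → ℝ}
    (hf : Continuous f) : ∫ z in parallelogram A u v, f z =
      |det2 u v| * ∫ s in Icc (0 : ℝ) 1, ∫ r in (0 : ℝ)..1, f (A + s • u + r • v) := by
  rw [parallelogram, setIntegral_affPar hd, preimage_image_eq _ (injective_affPar hd),
    Measure.volume_eq_prod, setIntegral_prod]
  · simp only [intervalIntegral.integral_of_le zero_le_one, ← integral_Icc_eq_integral_Ioc]
    rfl
  · exact (hf.comp (continuous_affPar A u v)).continuousOn.integrableOn_compact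
      (isCompact_Icc.prod isCompact_Icc)

/-- By Fubini this is the Markov inequality on each line parallel to `v`. In a parallelogram all
these lines have the full length of the side, unlike in a triangle, where they degenerate. -/
lemma setIntegral_parallelogram_fderiv_sq_le {A u v : Plane} (hd : det2 u v ≠ 0)
    {q : MvPolynomial (Fin 2) ℝ} {p : ℕ} (hp : 1 ≤ p) (hq : q.totalDegree ≤ p) :
    ∫ z in parallelogram A u v, fderiv ℝ (polyFun q) z v ^ 2 ≤
      13 * (p : ℝ) ^ 4 * ∫ z in parallelogram A u v, polyFun q z ^ 2 := by
  have hc1 : Continuous fun z => fderiv ℝ (polyFun q) z v ^ 2 :=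
    (((contDiff_polyFun q (n := 1)).continuous_fderiv one_ne_zero).clm_apply
      continuous_const).pow 2
  have hc2 : Continuous fun z => polyFun q z ^ 2 := (continuous_polyFun q).pow 2
  rw [setIntegral_parallelogram hd hc1, setIntegral_parallelogram hd hc2, mul_left_comm]
  refine mul_le_mul_of_nonneg_left ?_ (abs_nonneg _)
  rw [← integral_const_mul]
  have hi : ∀ {f : Plane → ℝ}, Continuous f → Continuous fun s : ℝ =>
      ∫ r in (0 : ℝ)..1, f (A + s • u + r • v) := fun {f} hf =>
    intervalIntegral.continuous_parametric_intervalIntegral_of_continuous' (by fun_prop) _ _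
  refine setIntegral_mono ((hi hc1).continuousOn.integrableOn_compact isCompact_Icc)
    (((hi hc2).continuousOn.integrableOn_compact isCompact_Icc).const_mul _) fun s => ?_
  exact integral_line_fderiv_sq_le hp hq (A + s • u) v

/-- The constant is `52 = 2 · 2 · 13`: one factor from squaring a sum, one from the two directions,
and the Markov constant. -/
lemma setIntegral_parallelogram_fderiv_comb_sq_le {A u v : Plane} (hd : det2 u v ≠ 0)
    {q : MvPolynomial (Fin 2) ℝ} {p : ℕ} (hp : 1 ≤ p) (hq : q.totalDegree ≤ p) {a b c : ℝ}
    (ha : a ^ 2 ≤ c) (hb : b ^ 2 ≤ c) :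
    ∫ z in parallelogram A u v, fderiv ℝ (polyFun q) z (a • u + b • v) ^ 2 ≤
      52 * c * (p : ℝ) ^ 4 * ∫ z in parallelogram A u v, polyFun q z ^ 2 := by
  have hc : ∀ w, Continuous fun z => fderiv ℝ (polyFun q) z w ^ 2 := fun w =>
    (((contDiff_polyFun q (n := 1)).continuous_fderiv one_ne_zero).clm_apply
      continuous_const).pow 2
  have hi : ∀ w, IntegrableOn (fun z => fderiv ℝ (polyFun q) z w ^ 2) (parallelogram A u v) :=
    fun w => (hc w).continuousOn.integrableOn_compact (isCompact_parallelogram A u v)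
  have hc0 : 0 ≤ c := (sq_nonneg a).trans ha
  have hv := setIntegral_parallelogram_fderiv_sq_le (A := A) hd hp hq
  have hu := setIntegral_parallelogram_fderiv_sq_le (A := A) (u := v) (v := u)
    (by intro h; apply hd; rw [det2] at h ⊢; linarith) hp hq
  rw [parallelogram_swap A v u] at hu
  calc ∫ z in parallelogram A u v, fderiv ℝ (polyFun q) z (a • u + b • v) ^ 2
      ≤ ∫ z in parallelogram A u v, (2 * c * fderiv ℝ (polyFun q) z u ^ 2 +
          2 * c * fderiv ℝ (polyFun q) z v ^ 2) := by
        refine setIntegral_mono (hi _) (((hi u).const_mul _).add ((hi v).const_mul _)) fun z => ?_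
        simp only [map_add, map_smul, smul_eq_mul]
        nlinarith [sq_nonneg (a * fderiv ℝ (polyFun q) z u - b * fderiv ℝ (polyFun q) z v),
          mul_le_mul_of_nonneg_right ha (sq_nonneg (fderiv ℝ (polyFun q) z u)),
          mul_le_mul_of_nonneg_right hb (sq_nonneg (fderiv ℝ (polyFun q) z v))]
    _ = 2 * c * (∫ z in parallelogram A u v, fderiv ℝ (polyFun q) z u ^ 2) +
          2 * c * ∫ z in parallelogram A u v, fderiv ℝ (polyFun q) z v ^ 2 := by
        rw [integral_add ((hi u).const_mul _) ((hi v).const_mul _), integral_const_mul,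
          integral_const_mul]
    _ ≤ 2 * c * (13 * (p : ℝ) ^ 4 * ∫ z in parallelogram A u v, polyFun q z ^ 2) +
          2 * c * (13 * (p : ℝ) ^ 4 * ∫ z in parallelogram A u v, polyFun q z ^ 2) := by
        gcongr
    _ = _ := by ring

/-! ### Inverse inequalities on shape-regular triangles -/

variable (t : Affine.Triangle ℝ Plane)

/-- The parallelogram spanned by the halves of the two edges at the `k`-th vertex. -/
def cornerParallelogram (k : Fin 3) : Set Plane :=
  parallelogram (t.points k) ((1 / 2 : ℝ) • (t.points (k + 1) - t.points k))
    ((1 / 2 : ℝ) • (t.points (k + 2) - t.points k))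

lemma eq_add_bary_smul (k : Fin 3) (z : Plane) :
    z = t.points k + bary t (k + 1) z • (t.points (k + 1) - t.points k) +
      bary t (k + 2) z • (t.points (k + 2) - t.points k) := by
  have h1 := sum_bary t z
  have h2 := sum_bary_smul t z
  nth_rewrite 1 [← h2]
  fin_cases k <;> simp
  · rw [show bary t 0 z = 1 - bary t 1 z - bary t 2 z by linarith]; module
  · rw [show bary t 1 z = 1 - bary t 0 z - bary t 2 z by linarith]; module
  · rw [show bary t 2 z = 1 - bary t 0 z - bary t 1 z by linarith]; module

lemma eq_inner_baryGrad_smul (k : Fin 3) (w : Plane) :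
    w = inner ℝ w (baryGrad t (k + 1)) • (t.points (k + 1) - t.points k) +
      inner ℝ w (baryGrad t (k + 2)) • (t.points (k + 2) - t.points k) := by
  have h := eq_add_bary_smul t k (t.points k + w)
  rw [bary_sub t (k + 1) (t.points k), bary_sub t (k + 2) (t.points k), bary_vertex, bary_vertex,
    if_neg (by fin_cases k <;> decide), if_neg (by fin_cases k <;> decide), zero_add, zero_add,
    add_sub_cancel_left, add_assoc] at h
  exact add_left_cancel h

/-- The coordinates sum to one, so at most one exceeds `1/2`, and the parallelogram at that vertex
contains the point. -/
lemma closure_subset_iUnion_cornerParallelogram :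
    closure (openTriangle t) ⊆ ⋃ k, cornerParallelogram t k := by
  intro z hz
  rw [mem_closure_openTriangle] at hz
  have h1 := sum_bary t z
  have key : ∀ k, bary t (k + 1) z ≤ 1 / 2 → bary t (k + 2) z ≤ 1 / 2 →
      z ∈ ⋃ k, cornerParallelogram t k := by
    intro k ha hb
    refine mem_iUnion.2 ⟨k, (2 * bary t (k + 1) z, 2 * bary t (k + 2) z), ⟨⟨?_, ?_⟩, ⟨?_, ?_⟩⟩, ?_⟩
    · linarith [hz (k + 1)]
    · linarith
    · linarith [hz (k + 2)]
    · linarith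
    · conv_rhs => rw [eq_add_bary_smul t k z]
      simp only [affPar, smul_smul]
      congr 3 <;> ring
  have h0 := key 0
  have h1' := key 1
  have h2 := key 2
  simp only [Fin.reduceAdd, zero_add] at h0 h1' h2
  by_cases a0 : bary t 0 z ≤ 1 / 2
  · by_cases a1 : bary t 1 z ≤ 1 / 2
    · exact h2 a0 a1
    · exact h1' (by linarith [hz 0, hz 1, hz 2]) a0
  · exact h0 (by linarith [hz 0, hz 1, hz 2]) (by linarith [hz 0, hz 1, hz 2])

lemma cornerParallelogram_subset (k : Fin 3) :
    cornerParallelogram t k ⊆ closure (openTriangle t) := by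
  rintro _ ⟨⟨a, b⟩, ⟨⟨ha0, ha1⟩, hb0, hb1⟩, rfl⟩
  have hc := (convex_openTriangle t).closure
  simp only at ha0 ha1 hb0 hb1
  have h1 := hc (vertex_mem_closure t k) (vertex_mem_closure t (k + 1))
    (show 0 ≤ 1 - a by linarith) ha0 (by ring)
  have h2 := hc (vertex_mem_closure t k) (vertex_mem_closure t (k + 2))
    (show 0 ≤ 1 - b by linarith) hb0 (by ring)
  have h3 := hc h1 h2 (show (0 : ℝ) ≤ 1 / 2 by norm_num) (show (0 : ℝ) ≤ 1 / 2 by norm_num)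
    (by norm_num)
  convert h3 using 1
  simp only [affPar]; module

lemma openTriangle_ae_eq_closure :
    (openTriangle t : Set Plane) =ᵐ[volume] closure (openTriangle t) := by
  refine (ae_eq_set.2 ⟨?_, ?_⟩)
  · rw [sdiff_eq_empty.2 subset_closure, measure_empty]
  · rw [← (isOpen_openTriangle t).frontier_eq]
    exact (convex_openTriangle t).addHaar_frontier volume

lemma integrableOn_openTriangle {f : Plane → ℝ} (hf : Continuous f) :
    IntegrableOn f (openTriangle t) :=
  (hf.continuousOn.integrableOn_compact (isCompact_closure_openTriangle t)).mono_set
    subset_closure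

lemma setIntegral_openTriangle_le_sum {f : Plane → ℝ} (hf : Continuous f) (h0 : ∀ z, 0 ≤ f z) :
    ∫ z in openTriangle t, f z ≤ ∑ k, ∫ z in cornerParallelogram t k, f z := by
  have hm : ∀ k, MeasurableSet (cornerParallelogram t k) := fun k =>
    (isCompact_parallelogram _ _ _).isClosed.measurableSet
  have hi : ∀ k, Integrable ((cornerParallelogram t k).indicator f) := fun k =>
    (hf.continuousOn.integrableOn_compact (isCompact_parallelogram _ _ _)).integrable_indicator
      (hm k)
  simp only [← integral_indicator (hm _),
    ← integral_indicator (isOpen_openTriangle t).measurableSet]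
  rw [← integral_finsetSum _ fun k _ => hi k]
  refine integral_mono ((integrableOn_openTriangle t hf).integrable_indicator
    (isOpen_openTriangle t).measurableSet) (integrable_finsetSum _ fun k _ => hi k) fun z => ?_
  by_cases hz : z ∈ openTriangle t
  · obtain ⟨k, hk⟩ := mem_iUnion.1
      (closure_subset_iUnion_cornerParallelogram t (subset_closure hz))
    rw [indicator_of_mem hz]
    refine le_trans ?_ (Finset.single_le_sum (f := fun k => (cornerParallelogram t k).indicator f z)
      (fun k _ => indicator_nonneg (fun z _ => h0 z) z) (Finset.mem_univ k))
    simp only [indicator_of_mem hk, le_refl]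
  · rw [indicator_of_notMem hz]
    exact Finset.sum_nonneg fun k _ => indicator_nonneg (fun z _ => h0 z) z

/-- A barycentric coordinate stays in `[0, 1]`, so it changes by at most one over the distance `ρ /
2` covered inside the disc. -/
lemma abs_inner_baryGrad_le {c : Plane} {ρ : ℝ} (hρ : 0 < ρ)
    (hc : Metric.ball c ρ ⊆ openTriangle t) {w : Plane} (hw : ‖w‖ = 1) (k : Fin 3) :
    |inner ℝ w (baryGrad t k)| ≤ 2 / ρ := by
  have h1 : c ∈ closure (openTriangle t) := subset_closure (hc (Metric.mem_ball_self hρ))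
  have h2 : c + (ρ / 2) • w ∈ closure (openTriangle t) := by
    refine subset_closure (hc ?_)
    rw [Metric.mem_ball, dist_eq_norm, add_sub_cancel_left, norm_smul, hw,
      Real.norm_of_nonneg (by positivity)]
    linarith
  have h3 := bary_sub t k c (c + (ρ / 2) • w)
  rw [add_sub_cancel_left, real_inner_smul_left] at h3
  have a1 := bary_le_one t h1 k
  have a2 := bary_le_one t h2 k
  have a3 := (mem_closure_openTriangle t).1 h1 k
  have a4 := (mem_closure_openTriangle t).1 h2 k
  rw [abs_le]
  constructor
  · rw [neg_le, le_div_iff₀ hρ]; linarith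
  · rw [le_div_iff₀ hρ]; linarith

end

noncomputable section

lemma gradInverse_iff {C : ℝ} (hC : 0 < C) {p : ℕ} (t : Affine.Triangle ℝ Plane) :
    GradInverse C p t ↔ ∀ q : MvPolynomial (Fin 2) ℝ, q.totalDegree ≤ p →
      ∫ z in openTriangle t, (pd 0 (polyFun q) z ^ 2 + pd 1 (polyFun q) z ^ 2) ≤
        (C * (p : ℝ) ^ 2 / meshSize t) ^ 2 * ∫ z in openTriangle t, polyFun q z ^ 2 := by
  have hh := meshSize_pos t
  refine forall_congr' fun q => imp_congr_right fun _ => ?_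
  have h0 : 0 ≤ ∫ z in openTriangle t, polyFun q z ^ 2 := integral_nonneg fun z => sq_nonneg _
  have hκ : 0 ≤ C * (p : ℝ) ^ 2 / meshSize t := by positivity
  rw [Real.sqrt_le_left (by positivity), mul_pow, Real.sq_sqrt h0]

variable (t : Affine.Triangle ℝ Plane)

/-- In terms of the half edges the coefficients of `w` are at most `4 / ρ`. Each parallelogram thus
contributes `52 · 16 = 832`, and the three together `2496`. -/
lemma setIntegral_fderiv_sq_le_of_ball {c : Plane} {ρ : ℝ} (hρ : 0 < ρ)
    (hc : Metric.ball c ρ ⊆ openTriangle t) {w : Plane} (hw : ‖w‖ = 1)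
    {q : MvPolynomial (Fin 2) ℝ} {p : ℕ} (hp : 1 ≤ p) (hq : q.totalDegree ≤ p) :
    ∫ z in openTriangle t, fderiv ℝ (polyFun q) z w ^ 2 ≤
      2496 / ρ ^ 2 * (p : ℝ) ^ 4 * ∫ z in openTriangle t, polyFun q z ^ 2 := by
  have hcont : Continuous fun z => fderiv ℝ (polyFun q) z w ^ 2 :=
    (((contDiff_polyFun q (n := 1)).continuous_fderiv one_ne_zero).clm_apply
      continuous_const).pow 2
  have hq2 : Continuous fun z => polyFun q z ^ 2 := (continuous_polyFun q).pow 2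
  refine (setIntegral_openTriangle_le_sum t hcont fun z => sq_nonneg _).trans ?_
  have hk : ∀ k, ∫ z in cornerParallelogram t k, fderiv ℝ (polyFun q) z w ^ 2 ≤
      832 / ρ ^ 2 * (p : ℝ) ^ 4 * ∫ z in openTriangle t, polyFun q z ^ 2 := by
    intro k
    have hcoef : ∀ j, (2 * inner ℝ w (baryGrad t j)) ^ 2 ≤ 16 / ρ ^ 2 := by
      intro j
      have h1 := abs_inner_baryGrad_le t hρ hc hw j
      have h2 : inner ℝ w (baryGrad t j) ^ 2 ≤ (2 / ρ) ^ 2 := sq_le_sq' (abs_le.1 h1).1 (abs_le.1 h1).2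
      calc (2 * inner ℝ w (baryGrad t j)) ^ 2 = 4 * inner ℝ w (baryGrad t j) ^ 2 := by ring
        _ ≤ 4 * (2 / ρ) ^ 2 := by gcongr
        _ = _ := by ring
    have hdet : det2 ((1 / 2 : ℝ) • (t.points (k + 1) - t.points k))
        ((1 / 2 : ℝ) • (t.points (k + 2) - t.points k)) ≠ 0 := by
      intro h
      apply det2_ne_zero t k
      simp only [det2, PiLp.smul_apply, smul_eq_mul] at h ⊢
      linarith
    have h3 := setIntegral_parallelogram_fderiv_comb_sq_le (A := t.points k) hdet hp hq
      (hcoef (k + 1)) (hcoef (k + 2))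
    have hweq : (2 * inner ℝ w (baryGrad t (k + 1))) •
        ((1 / 2 : ℝ) • (t.points (k + 1) - t.points k)) + (2 * inner ℝ w (baryGrad t (k + 2))) •
        ((1 / 2 : ℝ) • (t.points (k + 2) - t.points k)) = w := by
      conv_rhs => rw [eq_inner_baryGrad_smul t k w]
      rw [smul_smul, smul_smul]
      congr 2 <;> ring
    rw [hweq] at h3
    refine h3.trans ?_
    rw [show 52 * (16 / ρ ^ 2) * (p : ℝ) ^ 4 = 832 / ρ ^ 2 * (p : ℝ) ^ 4 by ring,
      setIntegral_congr_set (openTriangle_ae_eq_closure t)]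
    refine mul_le_mul_of_nonneg_left ?_ (by positivity)
    exact setIntegral_mono_set (hq2.continuousOn.integrableOn_compact
      (isCompact_closure_openTriangle t)) (Filter.Eventually.of_forall fun z => sq_nonneg _)
      (cornerParallelogram_subset t k).eventuallyLE
  refine (Finset.sum_le_sum fun k _ => hk k).trans (le_of_eq ?_)
  rw [Finset.sum_const, Finset.card_univ, Fintype.card_fin]
  simp; ring

theorem ShapeRegular.gradInverse {σ : ℝ} (hσ : 0 < σ) {t : Affine.Triangle ℝ Plane}
    (ht : ShapeRegular σ t) {p : ℕ} (hp : 1 ≤ p) : GradInverse (71 / σ) p t := by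
  obtain ⟨c, hc⟩ := ht
  have hh := meshSize_pos t
  rw [gradInverse_iff (by positivity)]
  intro q hq
  have hcont : ∀ i, Continuous fun z => pd i (polyFun q) z ^ 2 := fun i => by
    rw [pd_polyFun]; exact (continuous_polyFun _).pow 2
  rw [integral_add (integrableOn_openTriangle t (hcont 0)) (integrableOn_openTriangle t (hcont 1))]
  have h0 : 0 ≤ ∫ z in openTriangle t, polyFun q z ^ 2 := integral_nonneg fun z => sq_nonneg _
  have h : ∀ i : Fin 2, ∫ z in openTriangle t, pd i (polyFun q) z ^ 2 ≤
      2496 / (σ * meshSize t) ^ 2 * (p : ℝ) ^ 4 * ∫ z in openTriangle t, polyFun q z ^ 2 :=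
    fun i => setIntegral_fderiv_sq_le_of_ball t (by positivity) hc (by simp) hp hq
  calc _ ≤ 2496 / (σ * meshSize t) ^ 2 * (p : ℝ) ^ 4 * (∫ z in openTriangle t, polyFun q z ^ 2) +
        2496 / (σ * meshSize t) ^ 2 * (p : ℝ) ^ 4 * ∫ z in openTriangle t, polyFun q z ^ 2 :=
        add_le_add (h 0) (h 1)
    _ = 4992 * ((p : ℝ) ^ 4 / (σ * meshSize t) ^ 2) *
        ∫ z in openTriangle t, polyFun q z ^ 2 := by ring
    -- Here `5041 = 71²` rounds the constant up to a perfect square.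
    _ ≤ 5041 * ((p : ℝ) ^ 4 / (σ * meshSize t) ^ 2) *
        ∫ z in openTriangle t, polyFun q z ^ 2 := by gcongr; norm_num
    _ = _ := by
      congr 1
      field_simp
      norm_num

/-! ### The trace inverse inequality from the radial field `z - c` -/

lemma setIntegral_radial {f : Plane → ℝ} (hf : ContDiff ℝ 1 f) (c : Plane) :
    ∫ z in openTriangle t, (2 * f z + fderiv ℝ f z (z - c)) =
      ∫ z in frontier (openTriangle t),
        f z * inner ℝ (z - c) (outwardNormal (openTriangle t) z) ∂arcLength := by
  have hg : ∀ i : Fin 2, ContDiff ℝ 1 fun z : Plane => (z i - c i) * f z := fun i =>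
    ((contDiff_coord i).sub contDiff_const).mul hf
  have hdiv : ∀ i : Fin 2, ∫ z in openTriangle t, (f z + (z i - c i) * pd i f z) =
      ∫ z in frontier (openTriangle t),
        (z i - c i) * f z * outwardNormal (openTriangle t) z i ∂arcLength := by
    intro i
    have h := setIntegral_fderiv_openTriangle t (hg i) (EuclideanSpace.single i 1)
    have e1 : ∀ z, fderiv ℝ (fun z : Plane => (z i - c i) * f z) z (EuclideanSpace.single i 1) =
        f z + (z i - c i) * pd i f z := by
      intro z
      have h1 : HasFDerivAt (fun z : Plane => z i - c i) (EuclideanSpace.proj (𝕜 := ℝ) i) z :=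
        (EuclideanSpace.proj (𝕜 := ℝ) i).hasFDerivAt.sub_const _
      rw [(h1.fun_mul (hf.differentiable one_ne_zero z).hasFDerivAt).fderiv]
      simp [pd]; ring
    have e2 : ∀ n : Plane, inner ℝ (EuclideanSpace.single i (1 : ℝ)) n = n i := by
      intro n; simp [EuclideanSpace.inner_single_left]
    simpa only [e1, e2] using h
  have hpd : ∀ i, Continuous fun z => pd i f z := fun i =>
    (hf.continuous_fderiv one_ne_zero).clm_apply continuous_const
  have hfc := hf.continuous
  have hcoord : ∀ i : Fin 2, Continuous fun z : Plane => z i := fun i =>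
    (contDiff_coord i (n := 0)).continuous
  have hL : ∀ i : Fin 2, IntegrableOn (fun z => f z + (z i - c i) * pd i f z) (openTriangle t) :=
    fun i => integrableOn_openTriangle t (hfc.add (((hcoord i).sub continuous_const).mul (hpd i)))
  have hR : ∀ i : Fin 2, IntegrableOn (fun z => (z i - c i) * f z *
      outwardNormal (openTriangle t) z i) (frontier (openTriangle t)) arcLength :=
    fun i => integrableOn_frontier_normal t (G := fun z n => (z i - c i) * f z * n i)
      fun n => (((hcoord i).sub continuous_const).mul hfc).mul continuous_const
  have h := congrArg₂ (· + ·) (hdiv 0) (hdiv 1)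
  simp only at h
  rw [← integral_add (hL 0) (hL 1), ← integral_add (hR 0) (hR 1)] at h
  refine Eq.trans (integral_congr_ae (Filter.Eventually.of_forall fun z => ?_))
    (h.trans (integral_congr_ae (Filter.Eventually.of_forall fun z => ?_)))
  · simp only
    rw [fderiv_apply_eq_pd, PiLp.sub_apply, PiLp.sub_apply]; ring
  · simp only
    rw [plane_inner, PiLp.sub_apply, PiLp.sub_apply]; ring

lemma ae_frontier_of_edge {P : Plane → Plane → Prop}
    (h : ∀ k, ∀ z ∈ edge t k, P z (edgeNormal t k)) :
    ∀ᵐ z ∂arcLength.restrict (frontier (openTriangle t)),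
      P z (outwardNormal (openTriangle t) z) := by
  rw [ae_restrict_iff' isClosed_frontier.measurableSet]
  filter_upwards [ae_notMem_finite (finite_range t.points)] with z hv hz
  rw [frontier_eq_iUnion_edge, mem_iUnion] at hz
  obtain ⟨k, hk⟩ := hz
  rw [(isOutwardNormal_of_mem_edge t hk hv).outwardNormal_eq]
  exact h k z hk

/-- Moving from `c` by less than `ρ` along the normal stays inside the triangle, hence on the inner
side of the edge. So the radial field has outward flux at least `ρ`. -/
lemma le_inner_edgeNormal_of_ball {c : Plane} {ρ : ℝ} (hρ : 0 < ρ)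
    (hc : Metric.ball c ρ ⊆ openTriangle t) {k : Fin 3} {z : Plane} (hz : z ∈ edge t k) :
    ρ ≤ inner ℝ (z - c) (edgeNormal t k) := by
  refine le_of_forall_lt_imp_le_of_dense fun r hr => ?_
  rcases le_or_gt r 0 with h0 | h0
  · refine h0.trans ?_
    have h1 := (mem_openTriangle t).1 (hc (Metric.mem_ball_self hρ)) k
    rw [← inner_edgeNormal_lt_zero_iff t hz.2, ← neg_sub, inner_neg_left] at h1
    linarith
  · have hmem : c + r • edgeNormal t k ∈ openTriangle t := by
      refine hc ?_
      rw [Metric.mem_ball, dist_eq_norm, add_sub_cancel_left, norm_smul, norm_edgeNormal,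
        Real.norm_of_nonneg h0.le, mul_one]
      exact hr
    have h1 := (mem_openTriangle t).1 hmem k
    rw [← inner_edgeNormal_lt_zero_iff t hz.2, show c + r • edgeNormal t k - z =
      r • edgeNormal t k - (z - c) by abel, inner_sub_left, real_inner_smul_left,
      real_inner_self_eq_norm_sq, norm_edgeNormal] at h1
    linarith

lemma abs_fderiv_mul_le {f : Plane → ℝ} (z w : Plane) {κ h : ℝ} (hκ : 0 < κ) (hw : ‖w‖ ≤ h) :
    2 * f z * fderiv ℝ f z w ≤ κ * f z ^ 2 + h ^ 2 / κ * (pd 0 f z ^ 2 + pd 1 f z ^ 2) := by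
  rw [fderiv_apply_eq_pd]
  have h1 : (w 0 * pd 0 f z + w 1 * pd 1 f z) ^ 2 ≤ h ^ 2 * (pd 0 f z ^ 2 + pd 1 f z ^ 2) := by
    have h2 : w 0 ^ 2 + w 1 ^ 2 ≤ h ^ 2 := by
      rw [← plane_norm_sq]
      exact pow_le_pow_left₀ (norm_nonneg _) hw 2
    nlinarith [sq_nonneg (w 0 * pd 1 f z - w 1 * pd 0 f z), sq_nonneg (pd 0 f z),
      sq_nonneg (pd 1 f z)]
  rw [div_mul_eq_mul_div, ← sub_le_iff_le_add', le_div_iff₀ hκ]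
  nlinarith [sq_nonneg (κ * f z - (w 0 * pd 0 f z + w 1 * pd 1 f z))]

theorem ShapeRegular.traceInverse {σ C : ℝ} (hσ : 0 < σ) (hC : 0 < C)
    {t : Affine.Triangle ℝ Plane} (ht : ShapeRegular σ t) {p : ℕ} (hp : 1 ≤ p)
    (hG : GradInverse C p t) : TraceInverse ((2 + 2 * C) / σ) p t := by
  obtain ⟨c, hc⟩ := ht
  have hh := meshSize_pos t
  have hp1 : (1 : ℝ) ≤ p := by exact_mod_cast hp
  rw [gradInverse_iff hC] at hG
  intro q hq
  have hρ : 0 < σ * meshSize t := by positivity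
  have hqc := continuous_polyFun q
  have hf : ContDiff ℝ 1 fun z => polyFun q z ^ 2 := (contDiff_polyFun q).pow 2
  have hdiv := setIntegral_radial t hf c
  have hder : ∀ z w, fderiv ℝ (fun z => polyFun q z ^ 2) z w =
      2 * polyFun q z * fderiv ℝ (polyFun q) z w := by
    intro z w
    rw [((hasFDerivAt_polyFun q z).pow 2).fderiv]
    simp
  have hlow : σ * meshSize t * ∫ z in frontier (openTriangle t), polyFun q z ^ 2 ∂arcLength ≤
      ∫ z in frontier (openTriangle t), polyFun q z ^ 2 *
        inner ℝ (z - c) (outwardNormal (openTriangle t) z) ∂arcLength := by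
    rw [← integral_const_mul]
    refine integral_mono_ae ((integrableOn_frontier_of_continuous t (hqc.pow 2)).const_mul _)
      (integrableOn_frontier_normal t (G := fun z n => polyFun q z ^ 2 * inner ℝ (z - c) n)
        fun n => by fun_prop) ?_
    refine ae_frontier_of_edge t (P := fun z n => σ * meshSize t * polyFun q z ^ 2 ≤
      polyFun q z ^ 2 * inner ℝ (z - c) n) fun k z hz => ?_
    rw [mul_comm]
    exact mul_le_mul_of_nonneg_left (le_inner_edgeNormal_of_ball t hρ hc hz) (sq_nonneg _)
  have hcm : c ∈ closure (openTriangle t) := subset_closure (hc (Metric.mem_ball_self hρ))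
  -- This Young weight balances the two terms: with the gradient inverse inequality, `h² / κ · (κ /
  -- h)² = κ`.
  set κ : ℝ := C * (p : ℝ) ^ 2 with hκ
  have hκ0 : 0 < κ := by positivity
  have hpd : ∀ i, Continuous (pd i (polyFun q)) := fun i => by
    rw [pd_polyFun]; exact continuous_polyFun _
  have hi1 : IntegrableOn (fun z => polyFun q z ^ 2) (openTriangle t) :=
    integrableOn_openTriangle t (hqc.pow 2)
  have hi2 : IntegrableOn (fun z => pd 0 (polyFun q) z ^ 2 + pd 1 (polyFun q) z ^ 2)
      (openTriangle t) := integrableOn_openTriangle t (((hpd 0).pow 2).add ((hpd 1).pow 2))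
  have hup : ∫ z in openTriangle t, (2 * polyFun q z ^ 2 +
      fderiv ℝ (fun z => polyFun q z ^ 2) z (z - c)) ≤
      (2 + κ) * (∫ z in openTriangle t, polyFun q z ^ 2) + meshSize t ^ 2 / κ *
        ∫ z in openTriangle t, (pd 0 (polyFun q) z ^ 2 + pd 1 (polyFun q) z ^ 2) := by
    rw [← integral_const_mul, ← integral_const_mul,
      ← integral_add (hi1.const_mul _) (hi2.const_mul _)]
    refine setIntegral_mono_on (integrableOn_openTriangle t ?_)
      ((hi1.const_mul _).add (hi2.const_mul _)) (isOpen_openTriangle t).measurableSet ?_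
    · exact (hf.continuous.const_mul 2).add ((hf.continuous_fderiv one_ne_zero).clm_apply
        (continuous_id.sub continuous_const))
    · intro z hz
      have := abs_fderiv_mul_le (f := polyFun q) z (z - c) hκ0
        (norm_sub_le_meshSize t (subset_closure hz) hcm)
      rw [hder]
      linarith
  have hGq := hG q hq
  set I := ∫ z in openTriangle t, polyFun q z ^ 2
  have hI0 : 0 ≤ I := integral_nonneg fun z => sq_nonneg _
  have hfin : σ * meshSize t * ∫ z in frontier (openTriangle t), polyFun q z ^ 2 ∂arcLength ≤
      (2 + 2 * C) * (p : ℝ) ^ 2 * I := by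
    calc _ ≤ (2 + κ) * I + meshSize t ^ 2 / κ * ((κ / meshSize t) ^ 2 * I) :=
          (hlow.trans (hdiv ▸ hup)).trans (by gcongr)
      _ = (2 + 2 * κ) * I := by field_simp; ring
      _ ≤ (2 * (p : ℝ) ^ 2 + 2 * κ) * I := by
          gcongr
          nlinarith
      _ = _ := by rw [hκ]; ring
  rw [show (2 + 2 * C) / σ * (p : ℝ) ^ 2 / meshSize t * I =
    (2 + 2 * C) * (p : ℝ) ^ 2 * I / (σ * meshSize t) by field_simp, le_div_iff₀ hρ]
  linarith

theorem exists_inverse_constants (σ : ℝ) (hσ : 0 < σ) : ∃ Cinv CINV : ℝ, 0 < Cinv ∧ 0 < CINV ∧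
    ∀ t : Affine.Triangle ℝ Plane, ShapeRegular σ t → ∀ p : ℕ, 1 ≤ p →
      TraceInverse Cinv p t ∧ GradInverse CINV p t := by
  have hC : 0 < 71 / σ := by positivity
  refine ⟨(2 + 2 * (71 / σ)) / σ, 71 / σ, by positivity, hC, fun t ht p hp => ?_⟩
  have hG := ht.gradInverse hσ hp
  exact ⟨ht.traceInverse hσ hC hp hG, hG⟩

/-- The length of the boundary controls the area. -/
lemma two_mul_area_le : 2 * ∫ _z in openTriangle t, (1 : ℝ) ≤
    meshSize t * ∫ _z in frontier (openTriangle t), (1 : ℝ) ∂arcLength := by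
  obtain ⟨c, hc⟩ := nonempty_openTriangle t
  have h := setIntegral_radial t (f := fun _ => (1 : ℝ)) contDiff_const c
  simp only [fderiv_fun_const, Pi.zero_apply, zero_apply, add_zero, mul_one, one_mul] at h
  rw [← integral_const_mul, ← integral_const_mul]
  simp only [mul_one]
  rw [h]
  refine integral_mono_ae (integrableOn_frontier_normal t (G := fun z n => inner ℝ (z - c) n)
    fun n => by fun_prop) (integrableOn_frontier_of_continuous t continuous_const) ?_
  rw [Filter.EventuallyLE, ae_restrict_iff' isClosed_frontier.measurableSet]
  refine Filter.Eventually.of_forall fun z hz => ?_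
  calc inner ℝ (z - c) (outwardNormal (openTriangle t) z)
      ≤ ‖z - c‖ * ‖outwardNormal (openTriangle t) z‖ := real_inner_le_norm _ _
    _ ≤ meshSize t * 1 := mul_le_mul
        (norm_sub_le_meshSize t (frontier_subset_closure hz) (subset_closure hc))
        (norm_outwardNormal_le _ _) (norm_nonneg _) (meshSize_pos t).le
    _ = _ := mul_one _

/-- The constant polynomial gives `|∂T| ≤ K |T|`, while `2 |T| ≤ h |∂T|` and `h ≤ 1`. This later
allows `K` to be replaced by `K²`. -/
lemma TraceInverse.one_le {C : ℝ} {p : ℕ} {t : Affine.Triangle ℝ Plane}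
    (hT : TraceInverse C p t) (hh : meshSize t ≤ 1) : 1 ≤ C * (p : ℝ) ^ 2 / meshSize t := by
  have h := hT 1 (by simp)
  have h1 : ∀ z, polyFun 1 z ^ 2 = 1 := fun z => by simp [polyFun]
  simp only [h1] at h
  have h2 := two_mul_area_le t
  have hpos : 0 < ∫ _z in openTriangle t, (1 : ℝ) := by
    rw [setIntegral_const, smul_eq_mul, mul_one]
    exact ENNReal.toReal_pos ((isOpen_openTriangle t).measure_pos volume
      (nonempty_openTriangle t)).ne' (isBounded_openTriangle t).measure_lt_top.ne
  set a := ∫ _z in openTriangle t, (1 : ℝ)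
  set b := ∫ _z in frontier (openTriangle t), (1 : ℝ) ∂arcLength
  have hb : 0 ≤ b := integral_nonneg fun _ => zero_le_one
  have h3 : 1 * a ≤ C * (p : ℝ) ^ 2 / meshSize t * a := by nlinarith
  exact le_of_mul_le_mul_right h3 hpos

end

noncomputable section

/-! ### Geometry of a triangulation -/

section Mesh

variable {Ω : Set Plane} (M : Triangulation Ω)

/-- The vertices of a triangulation. -/
def meshVertices : Set Plane := ⋃ t ∈ M.elements, range t.points

lemma finite_meshVertices : (meshVertices M).Finite :=
  M.elements.finite_toSet.biUnion fun t _ => finite_range t.points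

lemma closure_openTriangle_subset {t : Affine.Triangle ℝ Plane} (ht : t ∈ M.elements) :
    closure (openTriangle t) ⊆ closure Ω := by
  rw [← M.cover]
  exact subset_biUnion_of_mem (u := fun t => closure (openTriangle t)) ht

lemma openTriangle_subset (hΩ : interior (closure Ω) = Ω) {t : Affine.Triangle ℝ Plane}
    (ht : t ∈ M.elements) : openTriangle t ⊆ Ω := by
  rw [← hΩ]
  exact (isOpen_openTriangle t).subset_interior_iff.2
    (subset_closure.trans (closure_openTriangle_subset M ht))

lemma exists_mem_closure_openTriangle {z : Plane} (hz : z ∈ closure Ω) :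
    ∃ t ∈ M.elements, z ∈ closure (openTriangle t) := by
  rw [← M.cover] at hz
  simpa using hz

lemma exists_mem_frontier_openTriangle (hΩo : IsOpen Ω) (hΩ : interior (closure Ω) = Ω)
    {z : Plane} (hz : z ∈ frontier Ω) : ∃ t ∈ M.elements, z ∈ frontier (openTriangle t) := by
  rw [hΩo.frontier_eq] at hz
  obtain ⟨t, ht, hzt⟩ := exists_mem_closure_openTriangle M hz.1
  refine ⟨t, ht, ?_⟩
  rw [(isOpen_openTriangle t).frontier_eq]
  exact ⟨hzt, fun h => hz.2 (openTriangle_subset M hΩ ht h)⟩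

lemma ae_eq_biUnion_openTriangle (hΩ : interior (closure Ω) = Ω) :
    Ω =ᵐ[volume] ⋃ t ∈ M.elements, openTriangle t := by
  refine ae_eq_set.2 ⟨?_, ?_⟩
  · refine measure_mono_null (t := ⋃ t ∈ M.elements, frontier (openTriangle t)) ?_ ?_
    · rintro z ⟨hz, hz'⟩
      obtain ⟨t, ht, hzt⟩ := exists_mem_closure_openTriangle M (subset_closure hz)
      refine mem_biUnion ht ?_
      rw [(isOpen_openTriangle t).frontier_eq]
      exact ⟨hzt, fun h => hz' (mem_biUnion ht h)⟩
    · exact (measure_biUnion_null_iff M.elements.countable_toSet).2 fun t _ =>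
        (convex_openTriangle t).addHaar_frontier volume
  · have hs : (⋃ t ∈ M.elements, openTriangle t) ⊆ Ω :=
      iUnion₂_subset fun t ht => openTriangle_subset M hΩ ht
    rw [sdiff_eq_empty.2 hs, measure_empty]

lemma setIntegral_eq_sum_openTriangle (hΩ : interior (closure Ω) = Ω) {f : Plane → ℝ}
    (hf : ∀ t ∈ M.elements, IntegrableOn f (openTriangle t)) :
    ∫ z in Ω, f z = ∑ t ∈ M.elements, ∫ z in openTriangle t, f z := by
  rw [setIntegral_congr_set (ae_eq_biUnion_openTriangle M hΩ)]
  exact integral_biUnion_finset _ (fun t _ => (isOpen_openTriangle t).measurableSet) M.disjoint hf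

lemma notMem_range_points {z : Plane} (hz : z ∉ meshVertices M) {t : Affine.Triangle ℝ Plane}
    (ht : t ∈ M.elements) : z ∉ range t.points := fun h => hz (mem_biUnion ht h)

lemma isOutwardNormal_of_mem_frontier {z : Plane} (hz : z ∉ meshVertices M)
    {t : Affine.Triangle ℝ Plane} (ht : t ∈ M.elements) (hzt : z ∈ frontier (openTriangle t)) :
    IsOutwardNormal (openTriangle t) z (outwardNormal (openTriangle t) z) :=
  exists_isOutwardNormal t hzt (notMem_range_points M hz ht)

lemma outwardNormal_eq_neg {z : Plane} (hz : z ∉ meshVertices M)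
    {t t' : Affine.Triangle ℝ Plane} (ht : t ∈ M.elements) (ht' : t' ∈ M.elements)
    (hne : t ≠ t') (hzt : z ∈ frontier (openTriangle t)) (hzt' : z ∈ frontier (openTriangle t')) :
    outwardNormal (openTriangle t') z = -outwardNormal (openTriangle t) z :=
  (isOutwardNormal_of_mem_frontier M hz ht hzt).eq_neg_of_disjoint
    (isOutwardNormal_of_mem_frontier M hz ht' hzt') (M.disjoint ht ht' hne)

lemma IsOutwardNormal.exists_ball_mem_closure_iff {S : Set Plane} {z n : Plane} (h : IsOutwardNormal S z n) :
    ∃ r > 0, ∀ ζ ∈ Metric.ball z r, ζ ∈ closure S ↔ inner ℝ (ζ - z) n ≤ 0 := by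
  obtain ⟨hn, r, hr, hS⟩ := h
  refine ⟨r, hr, fun ζ hζ => ⟨fun h => ?_, fun h => ?_⟩⟩
  · by_contra! hpos
    have hopen : IsOpen (Metric.ball z r ∩ {ζ | 0 < inner ℝ (ζ - z) n}) :=
      Metric.isOpen_ball.inter (isOpen_lt continuous_const (by fun_prop))
    obtain ⟨ξ, hξ, hξS⟩ := mem_closure_iff.1 h _ hopen ⟨hζ, hpos⟩
    exact lt_asymm ((hS ξ hξ.1).1 hξS) hξ.2
  · rw [Metric.mem_closure_iff]
    intro ε hε
    rw [Metric.mem_ball, dist_eq_norm] at hζ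
    obtain ⟨s, hs, hs1, hs2⟩ : ∃ s : ℝ, 0 < s ∧ s < ε ∧ ‖ζ - z‖ + s < r :=
      ⟨min (ε / 2) ((r - ‖ζ - z‖) / 2), lt_min (by linarith) (by linarith),
        (min_le_left _ _).trans_lt (by linarith),
        by linarith [min_le_right (ε / 2) ((r - ‖ζ - z‖) / 2)]⟩
    refine ⟨ζ - s • n, (hS _ ?_).2 ?_, ?_⟩
    · rw [Metric.mem_ball, dist_eq_norm, sub_right_comm]
      refine (norm_sub_le _ _).trans_lt ?_
      rwa [norm_smul, hn, mul_one, Real.norm_of_nonneg hs.le]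
    · rw [sub_right_comm, inner_sub_left, real_inner_smul_left, real_inner_self_eq_norm_sq, hn]
      linarith
    · rw [dist_eq_norm, sub_sub_cancel, norm_smul, hn, mul_one, Real.norm_of_nonneg hs.le]
      exact hs1

/-- Two disjoint triangles meeting away from all vertices fill opposite half-discs. Together these
form a ball in `closure Ω`, and `Ω` is the interior of its closure. -/
lemma notMem_frontier_of_two (hΩo : IsOpen Ω) (hΩ : interior (closure Ω) = Ω) {z : Plane}
    (hz : z ∉ meshVertices M) {t t' : Affine.Triangle ℝ Plane} (ht : t ∈ M.elements)
    (ht' : t' ∈ M.elements) (hne : t ≠ t') (hzt : z ∈ frontier (openTriangle t))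
    (hzt' : z ∈ frontier (openTriangle t')) : z ∉ frontier Ω := by
  obtain ⟨r, hr, h⟩ := (isOutwardNormal_of_mem_frontier M hz ht hzt).exists_ball_mem_closure_iff
  obtain ⟨r', hr', h'⟩ := (isOutwardNormal_of_mem_frontier M hz ht' hzt').exists_ball_mem_closure_iff
  rw [outwardNormal_eq_neg M hz ht ht' hne hzt hzt'] at h'
  rw [hΩo.frontier_eq]
  refine fun hf => hf.2 ?_
  rw [← hΩ, mem_interior_iff_mem_nhds]
  filter_upwards [Metric.ball_mem_nhds z hr, Metric.ball_mem_nhds z hr'] with ζ hζ hζ'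
  rcases le_total (inner ℝ (ζ - z) (outwardNormal (openTriangle t) z)) 0 with h0 | h0
  · exact closure_openTriangle_subset M ht ((h ζ hζ).2 h0)
  · refine closure_openTriangle_subset M ht' ((h' ζ hζ').2 ?_)
    rw [inner_neg_right]; linarith

lemma isOutwardNormal_of_unique (hΩ : interior (closure Ω) = Ω) {z : Plane}
    (hz : z ∉ meshVertices M) {t : Affine.Triangle ℝ Plane} (ht : t ∈ M.elements)
    (hzt : z ∈ frontier (openTriangle t))
    (huniq : ∀ t' ∈ M.elements, z ∈ frontier (openTriangle t') → t' = t) :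
    IsOutwardNormal Ω z (outwardNormal (openTriangle t) z) := by
  have hn := isOutwardNormal_of_mem_frontier M hz ht hzt
  obtain ⟨r₁, hr₁, h₁⟩ := hn.exists_ball_mem_closure_iff
  obtain ⟨hn1, r₂, hr₂, h₂⟩ := hn
  have hoff : ∀ᶠ ζ in 𝓝 z, ∀ t' ∈ M.elements, t' ≠ t → ζ ∉ closure (openTriangle t') := by
    rw [Filter.eventually_all_finset]
    intro t' ht'
    by_cases hne : t' = t
    · simp [hne]
    have hzt' : z ∉ closure (openTriangle t') := by
      intro hcl
      by_cases hmem : z ∈ openTriangle t'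
      · obtain ⟨ξ, hξ, hξ'⟩ := mem_closure_iff.1 (frontier_subset_closure hzt) _
          (isOpen_openTriangle t') hmem
        exact disjoint_left.1 (M.disjoint ht' ht hne) hξ hξ'
      · refine hne (huniq t' ht' ?_)
        rw [(isOpen_openTriangle t').frontier_eq]
        exact ⟨hcl, hmem⟩
    filter_upwards [isClosed_closure.isOpen_compl.mem_nhds hzt'] with ζ hζ _
    exact hζ
  obtain ⟨r₃, hr₃, h₃⟩ := Metric.eventually_nhds_iff_ball.1 hoff
  refine ⟨hn1, min r₁ (min r₂ r₃), by positivity, fun ζ hζ => ?_⟩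
  have hζ₂ : ζ ∈ Metric.ball z r₂ := Metric.ball_subset_ball
    ((min_le_right _ _).trans (min_le_left _ _)) hζ
  refine ⟨fun hζΩ => ?_, fun hneg => openTriangle_subset M hΩ ht ((h₂ ζ hζ₂).2 hneg)⟩
  -- The closure of the triangle only gives a weak inequality; pushing the point slightly outwards
  -- within the open set `Ω` makes it strict.
  have hopen : IsOpen (Metric.ball z (min r₁ (min r₂ r₃)) ∩ interior (closure Ω)) :=
    Metric.isOpen_ball.inter isOpen_interior
  obtain ⟨ε, hε, hball⟩ := Metric.isOpen_iff.1 hopen ζ ⟨hζ, by rwa [hΩ]⟩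
  set n := outwardNormal (openTriangle t) z
  have hmem : ζ + (ε / 2) • n ∈ Metric.ball ζ ε := by
    rw [Metric.mem_ball, dist_eq_norm, add_sub_cancel_left, norm_smul, hn1, mul_one,
      Real.norm_of_nonneg (by positivity)]
    linarith
  obtain ⟨hb, hc⟩ := hball hmem
  obtain ⟨t', ht', hξ⟩ := exists_mem_closure_openTriangle M (interior_subset hc)
  have htt : t' = t := by
    by_contra hne
    exact h₃ _ (Metric.ball_subset_ball ((min_le_right _ _).trans (min_le_right _ _)) hb)
      t' ht' hne hξ
  rw [htt] at hξ
  have := (h₁ _ (Metric.ball_subset_ball (min_le_left _ _) hb)).1 hξ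
  rw [add_sub_right_comm, inner_add_left, real_inner_smul_left, real_inner_self_eq_norm_sq,
    hn1] at this
  linarith

/-! ### Sums of normal jumps on the skeleton -/

/-- The sum over the elements of `b t` times the normal component, at a point of the skeleton. -/
def skeletonSum (b : Affine.Triangle ℝ Plane → ℝ) (i : Fin 2) (z : Plane) : ℝ :=
  ∑ t ∈ M.elements, (frontier (openTriangle t)).indicator
    (fun z => b t * outwardNormal (openTriangle t) z i) z

/-- Off the finitely many vertices, hanging nodes included, a point lies on no edge, between exactly
two elements with opposite normals, or on the boundary of one element that shares its normal with
`Ω`. -/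
lemma skeletonSum_cases (hΩo : IsOpen Ω) (hΩ : interior (closure Ω) = Ω) {z : Plane}
    (hz : z ∉ meshVertices M) :
    (z ∉ frontier Ω ∧ ∀ b i, skeletonSum M b i z = 0) ∨
    (z ∉ frontier Ω ∧ ∃ t t', ∃ n : Plane, ‖n‖ = 1 ∧
      ∀ b i, skeletonSum M b i z = (b t - b t') * n i) ∨
    (z ∈ frontier Ω ∧ ‖outwardNormal Ω z‖ = 1 ∧ ∃ t,
      ∀ b i, skeletonSum M b i z = b t * outwardNormal Ω z i) := by
  by_cases h0 : ∃ t ∈ M.elements, z ∈ frontier (openTriangle t)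
  · obtain ⟨t, ht, hzt⟩ := h0
    have hn := isOutwardNormal_of_mem_frontier M hz ht hzt
    by_cases h1 : ∃ t' ∈ M.elements, z ∈ frontier (openTriangle t') ∧ t' ≠ t
    · obtain ⟨t', ht', hzt', hne⟩ := h1
      refine Or.inr (Or.inl ⟨notMem_frontier_of_two M hΩo hΩ hz ht ht' hne.symm hzt hzt', t, t',
        outwardNormal (openTriangle t) z, hn.1, fun b i => ?_⟩)
      have hopp := outwardNormal_eq_neg M hz ht ht' hne.symm hzt hzt'
      rw [skeletonSum, Finset.sum_eq_add_of_mem t t' ht ht' hne.symm, indicator_of_mem hzt,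
        indicator_of_mem hzt', hopp, PiLp.neg_apply]
      · ring
      -- A third element would have a normal opposite to both `n` and `-n`.
      · rintro s hs ⟨hst, hst'⟩
        refine indicator_of_notMem (fun hzs => ?_) _
        have e1 := outwardNormal_eq_neg M hz ht hs hst.symm hzt hzs
        have e2 := outwardNormal_eq_neg M hz ht' hs hst'.symm hzt' hzs
        rw [hopp, neg_neg, e1] at e2
        have h2 : outwardNormal (openTriangle t) z = 0 := by
          have : (2 : ℝ) • outwardNormal (openTriangle t) z = 0 := by
            rw [two_smul]; nth_rewrite 1 [← e2]; exact neg_add_cancel _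
          exact (smul_eq_zero.1 this).resolve_left two_ne_zero
        have := hn.1
        rw [h2, norm_zero] at this
        exact zero_ne_one this
    · push Not at h1
      have hΩn := isOutwardNormal_of_unique M hΩ hz ht hzt h1
      rw [← hΩn.outwardNormal_eq] at hΩn
      refine Or.inr (Or.inr ⟨?_, hΩn.1, t, fun b i => ?_⟩)
      · rw [hΩo.frontier_eq]
        refine ⟨closure_openTriangle_subset M ht (frontier_subset_closure hzt), fun h => ?_⟩
        obtain ⟨-, r, hr, hS⟩ := hΩn
        have := (hS z (Metric.mem_ball_self hr)).1 h
        rw [sub_self, inner_zero_left] at this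
        exact lt_irrefl _ this
      · rw [skeletonSum, Finset.sum_eq_single_of_mem t ht, indicator_of_mem hzt,
          (isOutwardNormal_of_unique M hΩ hz ht hzt h1).outwardNormal_eq]
        intro s hs hst
        exact indicator_of_notMem (fun hzs => hst (h1 s hs hzs)) _
  · refine Or.inl ⟨fun h => h0 (exists_mem_frontier_openTriangle M hΩo hΩ h), fun b i => ?_⟩
    refine Finset.sum_eq_zero fun t ht => indicator_of_notMem (fun h => h0 ⟨t, ht, h⟩) _

lemma exists_apply_ne_zero {n : Plane} (hn : ‖n‖ = 1) : ∃ i, n i ≠ 0 := by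
  by_contra! h
  have : n = 0 := plane_ext (h 0) (h 1)
  rw [this, norm_zero] at hn
  exact zero_ne_one hn

lemma skeletonSum_one (hΩo : IsOpen Ω) (hΩ : interior (closure Ω) = Ω) {z : Plane}
    (hz : z ∉ meshVertices M) (i : Fin 2) :
    skeletonSum M (fun _ => 1) i z =
      (frontier Ω).indicator (fun z => outwardNormal Ω z i) z := by
  rcases skeletonSum_cases M hΩo hΩ hz with ⟨hz', h⟩ | ⟨hz', t, t', n, -, h⟩ | ⟨hz', -, t, h⟩
  · rw [h, indicator_of_notMem hz']
  · rw [h, indicator_of_notMem hz']; ring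
  · rw [h, indicator_of_mem hz', one_mul]

/-- Some component of the unit normal is nonzero, so the hypothesis says that the two values agree
at an inner edge and that the value is `g` at the boundary. Such an identity passes to squares. -/
lemma skeletonSum_sq (hΩo : IsOpen Ω) (hΩ : interior (closure Ω) = Ω) {z : Plane}
    (hz : z ∉ meshVertices M) {b : Affine.Triangle ℝ Plane → ℝ} {g : Plane → ℝ}
    (h : ∀ i, skeletonSum M b i z =
      (frontier Ω).indicator (fun z => g z * outwardNormal Ω z i) z) (i : Fin 2) :
    skeletonSum M (fun t => b t ^ 2) i z =
      (frontier Ω).indicator (fun z => g z ^ 2 * outwardNormal Ω z i) z := by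
  rcases skeletonSum_cases M hΩo hΩ hz with ⟨hz', h'⟩ | ⟨hz', t, t', n, hn, h'⟩ | ⟨hz', hn, t, h'⟩
  · rw [h', indicator_of_notMem hz']
  · obtain ⟨j, hj⟩ := exists_apply_ne_zero hn
    have := h j
    rw [h', indicator_of_notMem hz'] at this
    have hb := (mul_eq_zero.1 this).resolve_right hj
    rw [h', indicator_of_notMem hz', sub_eq_zero.1 hb]; ring
  · obtain ⟨j, hj⟩ := exists_apply_ne_zero hn
    have := h j
    rw [h', indicator_of_mem hz'] at this
    rw [h', indicator_of_mem hz', mul_right_cancel₀ hj this]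

end Mesh

/-! ### Traces of piecewise polynomials -/

lemma integrable_continuous_compactSupport_mul {μ : Measure Plane} {φ f : Plane → ℝ}
    (hφ : Continuous φ) (hc : HasCompactSupport φ) (hf : Integrable f μ) :
    Integrable (fun z => φ z * f z) μ := by
  obtain ⟨C, hC⟩ := hc.exists_bound_of_continuous hφ
  exact hf.bdd_mul hφ.aestronglyMeasurable (Filter.Eventually.of_forall hC)

lemma continuous_pd {f : Plane → ℝ} (hf : ContDiff ℝ 1 f) (i : Fin 2) : Continuous (pd i f) :=
  (hf.continuous_fderiv one_ne_zero).clm_apply continuous_const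

lemma pd_mul {f g : Plane → ℝ} {z : Plane} (hf : DifferentiableAt ℝ f z)
    (hg : DifferentiableAt ℝ g z) (i : Fin 2) :
    pd i (fun z => f z * g z) z = f z * pd i g z + pd i f z * g z := by
  rw [pd, (hf.hasFDerivAt.fun_mul hg.hasFDerivAt).fderiv]
  simp [pd, mul_comm]

/-- Integration by parts on a triangle. -/
lemma setIntegral_mul_pd_add (t : Affine.Triangle ℝ Plane) {f g : Plane → ℝ}
    (hf : ContDiff ℝ 1 f) (hg : ContDiff ℝ 1 g) (i : Fin 2) :
    ∫ z in openTriangle t, (f z * pd i g z + pd i f z * g z) =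
      ∫ z in frontier (openTriangle t),
        f z * g z * outwardNormal (openTriangle t) z i ∂arcLength := by
  have h := setIntegral_fderiv_openTriangle t (hf.mul hg) (EuclideanSpace.single i 1)
  have e2 : ∀ n : Plane, inner ℝ (EuclideanSpace.single i (1 : ℝ)) n = n i := by
    intro n; simp [EuclideanSpace.inner_single_left]
  simp only [e2] at h
  rw [← h]
  refine integral_congr_ae (Filter.Eventually.of_forall fun z => ?_)
  exact (pd_mul (hf.differentiable one_ne_zero z) (hg.differentiable one_ne_zero z) i).symm

section Trace

variable {Ω : Set Plane} (M : Triangulation Ω)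

/-- Test functions supported in one triangle see no boundary, so weak and classical derivative have
the same integrals against them, and the fundamental lemma applies. -/
lemma ae_eq_pd_of_isWeakPartial (hΩ : interior (closure Ω) = Ω) {v G : Plane → ℝ} {i : Fin 2}
    (hG : IsWeakPartial Ω i v G) (hG2 : MemLp G 2 (volume.restrict Ω))
    {t : Affine.Triangle ℝ Plane} (ht : t ∈ M.elements) {q : MvPolynomial (Fin 2) ℝ}
    (hv : ∀ z ∈ openTriangle t, v z = polyFun q z) :
    ∀ᵐ z, z ∈ openTriangle t → G z = pd i (polyFun q) z := by
  have hsub := openTriangle_subset M hΩ ht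
  have hGi : IntegrableOn G (openTriangle t) := by
    have h1 : MemLp G 2 (volume.restrict (openTriangle t)) :=
      hG2.mono_measure (Measure.restrict_mono hsub le_rfl)
    have : IsFiniteMeasure (volume.restrict (openTriangle t)) :=
      ⟨by rw [Measure.restrict_apply_univ]; exact (isBounded_openTriangle t).measure_lt_top⟩
    exact h1.integrable one_le_two
  have hq := continuous_pd (contDiff_polyFun q) i
  have hqi := integrableOn_openTriangle t hq
  have key := (isOpen_openTriangle t).ae_eq_zero_of_integral_contDiff_smul_eq_zero (μ := volume)
    (f := fun z => G z - pd i (polyFun q) z) (hGi.sub hqi).locallyIntegrableOn ?_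
  · filter_upwards [key] with z hz hzt
    exact sub_eq_zero.1 (hz hzt)
  intro φ hφ hc hs
  have hφ0 : ∀ z, z ∉ openTriangle t → φ z = 0 := fun z hz =>
    image_eq_zero_of_notMem_tsupport fun h => hz (hs h)
  have hφ0' : ∀ z, z ∉ openTriangle t → pd i φ z = 0 := fun z hz => by
    rw [pd, image_eq_zero_of_notMem_tsupport (f := fderiv ℝ φ)
      fun h => hz (hs (tsupport_fderiv_subset ℝ h))]
    rfl
  have hφ1 : ContDiff ℝ 1 φ := hφ.of_le (by exact_mod_cast le_top)
  have h1 := hG φ hφ hc (hs.trans hsub)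
  have hmeas := (isOpen_openTriangle t).measurableSet
  have hres : ∀ {f : Plane → ℝ} {S : Set Plane}, openTriangle t ⊆ S →
      (∀ z, z ∉ openTriangle t → f z = 0) → ∫ z in S, f z = ∫ z in openTriangle t, f z := by
    intro f S hS hf
    rw [setIntegral_eq_integral_of_forall_compl_eq_zero fun z hz => hf z fun h => hz (hS h),
      setIntegral_eq_integral_of_forall_compl_eq_zero hf]
  rw [hres hsub fun z hz => by rw [hφ0' z hz, mul_zero],
    hres hsub fun z hz => by rw [hφ0 z hz, mul_zero]] at h1
  have h2 := setIntegral_mul_pd_add t (contDiff_polyFun q) hφ1 i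
  have h3 : ∫ z in frontier (openTriangle t), polyFun q z * φ z *
      outwardNormal (openTriangle t) z i ∂arcLength = 0 := by
    refine setIntegral_eq_zero_of_forall_eq_zero fun z hz => ?_
    rw [(isOpen_openTriangle t).frontier_eq] at hz
    rw [hφ0 z hz.2]; ring
  have hi1 : IntegrableOn (fun z => polyFun q z * pd i φ z) (openTriangle t) :=
    integrableOn_openTriangle t ((continuous_polyFun q).mul (continuous_pd hφ1 i))
  have hi2 : IntegrableOn (fun z => pd i (polyFun q) z * φ z) (openTriangle t) :=
    integrableOn_openTriangle t (hq.mul hφ.continuous)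
  have hi3 : IntegrableOn (fun z => G z * φ z) (openTriangle t) := by
    simpa only [IntegrableOn, mul_comm] using integrable_continuous_compactSupport_mul hφ.continuous hc hGi
  rw [h3, integral_add hi1 hi2] at h2
  rw [setIntegral_congr_fun hmeas fun z hz => by rw [hv z hz]] at h1
  have h4 : ∫ z, φ z • (G z - pd i (polyFun q) z) =
      ∫ z in openTriangle t, (G z * φ z - pd i (polyFun q) z * φ z) := by
    rw [← setIntegral_univ, hres (subset_univ _) fun z hz => by rw [hφ0 z hz, zero_smul]]
    refine integral_congr_ae (Filter.Eventually.of_forall fun z => ?_)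
    simp only [smul_eq_mul]; ring
  rw [h4, integral_sub hi3 hi2]
  linarith

variable (q : Affine.Triangle ℝ Plane → MvPolynomial (Fin 2) ℝ)

lemma integrable_indicator_frontier_normal (t : Affine.Triangle ℝ Plane) {f : Plane → ℝ}
    (hf : Continuous f) (i : Fin 2) : Integrable ((frontier (openTriangle t)).indicator
      fun z => f z * outwardNormal (openTriangle t) z i) arcLength :=
  (integrableOn_frontier_normal t (G := fun z n => f z * n i)
    fun _ => hf.mul continuous_const).integrable_indicator isClosed_frontier.measurableSet

lemma integrable_skeletonSum (f : Affine.Triangle ℝ Plane → Plane → ℝ)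
    (hf : ∀ t, Continuous (f t)) (i : Fin 2) :
    Integrable (fun z => skeletonSum M (fun t => f t z) i z) arcLength := by
  refine (integrable_finsetSum M.elements fun t _ =>
    integrable_indicator_frontier_normal t (hf t) i).congr (Filter.Eventually.of_forall fun z => ?_)
  simp only [skeletonSum]
  refine Finset.sum_congr rfl fun t _ => ?_
  by_cases hz : z ∈ frontier (openTriangle t)
  · rw [indicator_of_mem hz, indicator_of_mem hz]
  · rw [indicator_of_notMem hz, indicator_of_notMem hz]

lemma integral_skeletonSum (f : Affine.Triangle ℝ Plane → Plane → ℝ)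
    (hf : ∀ t, Continuous (f t)) (i : Fin 2) :
    ∫ z, skeletonSum M (fun t => f t z) i z ∂arcLength = ∑ t ∈ M.elements,
      ∫ z in frontier (openTriangle t), f t z * outwardNormal (openTriangle t) z i ∂arcLength := by
  simp only [← integral_indicator isClosed_frontier.measurableSet]
  rw [← integral_finsetSum _ fun t _ => integrable_indicator_frontier_normal t (hf t) i]
  refine integral_congr_ae (Filter.Eventually.of_forall fun z => ?_)
  simp only [skeletonSum]
  refine Finset.sum_congr rfl fun t _ => ?_
  by_cases hz : z ∈ frontier (openTriangle t)
  · rw [indicator_of_mem hz, indicator_of_mem hz]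
  · rw [indicator_of_notMem hz, indicator_of_notMem hz]

lemma integrableOn_outwardNormal (M : Triangulation Ω) (hΩo : IsOpen Ω) (hΩ : interior (closure Ω) = Ω) (i : Fin 2) :
    IntegrableOn (fun z => outwardNormal Ω z i) (frontier Ω) arcLength := by
  rw [← integrable_indicator_iff isClosed_frontier.measurableSet]
  refine (integrable_skeletonSum M (fun _ _ => 1) (fun _ => continuous_const) i).congr ?_
  filter_upwards [ae_notMem_finite (finite_meshVertices M)] with z hz
  exact skeletonSum_one M hΩo hΩ hz i

lemma arcLength_frontier_domain_lt_top (M : Triangulation Ω) (hΩo : IsOpen Ω) (hΩ : interior (closure Ω) = Ω) :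
    arcLength (frontier Ω) < ⊤ := by
  refine (measure_mono (t := ⋃ t ∈ M.elements, frontier (openTriangle t)) fun z hz => ?_).trans_lt
    ((measure_biUnion_finset_le _ _).trans_lt
      (ENNReal.sum_lt_top.2 fun t _ => arcLength_frontier_lt_top t))
  obtain ⟨t, ht, h⟩ := exists_mem_frontier_openTriangle M hΩo hΩ hz
  exact mem_biUnion ht h

lemma IsTrace.integrableOn_mul_normal (M : Triangulation Ω) (hΩo : IsOpen Ω)
    (hΩ : interior (closure Ω) = Ω)
    {v g : Plane → ℝ} (hg : IsTrace Ω v g) (i : Fin 2) :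
    IntegrableOn (fun z => g z * outwardNormal Ω z i) (frontier Ω) arcLength := by
  have : IsFiniteMeasure (arcLength.restrict (frontier Ω)) :=
    ⟨by rw [Measure.restrict_apply_univ]; exact arcLength_frontier_domain_lt_top M hΩo hΩ⟩
  refine (hg.1.integrable one_le_two).mul_bdd (c := 1)
    (integrableOn_outwardNormal M hΩo hΩ i).aestronglyMeasurable
    (Filter.Eventually.of_forall fun z => abs_outwardNormal_le Ω z i)

/-- The normal jumps of a piecewise polynomial in `H¹` vanish inside the domain, and on the
boundary its trace is given by the boundary values. -/
lemma IsTrace.ae_skeletonSum_eq (hΩo : IsOpen Ω) (hΩ : interior (closure Ω) = Ω)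
    {v g : Plane → ℝ} (hg : IsTrace Ω v g)
    (hv : ∀ t ∈ M.elements, ∀ z ∈ openTriangle t, v z = polyFun (q t) z) :
    ∀ᵐ z ∂arcLength, ∀ i, skeletonSum M (fun t => polyFun (q t) z) i z =
      (frontier Ω).indicator (fun z => g z * outwardNormal Ω z i) z := by
  rw [ae_all_iff]
  intro i
  have hint1 := integrable_skeletonSum M (fun t => polyFun (q t))
    (fun t => continuous_polyFun (q t)) i
  have hint2 : Integrable ((frontier Ω).indicator fun z => g z * outwardNormal Ω z i) arcLength :=
    (hg.integrableOn_mul_normal M hΩo hΩ i).integrable_indicator isClosed_frontier.measurableSet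
  -- The fundamental lemma is used for arc length on the whole plane: test functions that do not
  -- vanish on the skeleton detect the jumps and the boundary values at once.
  have key := ae_eq_zero_of_integral_contDiff_smul_eq_zero (hint1.sub hint2).locallyIntegrable ?_
  · filter_upwards [key] with z hz
    exact sub_eq_zero.1 hz
  intro φ hφ hc
  have hφ1 : ContDiff ℝ 1 φ := hφ.of_le (by exact_mod_cast le_top)
  obtain ⟨G, hG2, hGw, hGreen⟩ := hg.2 i
  have hae : ∀ t ∈ M.elements, (fun z => v z * pd i φ z + G z * φ z)
      =ᵐ[volume.restrict (openTriangle t)]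
        fun z => polyFun (q t) z * pd i φ z + pd i (polyFun (q t)) z * φ z := by
    intro t ht
    rw [Filter.EventuallyEq, ae_restrict_iff' (isOpen_openTriangle t).measurableSet]
    filter_upwards [ae_eq_pd_of_isWeakPartial M hΩ hGw hG2 ht (hv t ht)] with z hz hzt
    rw [hz hzt, hv t ht z hzt]
  have hcont : ∀ t, Continuous fun z => polyFun (q t) z * pd i φ z + pd i (polyFun (q t)) z * φ z :=
    fun t => ((continuous_polyFun _).mul (continuous_pd hφ1 i)).add
      ((continuous_pd (contDiff_polyFun _) i).mul hφ.continuous)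
  have h1 := hGreen φ hφ hc
  rw [setIntegral_eq_sum_openTriangle M hΩ fun t ht =>
    (integrableOn_openTriangle t (hcont t)).congr (hae t ht).symm,
    Finset.sum_congr rfl fun t ht => integral_congr_ae (hae t ht),
    Finset.sum_congr rfl fun t _ => setIntegral_mul_pd_add t (contDiff_polyFun (q t)) hφ1 i,
    ← integral_skeletonSum M (fun t z => polyFun (q t) z * φ z)
      (fun t => (continuous_polyFun _).mul hφ.continuous)] at h1
  have e1 : ∀ z, skeletonSum M (fun t => polyFun (q t) z * φ z) i z =
      φ z * skeletonSum M (fun t => polyFun (q t) z) i z := by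
    intro z
    simp only [skeletonSum, Finset.mul_sum]
    refine Finset.sum_congr rfl fun t _ => ?_
    by_cases hz : z ∈ frontier (openTriangle t)
    · rw [indicator_of_mem hz, indicator_of_mem hz]; ring
    · rw [indicator_of_notMem hz, indicator_of_notMem hz, mul_zero]
  have e2 : ∫ z in frontier Ω, g z * φ z * outwardNormal Ω z i ∂arcLength =
      ∫ z, φ z * (frontier Ω).indicator (fun z => g z * outwardNormal Ω z i) z ∂arcLength := by
    rw [← integral_indicator isClosed_frontier.measurableSet]
    refine integral_congr_ae (Filter.Eventually.of_forall fun z => ?_)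
    by_cases hz : z ∈ frontier Ω
    · simp only [indicator_of_mem hz]; ring
    · simp only [indicator_of_notMem hz, mul_zero]
  simp only [e1] at h1
  rw [e2] at h1
  simp only [smul_eq_mul, Pi.sub_apply, mul_sub]
  rw [integral_sub (integrable_continuous_compactSupport_mul hφ.continuous hc hint1)
    (integrable_continuous_compactSupport_mul hφ.continuous hc hint2), h1, sub_self]

lemma IsTrace.ae_eq (hΩo : IsOpen Ω) (hΩ : interior (closure Ω) = Ω) {v g g' : Plane → ℝ}
    (hg : IsTrace Ω v g) (hg' : IsTrace Ω v g')
    (hv : ∀ t ∈ M.elements, ∀ z ∈ openTriangle t, v z = polyFun (q t) z) :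
    ∀ᵐ z ∂arcLength, z ∈ frontier Ω → g z = g' z := by
  filter_upwards [hg.ae_skeletonSum_eq M q hΩo hΩ hv, hg'.ae_skeletonSum_eq M q hΩo hΩ hv,
    ae_notMem_finite (finite_meshVertices M)] with z h h' hz hzΩ
  rcases skeletonSum_cases M hΩo hΩ hz with ⟨hz', -⟩ | ⟨hz', -⟩ | ⟨-, hn, -⟩
  · exact absurd hzΩ hz'
  · exact absurd hzΩ hz'
  · obtain ⟨j, hj⟩ := exists_apply_ne_zero hn
    have := (h j).symm.trans (h' j)
    rw [indicator_of_mem hzΩ, indicator_of_mem hzΩ] at this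
    exact mul_right_cancel₀ hj this

lemma IsTrace.ae_flux_sq (hΩo : IsOpen Ω) (hΩ : interior (closure Ω) = Ω)
    {v g : Plane → ℝ} (hg : IsTrace Ω v g)
    (hv : ∀ t ∈ M.elements, ∀ z ∈ openTriangle t, v z = polyFun (q t) z) :
    (fun z => skeletonSum M (fun t => z 0 * polyFun (q t) z ^ 2) 1 z) =ᵐ[arcLength]
      (frontier Ω).indicator fun z => normalFlux Ω z * g z ^ 2 := by
  filter_upwards [hg.ae_skeletonSum_eq M q hΩo hΩ hv,
    ae_notMem_finite (finite_meshVertices M)] with z h hz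
  have h2 := skeletonSum_sq M hΩo hΩ hz h 1
  have e : skeletonSum M (fun t => z 0 * polyFun (q t) z ^ 2) 1 z =
      z 0 * skeletonSum M (fun t => polyFun (q t) z ^ 2) 1 z := by
    simp only [skeletonSum, Finset.mul_sum]
    refine Finset.sum_congr rfl fun t _ => ?_
    by_cases hz : z ∈ frontier (openTriangle t)
    · rw [indicator_of_mem hz, indicator_of_mem hz]; ring
    · rw [indicator_of_notMem hz, indicator_of_notMem hz, mul_zero]
  rw [e, h2]
  by_cases hz : z ∈ frontier Ω
  · rw [indicator_of_mem hz, indicator_of_mem hz, normalFlux]; ring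
  · rw [indicator_of_notMem hz, indicator_of_notMem hz, mul_zero]

/-! ### The transport flux through the boundary of the domain -/

lemma continuous_coord (i : Fin 2) : Continuous fun z : Plane => z i :=
  (contDiff_coord i (n := 0)).continuous

lemma IsTrace.integrableOn_flux_sq (hΩo : IsOpen Ω) (hΩ : interior (closure Ω) = Ω)
    {v g : Plane → ℝ} (hg : IsTrace Ω v g)
    (hv : ∀ t ∈ M.elements, ∀ z ∈ openTriangle t, v z = polyFun (q t) z) :
    IntegrableOn (fun z => normalFlux Ω z * g z ^ 2) (frontier Ω) arcLength := by
  rw [← integrable_indicator_iff isClosed_frontier.measurableSet]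
  exact (integrable_skeletonSum M (fun t z => z 0 * polyFun (q t) z ^ 2)
    (fun t => (continuous_coord 0).mul ((continuous_polyFun _).pow 2)) 1).congr
      (hg.ae_flux_sq M q hΩo hΩ hv)

lemma setIntegral_transport (t : Affine.Triangle ℝ Plane) (r : MvPolynomial (Fin 2) ℝ) :
    ∫ z in openTriangle t, z 0 * pd 1 (polyFun r) z * polyFun r z =
      1 / 2 * ∫ z in frontier (openTriangle t),
        z 0 * polyFun r z ^ 2 * outwardNormal (openTriangle t) z 1 ∂arcLength := by
  have h := setIntegral_mul_pd_add t ((contDiff_coord 0).mul (contDiff_polyFun r))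
    (contDiff_polyFun r) 1
  have hx : ∀ z : Plane, pd 1 (fun z : Plane => z 0) z = 0 := by
    intro z
    have : HasFDerivAt (fun z : Plane => z 0) (EuclideanSpace.proj (𝕜 := ℝ) (0 : Fin 2)) z :=
      (EuclideanSpace.proj (𝕜 := ℝ) (0 : Fin 2)).hasFDerivAt
    rw [pd, this.fderiv]; simp
  have hd : ∀ z : Plane, pd 1 (fun z : Plane => z 0 * polyFun r z) z =
      z 0 * pd 1 (polyFun r) z := by
    intro z
    rw [pd_mul ((contDiff_coord 0 (n := 1)).differentiable one_ne_zero z)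
      (hasFDerivAt_polyFun r z).differentiableAt, hx]
    ring
  simp only [hd] at h
  have e1 : ∀ z : Plane, z 0 * polyFun r z * polyFun r z * outwardNormal (openTriangle t) z 1 =
    z 0 * polyFun r z ^ 2 * outwardNormal (openTriangle t) z 1 := fun z => by ring
  have e2 : ∀ z : Plane, z 0 * polyFun r z * pd 1 (polyFun r) z +
      z 0 * pd 1 (polyFun r) z * polyFun r z =
      2 * (z 0 * pd 1 (polyFun r) z * polyFun r z) := fun z => by ring
  simp only [e1, e2, integral_const_mul] at h
  rw [← h]; ring

/-- The transport form of a finite element function is half its boundary flux. -/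
lemma IsTrace.setIntegral_transport (hΩo : IsOpen Ω) (hΩ : interior (closure Ω) = Ω)
    {v g : Plane → ℝ} (hg : IsTrace Ω v g)
    (hv : ∀ t ∈ M.elements, ∀ z ∈ openTriangle t, v z = polyFun (q t) z) :
    ∑ t ∈ M.elements, ∫ z in openTriangle t,
        z 0 * pd 1 (polyFun (q t)) z * polyFun (q t) z =
      1 / 2 * ∫ z in frontier Ω, normalFlux Ω z * g z ^ 2 ∂arcLength := by
  rw [← integral_indicator isClosed_frontier.measurableSet,
    ← integral_congr_ae (hg.ae_flux_sq M q hΩo hΩ hv),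
    integral_skeletonSum M (fun t z => z 0 * polyFun (q t) z ^ 2)
      (fun t => (continuous_coord 0).mul ((continuous_polyFun _).pow 2)) 1, Finset.mul_sum]
  exact Finset.sum_congr rfl fun t _ => _root_.setIntegral_transport t (q t)

lemma isTrace_boundaryTrace {v : Plane → ℝ} (hv : MemH1Minus Ω v) :
    IsTrace Ω v (boundaryTrace Ω v) := by
  obtain ⟨-, g, hg, -⟩ := hv
  have hex : ∃ g, IsTrace Ω v g := ⟨g, hg⟩
  rw [boundaryTrace, dif_pos hex]
  exact hex.choose_spec

lemma ae_flux_boundaryTrace_nonneg (hΩo : IsOpen Ω) (hΩ : interior (closure Ω) = Ω)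
    (hell : ∀ z ∈ ellipticBoundary Ω, 0 ≤ normalFlux Ω z) {v : Plane → ℝ} (hvm : MemH1Minus Ω v)
    (hv : ∀ t ∈ M.elements, ∀ z ∈ openTriangle t, v z = polyFun (q t) z) :
    0 ≤ᵐ[arcLength.restrict (frontier Ω)]
      fun z => normalFlux Ω z * boundaryTrace Ω v z ^ 2 := by
  have hb := isTrace_boundaryTrace hvm
  obtain ⟨-, g, hg, hg0⟩ := hvm
  rw [Filter.EventuallyLE, ae_restrict_iff' isClosed_frontier.measurableSet]
  -- The chosen trace agrees almost everywhere with the one known to vanish on the inflow part, and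
  -- `hell` excludes negative flux on the elliptic part.
  filter_upwards [hb.ae_eq M q hΩo hΩ hg hv, ae_imp_of_ae_restrict hg0] with z h1 h2 hz
  rw [Pi.zero_apply]
  rcases le_or_gt 0 (normalFlux Ω z) with h0 | h0
  · positivity
  · have hin : z ∈ inflowBoundary Ω := ⟨⟨hz, fun h => absurd (hell z h) (not_le.2 h0)⟩, h0⟩
    rw [h1 hz, h2 hin]; simp

lemma outflowBoundary_subset : outflowBoundary Ω ⊆ frontier Ω := fun _ hz => hz.1.1

lemma setIntegral_outflowBoundary_nonneg (hΩo : IsOpen Ω) (hΩ : interior (closure Ω) = Ω)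
    (hell : ∀ z ∈ ellipticBoundary Ω, 0 ≤ normalFlux Ω z) {v : Plane → ℝ} (hvm : MemH1Minus Ω v)
    (hv : ∀ t ∈ M.elements, ∀ z ∈ openTriangle t, v z = polyFun (q t) z) :
    0 ≤ ∫ z in outflowBoundary Ω, normalFlux Ω z * boundaryTrace Ω v z ^ 2 ∂arcLength :=
  integral_nonneg_of_ae (ae_restrict_of_ae_restrict_of_subset outflowBoundary_subset
    (ae_flux_boundaryTrace_nonneg M q hΩo hΩ hell hvm hv))

/-- The boundary flux of a function with vanishing inflow trace is bounded below by the flux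
through the outflow boundary. -/
lemma setIntegral_outflowBoundary_le (hΩo : IsOpen Ω) (hΩ : interior (closure Ω) = Ω)
    (hell : ∀ z ∈ ellipticBoundary Ω, 0 ≤ normalFlux Ω z) {v : Plane → ℝ} (hvm : MemH1Minus Ω v)
    (hv : ∀ t ∈ M.elements, ∀ z ∈ openTriangle t, v z = polyFun (q t) z) :
    1 / 2 * ∫ z in outflowBoundary Ω, normalFlux Ω z * boundaryTrace Ω v z ^ 2 ∂arcLength ≤
      ∑ t ∈ M.elements, ∫ z in openTriangle t,
        z 0 * pd 1 (polyFun (q t)) z * polyFun (q t) z := by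
  have hb := isTrace_boundaryTrace hvm
  rw [hb.setIntegral_transport M q hΩo hΩ hv]
  exact mul_le_mul_of_nonneg_left (setIntegral_mono_set (hb.integrableOn_flux_sq M q hΩo hΩ hv)
    (ae_flux_boundaryTrace_nonneg M q hΩo hΩ hell hvm hv) outflowBoundary_subset.eventuallyLE)
    (by norm_num)

end Trace

end

noncomputable section

/-! ### Coercivity on an element -/

section Element

open MvPolynomial

lemma pderiv_comm (i j : Fin 2) (q : MvPolynomial (Fin 2) ℝ) :
    pderiv i (pderiv j q) = pderiv j (pderiv i q) := by
  induction q using MvPolynomial.induction_on with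
  | C a => simp
  | add q r hq hr => simp only [map_add, hq, hr]
  | mul_X q k hq =>
    simp only [Derivation.leibniz, map_add, smul_eq_mul, hq, pderiv_X]
    have hs : ∀ i j : Fin 2, pderiv i (Pi.single (M := fun _ => MvPolynomial (Fin 2) ℝ) j 1 k) = 0 := by
      intro i j
      rcases eq_or_ne k j with rfl | h
      · simp
      · simp [Pi.single_eq_of_ne h]
    rw [hs, hs]
    ring

/-- The quadratic form with coefficients `α`, `β`, `γ` at a pair of polynomials. -/
def quadPoly (α β γ : ℝ) (u v : MvPolynomial (Fin 2) ℝ) : MvPolynomial (Fin 2) ℝ :=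
  C α * u ^ 2 + C (2 * β) * (u * v) + C γ * v ^ 2

lemma polyFun_quadPoly (α β γ : ℝ) (u v : MvPolynomial (Fin 2) ℝ) (z : Plane) :
    polyFun (quadPoly α β γ u v) z =
      α * polyFun u z ^ 2 + 2 * β * polyFun u z * polyFun v z + γ * polyFun v z ^ 2 := by
  simp [polyFun, quadPoly, mul_assoc]

lemma quadForm_symm (α β γ : ℝ) (v : Fin 2 → ℝ) :
    quadForm !![α, β; β, γ] v = α * v 0 ^ 2 + 2 * β * v 0 * v 1 + γ * v 1 ^ 2 := by
  simp [quadForm, Matrix.mulVec, dotProduct, Fin.sum_univ_two]; ring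

/-- At `α = 0` the determinant condition forces `β = 0`, so the identity survives with the
convention `β / 0 = 0`. -/
lemma quad_eq_sum_sq {α β γ : ℝ} (hα : 0 ≤ α) (hdet : β ^ 2 ≤ α * γ) (u v : ℝ) :
    α * u ^ 2 + 2 * β * u * v + γ * v ^ 2 =
      α * (u + β / α * v) ^ 2 + (γ - β ^ 2 / α) * v ^ 2 := by
  rcases hα.eq_or_lt with rfl | hα
  · have : β = 0 := by
      rw [zero_mul] at hdet
      exact pow_eq_zero_iff two_ne_zero |>.1 (le_antisymm hdet (sq_nonneg _))
    simp [this]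
  · field_simp; ring

lemma schur_nonneg {α β γ : ℝ} (hα : 0 ≤ α) (hγ : 0 ≤ γ) (hdet : β ^ 2 ≤ α * γ) :
    0 ≤ γ - β ^ 2 / α := by
  rcases hα.eq_or_lt with rfl | hα
  · simpa using hγ
  · rw [sub_nonneg, div_le_iff₀ hα]; linarith

lemma quad_nonneg {α β γ : ℝ} (hα : 0 ≤ α) (hγ : 0 ≤ γ) (hdet : β ^ 2 ≤ α * γ) (u v : ℝ) :
    0 ≤ α * u ^ 2 + 2 * β * u * v + γ * v ^ 2 := by
  rw [quad_eq_sum_sq hα hdet]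
  have := schur_nonneg hα hγ hdet
  positivity

variable (t : Affine.Triangle ℝ Plane)

/-- The integral over a triangle as a linear functional on polynomials. -/
def triIntegral : MvPolynomial (Fin 2) ℝ →ₗ[ℝ] ℝ where
  toFun q := ∫ z in openTriangle t, polyFun q z
  map_add' q r := by
    simp only [polyFun_add]
    exact integral_add (integrableOn_openTriangle t (continuous_polyFun q))
      (integrableOn_openTriangle t (continuous_polyFun r))
  map_smul' c q := by
    simp only [smul_eq_C_mul, polyFun_C_mul, integral_const_mul, RingHom.id_apply, smul_eq_mul]

lemma triIntegral_apply (q : MvPolynomial (Fin 2) ℝ) :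
    triIntegral t q = ∫ z in openTriangle t, polyFun q z := rfl

lemma triIntegral_C_mul (c : ℝ) (q : MvPolynomial (Fin 2) ℝ) :
    triIntegral t (C c * q) = c * triIntegral t q := by
  rw [← smul_eq_C_mul, map_smul, smul_eq_mul]

lemma triIntegral_nonneg {q : MvPolynomial (Fin 2) ℝ} (h : ∀ z, 0 ≤ polyFun q z) :
    0 ≤ triIntegral t q := integral_nonneg h

lemma triIntegral_sq_nonneg (q : MvPolynomial (Fin 2) ℝ) : 0 ≤ triIntegral t (q ^ 2) :=
  triIntegral_nonneg t fun z => by rw [pow_two, polyFun_mul]; exact mul_self_nonneg _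

lemma triIntegral_pderiv (i : Fin 2) (q : MvPolynomial (Fin 2) ℝ) :
    triIntegral t (pderiv i q) = ∫ z in frontier (openTriangle t),
      polyFun q z * outwardNormal (openTriangle t) z i ∂arcLength := by
  have h := setIntegral_mul_pd_add t (contDiff_polyFun q) (contDiff_const (c := (1 : ℝ))) i
  simp only [pd_polyFun] at h
  simp only [pd, fderiv_fun_const, Pi.zero_apply, zero_apply, mul_zero, zero_add, mul_one] at h
  rw [triIntegral_apply, h]

lemma polyFun_pow (q : MvPolynomial (Fin 2) ℝ) (n : ℕ) (z : Plane) :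
    polyFun (q ^ n) z = polyFun q z ^ n := by simp [polyFun]

/-- Completing the square with constant coefficients writes the form as a nonnegative combination of
squares of polynomials of degree at most `p`, and the trace inequality applies to each. -/
lemma TraceInverse.quadPoly_le {c : ℝ} {p : ℕ} {t : Affine.Triangle ℝ Plane}
    (hT : TraceInverse c p t) {α β γ : ℝ} (hα : 0 ≤ α) (hγ : 0 ≤ γ) (hdet : β ^ 2 ≤ α * γ)
    {u v : MvPolynomial (Fin 2) ℝ} (hu : u.totalDegree ≤ p) (hv : v.totalDegree ≤ p) :
    ∫ z in frontier (openTriangle t), polyFun (quadPoly α β γ u v) z ∂arcLength ≤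
      c * (p : ℝ) ^ 2 / meshSize t * triIntegral t (quadPoly α β γ u v) := by
  set w := C 1 * u + C (β / α) * v with hw
  have h1 := hT w (totalDegree_linComb_le hu hv _ _)
  have h2 := hT v hv
  have e : ∀ z, polyFun (quadPoly α β γ u v) z =
      α * polyFun w z ^ 2 + (γ - β ^ 2 / α) * polyFun v z ^ 2 := by
    intro z
    rw [polyFun_quadPoly, quad_eq_sum_sq hα hdet, hw, polyFun_add, polyFun_C_mul, polyFun_C_mul,
      one_mul]
  have hc : ∀ r : MvPolynomial (Fin 2) ℝ, Continuous fun z => polyFun r z ^ 2 := fun r =>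
    (continuous_polyFun r).pow 2
  rw [triIntegral_apply]
  simp only [e]
  rw [integral_add ((integrableOn_frontier_of_continuous t (hc w)).const_mul _)
      ((integrableOn_frontier_of_continuous t (hc v)).const_mul _),
    integral_add ((integrableOn_openTriangle t (hc w)).const_mul _)
      ((integrableOn_openTriangle t (hc v)).const_mul _)]
  simp only [integral_const_mul]
  have h3 := mul_le_mul_of_nonneg_left h1 hα
  have h4 := mul_le_mul_of_nonneg_left h2 (schur_nonneg hα hγ hdet)
  linarith

/-! ### Boundary terms and parameters on a single element -/

lemma ae_abs_le_supNormOn {S : Set Plane} (hS : S ⊆ frontier (openTriangle t)) {f : Plane → ℝ}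
    {c : ℝ} (hf : ∀ z ∈ frontier (openTriangle t), |f z| ≤ c) :
    ∀ᵐ z ∂arcLength, z ∈ S → |f z| ≤ supNormOn S f := by
  have h1 : ∀ᵐ z ∂arcLength.restrict S, ‖f z‖ ≤ c :=
    ae_restrict_of_ae_restrict_of_subset hS
      ((ae_restrict_iff' isClosed_frontier.measurableSet).2 (Filter.Eventually.of_forall hf))
  -- Finiteness is essential, since an infinite norm would become zero under `toReal`.
  have h2 : eLpNorm f ⊤ (arcLength.restrict S) ≠ ⊤ := by
    rw [eLpNorm_exponent_top]
    exact (eLpNormEssSup_lt_top_of_ae_bound h1).ne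
  refine ae_imp_of_ae_restrict ?_
  filter_upwards [ae_le_eLpNormEssSup (f := f) (μ := arcLength.restrict S)] with z hz
  rw [← eLpNorm_exponent_top] at hz
  have := ENNReal.toReal_mono h2 hz
  simpa [supNormOn] using this

lemma ae_abs_normal_le : ∀ᵐ z ∂arcLength, z ∈ frontier (openTriangle t) →
    |outwardNormal (openTriangle t) z 0| ≤ supNormOn (frontier (openTriangle t))
      (fun z => outwardNormal (openTriangle t) z 0) :=
  ae_abs_le_supNormOn t Subset.rfl (c := 1) fun z _ => abs_outwardNormal_le _ z 0

lemma ae_abs_flux_le : ∀ᵐ z ∂arcLength, z ∈ elementInflow (openTriangle t) →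
    |normalFlux (openTriangle t) z| ≤ supNormOn (elementInflow (openTriangle t))
      (normalFlux (openTriangle t)) := by
  obtain ⟨c, hc⟩ := (isCompact_frontier_openTriangle t).exists_bound_of_continuousOn
    (continuous_coord 0).continuousOn
  refine ae_abs_le_supNormOn t (fun z hz => hz.1) (c := c) fun z hz => ?_
  rw [normalFlux, abs_mul]
  calc |z 0| * |outwardNormal (openTriangle t) z 1| ≤ |z 0| * 1 := by
        gcongr; exact abs_outwardNormal_le _ z 1
    _ ≤ c := by rw [mul_one]; exact hc z hz

lemma integrableOn_flux_mul {f : Plane → ℝ} (hf : Continuous f) :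
    IntegrableOn (fun z => normalFlux (openTriangle t) z * f z) (frontier (openTriangle t))
      arcLength :=
  integrableOn_frontier_normal t (G := fun z n => z 0 * n 1 * f z)
    fun _ => ((continuous_coord 0).mul continuous_const).mul hf

lemma nullMeasurableSet_elementOutflow :
    NullMeasurableSet (elementOutflow (openTriangle t)) arcLength := by
  have h := (integrableOn_flux_mul t (continuous_const (y := (1 : ℝ)))).integrable_indicator
    isClosed_frontier.measurableSet
  have h2 := nullMeasurableSet_le aemeasurable_const h.aemeasurable (f := fun _ => (0 : ℝ))
  have h3 : IsClosed (frontier (openTriangle t)) := isClosed_frontier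
  convert h3.measurableSet.nullMeasurableSet.inter h2 using 1
  ext z
  simp only [elementOutflow, mul_one, mem_inter_iff, mem_ofPred_eq]
  refine and_congr_right fun hz => ?_
  rw [indicator_of_mem hz]

lemma setIntegral_elementOutflow_nonneg {f : Plane → ℝ} (h0 : ∀ z, 0 ≤ f z) :
    0 ≤ ∫ z in elementOutflow (openTriangle t), normalFlux (openTriangle t) z * f z
      ∂arcLength := by
  refine integral_nonneg_of_ae ?_
  filter_upwards [ae_restrict_mem₀ (nullMeasurableSet_elementOutflow t)] with z hz
  exact mul_nonneg hz.2 (h0 z)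

/-- The flux through the outflow part is controlled by the total flux. -/
lemma setIntegral_elementOutflow_le {f : Plane → ℝ} (hf : Continuous f) (h0 : ∀ z, 0 ≤ f z) :
    ∫ z in elementOutflow (openTriangle t), normalFlux (openTriangle t) z * f z ∂arcLength ≤
      (∫ z in frontier (openTriangle t), normalFlux (openTriangle t) z * f z ∂arcLength) +
        supNormOn (elementInflow (openTriangle t)) (normalFlux (openTriangle t)) *
          ∫ z in frontier (openTriangle t), f z ∂arcLength := by
  set m := supNormOn (elementInflow (openTriangle t)) (normalFlux (openTriangle t)) with hm
  have hm0 : 0 ≤ m := ENNReal.toReal_nonneg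
  have hi1 := integrableOn_flux_mul t hf
  have hi2 := (integrableOn_frontier_of_continuous t hf).const_mul m
  have hsub : elementOutflow (openTriangle t) ⊆ frontier (openTriangle t) := fun z hz => hz.1
  rw [← integral_const_mul, ← integral_add hi1 hi2]
  refine (setIntegral_mono (hi1.mono_set hsub) ((hi1.add hi2).mono_set hsub) fun z => ?_).trans
    (setIntegral_mono_set (hi1.add hi2) ?_ hsub.eventuallyLE)
  · exact le_add_of_nonneg_right (mul_nonneg hm0 (h0 z))
  · rw [Filter.EventuallyLE, ae_restrict_iff' isClosed_frontier.measurableSet]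
    filter_upwards [ae_abs_flux_le t] with z hz hzf
    rw [← hm] at hz
    simp only [Pi.zero_apply, Pi.add_apply]
    rw [← add_mul]
    refine mul_nonneg ?_ (h0 z)
    rcases le_or_gt 0 (normalFlux (openTriangle t) z) with h | h
    · positivity
    · linarith [(abs_le.1 (hz ⟨hzf, h⟩)).1]

/-- Integration by parts in the diffusive part of the stabilisation. -/
lemma triIntegral_diffusion (α β γ : ℝ) (a b : MvPolynomial (Fin 2) ℝ)
    (hab : pderiv 0 b = pderiv 1 a) :
    triIntegral t (pderiv 0 (pderiv 0 a) * (C α * a + C β * b) +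
        pderiv 1 (pderiv 0 a) * (C β * a + C γ * b)) =
      (∫ z in frontier (openTriangle t),
        polyFun (pderiv 0 a * (C α * a + C β * b) + pderiv 1 a * (C β * a + C γ * b)) z *
          outwardNormal (openTriangle t) z 0 ∂arcLength) -
        triIntegral t (quadPoly α β γ (pderiv 0 a) (pderiv 1 a)) := by
  rw [← triIntegral_pderiv, ← map_sub]
  congr 1
  simp only [quadPoly, Derivation.leibniz, map_add, pderiv_C, smul_eq_mul, hab,
    pderiv_comm 0 1 a, C_mul, map_ofNat]
  ring

/-- Integration by parts in the transport part of the stabilisation. -/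
lemma triIntegral_transport (α β γ : ℝ) (a b : MvPolynomial (Fin 2) ℝ) :
    triIntegral t (X 0 * (pderiv 1 a * (C α * a + C β * b) + pderiv 1 b * (C β * a + C γ * b))) =
      1 / 2 * ∫ z in frontier (openTriangle t), normalFlux (openTriangle t) z *
        polyFun (quadPoly α β γ a b) z ∂arcLength := by
  have h := triIntegral_pderiv t 1 (X 0 * quadPoly α β γ a b)
  have e : pderiv 1 (X 0 * quadPoly α β γ a b) =
      C 2 * (X 0 * (pderiv 1 a * (C α * a + C β * b) + pderiv 1 b * (C β * a + C γ * b))) := by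
    simp only [quadPoly, Derivation.leibniz, Derivation.leibniz_pow, map_add, pderiv_C, pderiv_X,
      smul_eq_mul]
    simp only [C_mul, map_ofNat]
    simp
    ring
  rw [e, triIntegral_C_mul] at h
  have e2 : ∀ z : Plane, polyFun (X 0 * quadPoly α β γ a b) z *
      outwardNormal (openTriangle t) z 1 = normalFlux (openTriangle t) z *
        polyFun (quadPoly α β γ a b) z := fun z => by
    rw [polyFun_mul, polyFun_X, normalFlux]; ring
  simp only [e2] at h
  rw [← h]; ring

/-- Young's inequality in the seminorm of `A`, from the nonnegativity of the form at `2 ε u - n v`.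
-/
lemma bilin_le_quad {α β γ : ℝ} (hα : 0 ≤ α) (hγ : 0 ≤ γ) (hdet : β ^ 2 ≤ α * γ)
    {n N ε : ℝ} (hε : 0 < ε) (hn : |n| ≤ N) (u₀ u₁ v₀ v₁ : ℝ) :
    (u₀ * (α * v₀ + β * v₁) + u₁ * (β * v₀ + γ * v₁)) * n ≤
      ε * (α * u₀ ^ 2 + 2 * β * u₀ * u₁ + γ * u₁ ^ 2) +
        N ^ 2 / (4 * ε) * (α * v₀ ^ 2 + 2 * β * v₀ * v₁ + γ * v₁ ^ 2) := by
  have h1 := quad_nonneg hα hγ hdet (2 * ε * u₀ - n * v₀) (2 * ε * u₁ - n * v₁)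
  have h2 := quad_nonneg hα hγ hdet v₀ v₁
  have h3 : n ^ 2 ≤ N ^ 2 := by
    rw [← sq_abs n]; exact pow_le_pow_left₀ (abs_nonneg n) hn 2
  have h4 := mul_le_mul_of_nonneg_right h3 h2
  rw [div_mul_eq_mul_div, ← sub_le_iff_le_add', le_div_iff₀ (by positivity)]
  nlinarith

/-- The boundary term produced by the diffusive part of the stabilisation. -/
lemma setIntegral_frontier_bilin_le {c : ℝ} (hc : 0 < c) {p : ℕ} (hp : 1 ≤ p)
    (hT : TraceInverse c p t) {α β γ : ℝ} (hα : 0 ≤ α) (hγ : 0 ≤ γ) (hdet : β ^ 2 ≤ α * γ)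
    {u₀ u₁ v₀ v₁ : MvPolynomial (Fin 2) ℝ} (hu₀ : u₀.totalDegree ≤ p) (hu₁ : u₁.totalDegree ≤ p)
    (hv₀ : v₀.totalDegree ≤ p) (hv₁ : v₁.totalDegree ≤ p) :
    ∫ z in frontier (openTriangle t),
        polyFun (u₀ * (C α * v₀ + C β * v₁) + u₁ * (C β * v₀ + C γ * v₁)) z *
          outwardNormal (openTriangle t) z 0 ∂arcLength ≤
      3 / 4 * triIntegral t (quadPoly α β γ u₀ u₁) +
        (c * (p : ℝ) ^ 2 / meshSize t) ^ 2 *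
          supNormOn (frontier (openTriangle t)) (fun z => outwardNormal (openTriangle t) z 0) ^ 2 /
            3 * triIntegral t (quadPoly α β γ v₀ v₁) := by
  set K := c * (p : ℝ) ^ 2 / meshSize t with hK
  set N := supNormOn (frontier (openTriangle t)) (fun z => outwardNormal (openTriangle t) z 0)
    with hN
  have hp0 : (0 : ℝ) < p := by exact_mod_cast hp
  have hK0 : 0 < K := by have := meshSize_pos t; positivity
  -- After the trace inequality this `ε` costs exactly `3/4` of `‖√A∇w_x‖²` and leaves the `1/4`
  -- needed; the other term becomes `K² N² / 3`, a summand of `δ`.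
  have hε : 0 < 3 / (4 * K) := by positivity
  have hu := hT.quadPoly_le hα hγ hdet hu₀ hu₁
  have hv := hT.quadPoly_le hα hγ hdet hv₀ hv₁
  rw [← hK] at hu hv
  have hiu := integrableOn_frontier_of_continuous t (continuous_polyFun (quadPoly α β γ u₀ u₁))
  have hiv := integrableOn_frontier_of_continuous t (continuous_polyFun (quadPoly α β γ v₀ v₁))
  have hle : ∫ z in frontier (openTriangle t),
        polyFun (u₀ * (C α * v₀ + C β * v₁) + u₁ * (C β * v₀ + C γ * v₁)) z *
          outwardNormal (openTriangle t) z 0 ∂arcLength ≤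
      3 / (4 * K) * (∫ z in frontier (openTriangle t), polyFun (quadPoly α β γ u₀ u₁) z ∂arcLength) +
        N ^ 2 / (4 * (3 / (4 * K))) *
          ∫ z in frontier (openTriangle t), polyFun (quadPoly α β γ v₀ v₁) z ∂arcLength := by
    rw [← integral_const_mul, ← integral_const_mul,
      ← integral_add (hiu.const_mul _) (hiv.const_mul _)]
    refine integral_mono_ae (integrableOn_frontier_normal t (G := fun z n => polyFun _ z * n 0)
      fun _ => (continuous_polyFun _).mul continuous_const)
      ((hiu.const_mul _).add (hiv.const_mul _)) ?_
    rw [Filter.EventuallyLE, ae_restrict_iff' isClosed_frontier.measurableSet]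
    filter_upwards [ae_abs_normal_le t] with z hz hzf
    simp only [polyFun_quadPoly, polyFun_add, polyFun_mul, polyFun_C]
    exact bilin_le_quad hα hγ hdet hε (hz hzf) _ _ _ _
  have hNK : 0 ≤ N ^ 2 / (4 * (3 / (4 * K))) := by positivity
  refine hle.trans ?_
  calc _ ≤ 3 / (4 * K) * (K * triIntegral t (quadPoly α β γ u₀ u₁)) +
        N ^ 2 / (4 * (3 / (4 * K))) * (K * triIntegral t (quadPoly α β γ v₀ v₁)) := by gcongr
    _ = _ := by field_simp

/-- The streamline-upwind term. -/
lemma triIntegral_supg_ge {c : ℝ} (hc : 0 < c) {p : ℕ} (hp : 1 ≤ p) (hG : GradInverse c p t)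
    {τ : ℝ} (hτ : τ = meshSize t ^ 2 / (4 * c ^ 2 * (p : ℝ) ^ 4)) {a : MvPolynomial (Fin 2) ℝ}
    (ha : a.totalDegree ≤ p) (d : MvPolynomial (Fin 2) ℝ) :
    1 / 2 * (τ * triIntegral t (d ^ 2)) - 1 / 8 * triIntegral t (a ^ 2) ≤
      triIntegral t ((d - pderiv 0 a) * (C τ * d)) := by
  have hh := meshSize_pos t
  have hp0 : (0 : ℝ) < p := by exact_mod_cast hp
  have hτ0 : 0 < τ := by rw [hτ]; positivity
  have h1 := (gradInverse_iff hc t).1 hG a ha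
  have h2 : triIntegral t (pderiv 0 a ^ 2 + pderiv 1 a ^ 2) ≤
      (c * (p : ℝ) ^ 2 / meshSize t) ^ 2 * triIntegral t (a ^ 2) := by
    simpa only [triIntegral_apply, polyFun_add, polyFun_pow, pd_polyFun] using h1
  rw [map_add] at h2
  -- The scaling of `τ` makes `τ ‖w_xx‖²` at most a quarter of `‖w_x‖²`; polarisation halves this to
  -- `1/8`.
  have h3 : τ * (c * (p : ℝ) ^ 2 / meshSize t) ^ 2 = 1 / 4 := by
    rw [hτ]; field_simp
  have h4 : τ * triIntegral t (pderiv 0 a ^ 2) ≤ 1 / 4 * triIntegral t (a ^ 2) := by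
    rw [← h3, mul_assoc]
    exact mul_le_mul_of_nonneg_left
      (by linarith [triIntegral_sq_nonneg t (pderiv 1 a)]) hτ0.le
  have h5 := triIntegral_sq_nonneg t (d - pderiv 0 a)
  have e1 : (d - pderiv 0 a) ^ 2 = d ^ 2 - C 2 * (d * pderiv 0 a) + pderiv 0 a ^ 2 := by
    rw [map_ofNat]; ring
  have e2 : (d - pderiv 0 a) * (C τ * d) = C τ * (d ^ 2 - d * pderiv 0 a) := by ring
  rw [e1, map_add, map_sub, triIntegral_C_mul] at h5
  rw [e2, triIntegral_C_mul, map_sub]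
  nlinarith

/-- Here `x`, `y`, `xy` stand for `‖w_x‖²`, `‖w_y‖²`, `(w_x, w_y)`. With `e = 1/δ` the difference of
the sides is `5/8 x + e/24 xy + 17/768 e² y`. The hypothesis times `5/8` has the same first two
terms, whence the `30`, and the smaller coefficient `1/1440` at `e² y`. -/
lemma coercivity_arithmetic {α β γ δ x y xy : ℝ} (hα : α = (8 * δ)⁻¹)
    (hβ : β = (24 * δ ^ 2)⁻¹) (hγ : γ = (64 * δ ^ 3)⁻¹) (hδ : 0 ≤ δ) (hx : 0 ≤ x) (hy : 0 ≤ y)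
    (hxy : 0 ≤ x + 2 * (δ⁻¹ / 30) * xy + (δ⁻¹ / 30) ^ 2 * y) :
    1 / 8 * x + 1 / 4 * (γ * δ * y) ≤
      7 / 8 * x + (α * xy + β * y) - δ * (α * x + 2 * β * xy + γ * y) := by
  -- At `δ = 0` all entries of `A` vanish by the convention `0⁻¹ = 0`, and no separate proof that
  -- `δ` is positive is needed.
  rcases hδ.eq_or_lt with rfl | hδ
  · simp at hα hβ hγ
    subst hα hβ hγ
    linarith
  set e := δ⁻¹ with he
  have hδe : δ * e = 1 := mul_inv_cancel₀ hδ.ne'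
  have hα' : α = e / 8 := by rw [hα, mul_inv]; ring
  have hβ' : β = e ^ 2 / 24 := by rw [hβ, mul_inv, ← inv_pow]; ring
  have hγ' : γ = e ^ 3 / 64 := by rw [hγ, mul_inv, ← inv_pow]; ring
  have h1 : δ * α = 1 / 8 := by rw [hα']; linear_combination hδe / 8
  have h2 : δ * β = e / 24 := by rw [hβ']; linear_combination e * hδe / 24
  have h3 : δ * γ = e ^ 2 / 64 := by rw [hγ']; linear_combination e ^ 2 * hδe / 64
  have h4 : δ * (α * x + 2 * β * xy + γ * y) = 1 / 8 * x + 2 * (e / 24) * xy + e ^ 2 / 64 * y := by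
    rw [← h1, ← h2, ← h3]; ring
  rw [h4, mul_comm γ δ, h3, hα', hβ']
  have h5 : 0 ≤ e ^ 2 * y := by positivity
  nlinarith

lemma sq_le_mul_of_parameters {α β γ δ : ℝ} (hα : α = (8 * δ)⁻¹)
    (hβ : β = (24 * δ ^ 2)⁻¹) (hγ : γ = (64 * δ ^ 3)⁻¹) (hδ : 0 ≤ δ) : β ^ 2 ≤ α * γ := by
  rw [hα, hβ, hγ, ← mul_inv, inv_pow]
  rcases hδ.eq_or_lt with h | h
  · rw [← h]; simp
  · refine inv_anti₀ (by positivity) ?_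
    nlinarith [pow_pos h 4]

lemma deltaConst_nonneg (c : ℝ) : 0 ≤ deltaConst c t := by
  have h : 0 ≤ supNormOn (elementInflow (openTriangle t)) (normalFlux (openTriangle t)) :=
    ENNReal.toReal_nonneg
  unfold deltaConst
  positivity

/-- Coercivity of the stabilised form on one element. -/
theorem element_coercivity {p : ℕ} (hp : 1 ≤ p) {Cinv CINV : ℝ} (hCinv : 0 < Cinv)
    (hCINV : 0 < CINV) (hT : TraceInverse Cinv p t) (hG : GradInverse CINV p t)
    (hh : meshSize t ≤ 1) {α β γ δ τ : ℝ}
    (hδ : δ = deltaConst Cinv t * ((p : ℝ) ^ 4 / meshSize t ^ 2))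
    (hτ : τ = meshSize t ^ 2 / (4 * CINV ^ 2 * (p : ℝ) ^ 4)) (hα : α = (8 * δ)⁻¹)
    (hβ : β = (24 * δ ^ 2)⁻¹) (hγ : γ = (64 * δ ^ 3)⁻¹) {a b : MvPolynomial (Fin 2) ℝ}
    (ha : a.totalDegree ≤ p) (hb : b.totalDegree ≤ p) (hab : pderiv 0 b = pderiv 1 a)
    (r : MvPolynomial (Fin 2) ℝ) :
    1 / 8 * triIntegral t (a ^ 2) + 1 / 4 * (γ * δ * triIntegral t (b ^ 2)) +
        1 / 8 * (τ * triIntegral t ((r + X 0 * b) ^ 2)) +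
        1 / 4 * triIntegral t (quadPoly α β γ (pderiv 0 a) (pderiv 1 a)) +
        1 / 4 * ∫ z in elementOutflow (openTriangle t), normalFlux (openTriangle t) z *
          polyFun (quadPoly α β γ a b) z ∂arcLength ≤
      triIntegral t (a ^ 2) + triIntegral t ((r + X 0 * b - pderiv 0 a) * (C τ * (r + X 0 * b))) +
        triIntegral t (pderiv 0 (-pderiv 0 a + X 0 * b) * (C α * a + C β * b) +
          pderiv 1 (-pderiv 0 a + X 0 * b) * (C β * a + C γ * b)) := by
  have hh0 := meshSize_pos t
  have hp0 : (0 : ℝ) < p := by exact_mod_cast hp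
  set K := Cinv * (p : ℝ) ^ 2 / meshSize t with hK
  have hK1 : 1 ≤ K := hT.one_le hh
  set m := supNormOn (elementInflow (openTriangle t)) (normalFlux (openTriangle t)) with hm
  set N := supNormOn (frontier (openTriangle t)) (fun z => outwardNormal (openTriangle t) z 0)
    with hN
  have hm0 : 0 ≤ m := ENNReal.toReal_nonneg
  -- In this form `δ` is the sum of the losses: `K² m / 2` from the inflow flux and `K² N² / 3` from
  -- the diffusive boundary term.
  have hδK : δ = K ^ 2 * (m / 2 + N ^ 2 / 3) := by
    rw [hδ, deltaConst, hK, ← hm, ← hN]; ring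
  have hδ0 : 0 ≤ δ := by rw [hδK]; positivity
  have hα0 : 0 ≤ α := by rw [hα]; positivity
  have hγ0 : 0 ≤ γ := by rw [hγ]; positivity
  have hdet : β ^ 2 ≤ α * γ := sq_le_mul_of_parameters hα hβ hγ hδ0
  have hτ0 : 0 ≤ τ := by rw [hτ]; positivity
  have hdeg : ∀ i, (pderiv i a).totalDegree ≤ p := fun i => (totalDegree_pderiv_le i a).trans ha
  have hQ0 : ∀ u v z, 0 ≤ polyFun (quadPoly α β γ u v) z := fun u v z => by
    rw [polyFun_quadPoly]; exact quad_nonneg hα0 hγ0 hdet _ _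
  -- the three contributions
  have hsupg := triIntegral_supg_ge t hCINV hp hG hτ ha (r + X 0 * b)
  have hbil := setIntegral_frontier_bilin_le t hCinv hp hT hα0 hγ0 hdet (hdeg 0) (hdeg 1) ha hb
  rw [← hK, ← hN] at hbil
  have hout := setIntegral_elementOutflow_le t (continuous_polyFun (quadPoly α β γ a b)) (hQ0 a b)
  rw [← hm] at hout
  have htr := hT.quadPoly_le hα0 hγ0 hdet ha hb
  rw [← hK] at htr
  -- The middle summand `α a b + β b²` is the commutator contribution, arising where `∂_x` hits the
  -- coefficient `x`.
  have hsplit : pderiv 0 (-pderiv 0 a + X 0 * b) * (C α * a + C β * b) +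
      pderiv 1 (-pderiv 0 a + X 0 * b) * (C β * a + C γ * b) =
      C (-1) * (pderiv 0 (pderiv 0 a) * (C α * a + C β * b) +
        pderiv 1 (pderiv 0 a) * (C β * a + C γ * b)) + (C α * (a * b) + C β * b ^ 2) +
      X 0 * (pderiv 1 a * (C α * a + C β * b) + pderiv 1 b * (C β * a + C γ * b)) := by
    simp only [map_add, map_neg, Derivation.leibniz, pderiv_X, smul_eq_mul, hab, C_1]
    simp
    ring
  rw [hsplit, map_add, map_add, map_add, triIntegral_C_mul, triIntegral_C_mul, triIntegral_C_mul,
    triIntegral_diffusion t α β γ a b hab, triIntegral_transport]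
  have hQ : triIntegral t (quadPoly α β γ a b) = α * triIntegral t (a ^ 2) +
      2 * β * triIntegral t (a * b) + γ * triIntegral t (b ^ 2) := by
    rw [quadPoly, map_add, map_add, triIntegral_C_mul, triIntegral_C_mul, triIntegral_C_mul]
  have hxy : 0 ≤ triIntegral t (a ^ 2) + 2 * (δ⁻¹ / 30) * triIntegral t (a * b) +
      (δ⁻¹ / 30) ^ 2 * triIntegral t (b ^ 2) := by
    have := triIntegral_sq_nonneg t (a + C (δ⁻¹ / 30) * b)
    have e : (a + C (δ⁻¹ / 30) * b) ^ 2 = a ^ 2 + C (2 * (δ⁻¹ / 30)) * (a * b) +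
        C ((δ⁻¹ / 30) ^ 2) * b ^ 2 := by
      rw [C_mul, C_pow, map_ofNat]; ring
    rwa [e, map_add, map_add, triIntegral_C_mul, triIntegral_C_mul] at this
  have harith := coercivity_arithmetic hα hβ hγ hδ0 (triIntegral_sq_nonneg t a)
    (triIntegral_sq_nonneg t b) hxy
  rw [← hQ, hδK] at harith
  have hQ1 := triIntegral_nonneg t (hQ0 a b)
  have hD := triIntegral_sq_nonneg t (r + X 0 * b)
  have hout0 := setIntegral_elementOutflow_nonneg t (hQ0 a b)
  have hmK : m * ∫ z in frontier (openTriangle t), polyFun (quadPoly α β γ a b) z ∂arcLength ≤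
      m * (K ^ 2 * triIntegral t (quadPoly α β γ a b)) := by
    -- The trace inequality gives only one factor `K`; since `K ≥ 1` it is raised to the `K²`
    -- contained in `δ`.
    refine mul_le_mul_of_nonneg_left (htr.trans ?_) hm0
    exact mul_le_mul_of_nonneg_right (by nlinarith) hQ1
  have hτD : 0 ≤ τ * triIntegral t ((r + X 0 * b) ^ 2) := mul_nonneg hτ0 hD
  rw [← hδK] at harith
  have hδQ : δ * triIntegral t (quadPoly α β γ a b) = 1 / 2 * (m * (K ^ 2 *
      triIntegral t (quadPoly α β γ a b))) + K ^ 2 * N ^ 2 / 3 *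
      triIntegral t (quadPoly α β γ a b) := by rw [hδK]; ring
  linarith

end Element

end

noncomputable section

/-! ### Elementwise evaluation of the form and of the norm -/

section Evaluation

open MvPolynomial

lemma eqOn_pd {S : Set Plane} (hS : IsOpen S) {f g : Plane → ℝ} (h : EqOn f g S) (i : Fin 2) :
    EqOn (pd i f) (pd i g) S := fun z hz => by
  have : f =ᶠ[𝓝 z] g := Filter.eventuallyEq_of_mem (hS.mem_nhds hz) h
  rw [pd, pd, this.fderiv_eq]

lemma eqOn_pd_polyFun {S : Set Plane} (hS : IsOpen S) {f : Plane → ℝ}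
    {q : MvPolynomial (Fin 2) ℝ} (h : EqOn f (polyFun q) S) (i : Fin 2) :
    EqOn (pd i f) (polyFun (pderiv i q)) S := by
  rw [← pd_polyFun]
  exact eqOn_pd hS h i

lemma eqOn_kolmogorovOp {S : Set Plane} (hS : IsOpen S) {f : Plane → ℝ}
    {q : MvPolynomial (Fin 2) ℝ} (h : EqOn f (polyFun q) S) :
    EqOn (kolmogorovOp f) (polyFun (-pderiv 0 (pderiv 0 q) + X 0 * pderiv 1 q)) S := fun z hz => by
  rw [kolmogorovOp, eqOn_pd_polyFun hS (eqOn_pd_polyFun hS h 0) 0 hz, eqOn_pd_polyFun hS h 1 hz,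
    polyFun_add, polyFun_mul, polyFun_X]
  simp [polyFun]

lemma innerGrad_eq (t : Affine.Triangle ℝ Plane) {f : Plane → ℝ} {q : MvPolynomial (Fin 2) ℝ}
    (h : EqOn f (polyFun q) (openTriangle t)) {z : Plane} (hz : z ∈ closure (openTriangle t))
    (i : Fin 2) : innerGrad (openTriangle t) f z i = polyFun (pderiv i q) z := by
  refine extendFrom_eq hz (((continuous_polyFun (pderiv i q)).continuousWithinAt
    (s := openTriangle t)).congr' ?_)
  exact (eqOn_pd_polyFun (isOpen_openTriangle t) h i).symm.eventuallyEq_nhdsWithin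

lemma setIntegral_eq_triIntegral (t : Affine.Triangle ℝ Plane) {f : Plane → ℝ}
    {q : MvPolynomial (Fin 2) ℝ} (h : EqOn f (polyFun q) (openTriangle t)) :
    ∫ z in openTriangle t, f z = triIntegral t q :=
  setIntegral_congr_fun (isOpen_openTriangle t).measurableSet h

lemma setIntegral_domain_eq_sum {Ω : Set Plane} (M : Triangulation Ω)
    (hΩ : interior (closure Ω) = Ω) {f : Plane → ℝ}
    {q : Affine.Triangle ℝ Plane → MvPolynomial (Fin 2) ℝ}
    (h : ∀ t ∈ M.elements, EqOn f (polyFun (q t)) (openTriangle t)) :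
    ∫ z in Ω, f z = ∑ t ∈ M.elements, triIntegral t (q t) := by
  rw [setIntegral_eq_sum_openTriangle M hΩ fun t ht =>
    (integrableOn_openTriangle t (continuous_polyFun (q t))).congr_fun (h t ht).symm
      (isOpen_openTriangle t).measurableSet]
  exact Finset.sum_congr rfl fun t ht => setIntegral_eq_triIntegral t (h t ht)

/-- Coercivity of the stabilised form, at a fixed time. -/
theorem energyNorm_sq_le_stabForm {Ω : Set Plane} (hΩo : IsOpen Ω)
    (hΩ : interior (closure Ω) = Ω) (hell : ∀ z ∈ ellipticBoundary Ω, 0 ≤ normalFlux Ω z)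
    (M : Triangulation Ω) (hM : ∀ t ∈ M.elements, meshSize t ≤ 1) {p : ℕ} (hp : 1 ≤ p)
    {Cinv CINV : ℝ} (hCinv : 0 < Cinv) (hCINV : 0 < CINV)
    (hT : ∀ t ∈ M.elements, TraceInverse Cinv p t) (hG : ∀ t ∈ M.elements, GradInverse CINV p t)
    {α β γ δ τ : Affine.Triangle ℝ Plane → ℝ}
    (hδ : ∀ t ∈ M.elements, δ t = deltaConst Cinv t * ((p : ℝ) ^ 4 / meshSize t ^ 2))
    (hτ : ∀ t ∈ M.elements, τ t = meshSize t ^ 2 / (4 * CINV ^ 2 * (p : ℝ) ^ 4))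
    (hα : ∀ t ∈ M.elements, α t = (8 * δ t)⁻¹)
    (hβ : ∀ t ∈ M.elements, β t = (24 * δ t ^ 2)⁻¹)
    (hγ : ∀ t ∈ M.elements, γ t = (64 * δ t ^ 3)⁻¹) {v v' : Plane → ℝ}
    (hv : v ∈ feSpace Ω M p) (hv' : v' ∈ feSpace Ω M p) :
    1 / 4 * energyNorm Ω M (fun t => !![α t, β t; β t, γ t]) γ δ τ v v' ^ 2 ≤
      stabForm Ω M (fun t => !![α t, β t; β t, γ t]) τ v v' v v' := by
  obtain ⟨hvm, hv⟩ := hv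
  have hex : ∀ t, ∃ q : MvPolynomial (Fin 2) ℝ, t ∈ M.elements →
      q.totalDegree ≤ p ∧ EqOn v (polyFun q) (openTriangle t) := fun t => by
    by_cases ht : t ∈ M.elements
    · obtain ⟨q, hq, h⟩ := hv t ht
      exact ⟨q, fun _ => ⟨hq, h⟩⟩
    · exact ⟨0, fun h => absurd h ht⟩
  have hex' : ∀ t, ∃ r : MvPolynomial (Fin 2) ℝ, t ∈ M.elements →
      EqOn v' (polyFun r) (openTriangle t) := fun t => by
    by_cases ht : t ∈ M.elements
    · obtain ⟨r, -, h⟩ := hv'.2 t ht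
      exact ⟨r, fun _ => h⟩
    · exact ⟨0, fun h => absurd h ht⟩
  choose q hq using hex
  choose r hr using hex'
  have hqv : ∀ t ∈ M.elements, EqOn v (polyFun (q t)) (openTriangle t) := fun t ht => (hq t ht).2
  have ho : ∀ t, IsOpen (openTriangle t) := isOpen_openTriangle
  set a : Affine.Triangle ℝ Plane → MvPolynomial (Fin 2) ℝ := fun t => pderiv 0 (q t) with ha
  set b : Affine.Triangle ℝ Plane → MvPolynomial (Fin 2) ℝ := fun t => pderiv 1 (q t) with hb
  have hav : ∀ t ∈ M.elements, EqOn (pd 0 v) (polyFun (a t)) (openTriangle t) := fun t ht =>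
    eqOn_pd_polyFun (ho t) (hqv t ht) 0
  have hbv : ∀ t ∈ M.elements, EqOn (pd 1 v) (polyFun (b t)) (openTriangle t) := fun t ht =>
    eqOn_pd_polyFun (ho t) (hqv t ht) 1
  have hδ0 : ∀ t ∈ M.elements, 0 ≤ δ t := fun t ht => by
    rw [hδ t ht]
    have := deltaConst_nonneg t Cinv
    positivity
  have hα0 : ∀ t ∈ M.elements, 0 ≤ α t := fun t ht => by
    rw [hα t ht]; have := hδ0 t ht; positivity
  have hγ0 : ∀ t ∈ M.elements, 0 ≤ γ t := fun t ht => by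
    rw [hγ t ht]; have := hδ0 t ht; positivity
  have hτ0 : ∀ t ∈ M.elements, 0 ≤ τ t := fun t ht => by rw [hτ t ht]; positivity
  have hQ0 : ∀ t ∈ M.elements, ∀ u w z, 0 ≤ polyFun (quadPoly (α t) (β t) (γ t) u w) z :=
    fun t ht u w z => by
      rw [polyFun_quadPoly]
      exact quad_nonneg (hα0 t ht) (hγ0 t ht)
        (sq_le_mul_of_parameters (hα t ht) (hβ t ht) (hγ t ht) (hδ0 t ht)) _ _
  -- the terms of the norm
  have n1 : ∫ z in Ω, pd 0 v z ^ 2 = ∑ t ∈ M.elements, triIntegral t (a t ^ 2) :=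
    setIntegral_domain_eq_sum M hΩ fun t ht z hz => by
      simp only [hav t ht hz, polyFun_pow]
  have n2 : ∀ t ∈ M.elements, ∫ z in openTriangle t, γ t * δ t * pd 1 v z ^ 2 =
      γ t * δ t * triIntegral t (b t ^ 2) := fun t ht => by
    rw [← triIntegral_C_mul]
    exact setIntegral_eq_triIntegral t fun z hz => by
      simp only [hbv t ht hz, polyFun_pow, polyFun_C_mul]
  have n3 : ∀ t ∈ M.elements, ∫ z in openTriangle t, τ t * (v' z + z 0 * pd 1 v z) ^ 2 =
      τ t * triIntegral t ((r t + X 0 * b t) ^ 2) := fun t ht => by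
    rw [← triIntegral_C_mul]
    exact setIntegral_eq_triIntegral t fun z hz => by
      simp only [hbv t ht hz, hr t ht hz, polyFun_pow, polyFun_C, polyFun_add, polyFun_mul,
        polyFun_X]
  have n4 : ∀ t ∈ M.elements, ∫ z in openTriangle t,
      quadForm !![α t, β t; β t, γ t] (grad (pd 0 v) z) =
      triIntegral t (quadPoly (α t) (β t) (γ t) (pderiv 0 (a t)) (pderiv 1 (a t))) := fun t ht =>
    setIntegral_eq_triIntegral t fun z hz => by
      simp only [quadForm_symm, grad, polyFun_quadPoly,
        eqOn_pd_polyFun (ho t) (hav t ht) _ hz]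
  have n5 : ∀ t ∈ M.elements, ∫ z in elementOutflow (openTriangle t),
      normalFlux (openTriangle t) z * quadForm !![α t, β t; β t, γ t]
        (innerGrad (openTriangle t) v z) ∂arcLength =
      ∫ z in elementOutflow (openTriangle t), normalFlux (openTriangle t) z *
        polyFun (quadPoly (α t) (β t) (γ t) (a t) (b t)) z ∂arcLength := fun t ht => by
    -- The outflow part is only known to be null measurable, so the integrands are compared almost
    -- everywhere instead of on the set.
    refine integral_congr_ae ?_
    filter_upwards [ae_restrict_mem₀ (nullMeasurableSet_elementOutflow t)] with z hz
    rw [quadForm_symm, innerGrad_eq t (hqv t ht) (frontier_subset_closure hz.1),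
      innerGrad_eq t (hqv t ht) (frontier_subset_closure hz.1), polyFun_quadPoly]
  -- the terms of the form
  have s1 : ∫ z in Ω, pd 0 v z * pd 0 v z = ∑ t ∈ M.elements, triIntegral t (a t ^ 2) := by
    rw [← n1]; simp only [pow_two]
  have s2 : ∫ z in Ω, z 0 * pd 1 v z * v z =
      ∑ t ∈ M.elements, triIntegral t (X 0 * b t * q t) :=
    setIntegral_domain_eq_sum M hΩ fun t ht z hz => by
      simp only [hbv t ht hz, hqv t ht hz, polyFun_mul, polyFun_X]
  have s3 : ∀ t ∈ M.elements, ∫ z in openTriangle t, (v' z + kolmogorovOp v z) *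
      (τ t * (v' z + z 0 * pd 1 v z)) =
      triIntegral t ((r t + X 0 * b t - pderiv 0 (a t)) * (C (τ t) * (r t + X 0 * b t))) :=
    fun t ht => setIntegral_eq_triIntegral t fun z hz => by
      simp only [eqOn_kolmogorovOp (ho t) (hqv t ht) hz, hbv t ht hz, hr t ht hz]
      simp only [polyFun, map_add, map_sub, map_neg, map_mul, eval_X, eval_C, ha, hb]
      ring
  have s4 : ∀ t ∈ M.elements, ∫ z in openTriangle t,
      grad (kolmogorovOp v) z ⬝ᵥ (!![α t, β t; β t, γ t] : Matrix (Fin 2) (Fin 2) ℝ).mulVec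
        (grad v z) =
      triIntegral t (pderiv 0 (-pderiv 0 (a t) + X 0 * b t) * (C (α t) * a t + C (β t) * b t) +
        pderiv 1 (-pderiv 0 (a t) + X 0 * b t) * (C (β t) * a t + C (γ t) * b t)) := fun t ht =>
    setIntegral_eq_triIntegral t fun z hz => by
      have hL := eqOn_kolmogorovOp (ho t) (hqv t ht)
      simp only [dotProduct, Matrix.mulVec, Fin.sum_univ_two, grad,
        eqOn_pd_polyFun (ho t) hL _ hz, hav t ht hz, hbv t ht hz, polyFun_add, polyFun_mul,
        polyFun_C]
      rfl
  have hflux := setIntegral_outflowBoundary_le M q hΩo hΩ hell hvm hqv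
  have hflux' : ∑ t ∈ M.elements, ∫ z in openTriangle t,
      z 0 * pd 1 (polyFun (q t)) z * polyFun (q t) z =
      ∑ t ∈ M.elements, triIntegral t (X 0 * b t * q t) :=
    Finset.sum_congr rfl fun t _ => setIntegral_eq_triIntegral t fun z _ => by
      simp only [pd_polyFun, polyFun_mul, polyFun_X, hb]
  rw [hflux'] at hflux
  have hflux0 := setIntegral_outflowBoundary_nonneg M q hΩo hΩ hell hvm hqv
  have hel := Finset.sum_le_sum fun t ht => element_coercivity t hp hCinv hCINV (hT t ht) (hG t ht)
    (hM t ht) (hδ t ht) (hτ t ht) (hα t ht) (hβ t ht) (hγ t ht)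
    ((totalDegree_pderiv_le 0 (q t)).trans (hq t ht).1)
    ((totalDegree_pderiv_le 1 (q t)).trans (hq t ht).1) (pderiv_comm 0 1 (q t)) (r t)
  simp only [Finset.sum_add_distrib, ← Finset.mul_sum] at hel
  rw [stabForm, supgForm, energyNorm, Real.sq_sqrt, n1, s1, s2, Finset.sum_congr rfl n2,
    Finset.sum_congr rfl n3, Finset.sum_congr rfl n4, Finset.sum_congr rfl n5,
    Finset.sum_congr rfl s3, Finset.sum_congr rfl s4]
  · linarith
  -- The radicand must be nonnegative for the square of the norm to recover the sum, since the real
  -- square root is zero on negative numbers.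
  · rw [n1, Finset.sum_congr rfl n2, Finset.sum_congr rfl n3, Finset.sum_congr rfl n4,
      Finset.sum_congr rfl n5]
    have p1 := Finset.sum_nonneg fun t (_ : t ∈ M.elements) => triIntegral_sq_nonneg t (a t)
    have p2 := Finset.sum_nonneg fun t (ht : t ∈ M.elements) =>
      mul_nonneg (mul_nonneg (hγ0 t ht) (hδ0 t ht)) (triIntegral_sq_nonneg t (b t))
    have p3 := Finset.sum_nonneg fun t (ht : t ∈ M.elements) =>
      mul_nonneg (hτ0 t ht) (triIntegral_sq_nonneg t (r t + X 0 * b t))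
    have p4 := Finset.sum_nonneg fun t (ht : t ∈ M.elements) =>
      triIntegral_nonneg t (hQ0 t ht (pderiv 0 (a t)) (pderiv 1 (a t)))
    have p5 := Finset.sum_nonneg fun t (ht : t ∈ M.elements) =>
      setIntegral_elementOutflow_nonneg t (hQ0 t ht (a t) (b t))
    linarith

end Evaluation

end

theorem mainTheorem3 :
    (∀ σ : ℝ, 0 < σ → ∃ Cinv CINV : ℝ, 0 < Cinv ∧ 0 < CINV ∧
      ∀ t : Affine.Triangle ℝ Plane, ShapeRegular σ t → ∀ p : ℕ, 1 ≤ p →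
        TraceInverse Cinv p t ∧ GradInverse CINV p t) ∧
    (∀ (Ω : Set Plane), IsOpen Ω → interior (closure Ω) = Ω →
      (∀ z ∈ ellipticBoundary Ω, 0 ≤ normalFlux Ω z) →
      ∀ (M : Triangulation Ω), (∀ t ∈ M.elements, meshSize t ≤ 1) →
      ∀ (p : ℕ), 1 ≤ p →
      ∀ (Cinv CINV : ℝ), 0 < Cinv → 0 < CINV →
      (∀ t ∈ M.elements, TraceInverse Cinv p t) →
      (∀ t ∈ M.elements, GradInverse CINV p t) →
      ∀ (α β γ δ τ : Affine.Triangle ℝ Plane → ℝ),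
      (∀ t ∈ M.elements, δ t = deltaConst Cinv t * ((p : ℝ) ^ 4 / meshSize t ^ 2)) →
      (∀ t ∈ M.elements, τ t = meshSize t ^ 2 / (4 * CINV ^ 2 * (p : ℝ) ^ 4)) →
      (∀ t ∈ M.elements, α t = (8 * δ t)⁻¹) →
      (∀ t ∈ M.elements, β t = (24 * δ t ^ 2)⁻¹) →
      (∀ t ∈ M.elements, γ t = (64 * δ t ^ 3)⁻¹) →
      ∀ (t₀ t₁ : ℝ) (w w' : ℝ → Plane → ℝ), IsTimeDerivative Ω M p (Set.Ioc t₀ t₁) w w' →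
      ∀ s ∈ Set.Ioc t₀ t₁,
        stabForm Ω M (fun t => !![α t, β t; β t, γ t]) τ (w s) (w' s) (w s) (w' s) ≥
          1 / 4 *
            energyNorm Ω M (fun t => !![α t, β t; β t, γ t]) γ δ τ (w s) (w' s) ^ 2) := by
  exact ⟨exists_inverse_constants, fun _ hΩo hΩ hell M hM _ hp _ _ hCinv hCINV hT hG _ _ _ _ _
    hδ hτ hα hβ hγ _ _ _ _ hw s hs => energyNorm_sq_le_stabForm hΩo hΩ hell M hM hp hCinv hCINV hT hG hδ hτ hα hβ hγ
      (hw s hs).1 (hw s hs).2.1⟩
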